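/- Let $\theta=(\theta_i)_{i\ge 0}$ be a sequence in $[0,\infty)$ with $\sum_{i\ge 0}\theta_i^2=1$ and $\theta_1\ge\theta_2\ge\cdots$. Indices $i$ below range over $\{1,2,\dots\}$. Random ingredients. Let $X=(X_i)$ be independent exponential random variables with rates $\theta_i$ ($X_i=\infty$ if $\theta_i=0$), and let $\mu=\theta_0^2\,dx+\sum_i\theta_i\delta_{X_i}$, a random measure on $[0,\infty)$. Given $X$, let $Y_1<Y_2<\cdots$ be the points of a Poisson point process on $[0,\infty)$ with intensity $\mu[0,l]\,dl$. Given $X$ and $Y$, let $(Z_i)$ be independent random variables, $Z_i$ having law $\mu|_{[0,Y_i]}/\mu[0,Y_i]$. Let $(U_{X,i})$, $(U_{Z,i})$ be independent uniform random variables on $[0,1]$, independent of $(X,Y,Z)$. Tree. Put $Y_0=Z_0=0$. If $Y_1<Y_2<\cdots\to\infty$ and $Z_i\le Y_i$ for all $i$, let $d_{\mathcal T}$ be the metric on $[0,\infty)$ defined recursively on $[0,Y_{n+1}]$, $n\ge 0$, by $d_{\mathcal T}(x,y)=d_{\mathcal T}(x,Z_n)+(y-Y_n)$ for $x\le Y_n<y\le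 Y_{n+1}$ and $d_{\mathcal T}(x,y)=|x-y|$ for $x,y\in(Y_n,Y_{n+1}]$. The $\Theta$-ICRT $\mathcal T$ is the completion of $([0,\infty),d_{\mathcal T})$, rooted at $0$. Angles. An angle function on $\mathcal T$ is a map $U:\mathcal T^2\to[0,1]$, $(x,y)\mapsto U_{x,y}$, with $U_{x,0}=U_{x,x}=0$ for all $x$ and such that, for all $x$ and all $y,z\neq x$, $U_{x,y}=U_{x,z}$ if and only if $y$ and $z$ lie in the same connected component of $\mathcal T\setminus\{x\}$. For $x\in[0,\infty)$ let $x^+$ be the first $Y_a$ ($a\ge1$) with $Y_a>x$. Consider the angle functions $U$ such that $U_{X_i,X_i^+}=U_{X,i}$ for every $i$ with $\theta_i>0$; $U_{Z_i,Y_{i+1}}=U_{Z,i}$ for every $i$; and $U_{x,x^+}=1/2$ for every $x\in[0,\infty)\setminus(\{X_i:\theta_i>0\}\cup\{Y_i\})$. Looptree. Let $\mathfrak c$ be the distance on $[0,1]$ seen as the torus $\mathbb R/\mathbb Z$, and let $U_{x,y,u}=U_{x,y}$ if $x\neq y$ and $U_{x,x,u}=u$. For $(x,u),(y,v)\in\mathcal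 T\times[0,1]$ put $$d_{\mathcal L}((x,u),(y,v))=\frac{\theta_0^2}{4}d_{\mathcal T}(x,y)+\sum_{i\ge1}\theta_i\,\mathfrak c(U_{X_i,x,u},U_{X_i,y,v})\in[0,\infty]$$ (terms with $\theta_i=0$ being $0$), and let $\mathcal L$ be the completion of $(\mathcal T\times[0,1],d_{\mathcal L})$. Theorem. For every such $\theta$, almost surely: $Y_1<Y_2<\cdots\to\infty$ and $Z_i\le Y_i$ for all $i$, so that $\mathcal T$ is well defined; there is exactly one angle function $U$ on $\mathcal T$ with the three properties above; and, for this $U$, $d_{\mathcal L}$ is finite everywhere on $\mathcal T\times[0,1]$ and $\mathcal L$ is compact. -/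

import Mathlib

open MeasureTheory ProbabilityTheory Set Filter
open scoped NNReal ENNReal unitInterval

noncomputable section

namespace ICRT

/-! ### Generic stick-breaking construction

Sequences are indexed from `0`: `y i`, `z i` are the `(i+1)`-st cut and the `(i+1)`-st glue point. -/

/-- `y` is a strictly increasing unbounded sequence of cuts, `z` a sequence of glue points. -/
structure IsStick (y z : ℕ → ℝ≥0) : Prop where
  strictMono : StrictMono y
  tendsto : Tendsto y atTop atTop
  le : ∀ i, z i ≤ y i

/-- `a` preceded by `0`: the convention that the zeroth cut and the zeroth glue point are `0`. -/
def withZero (a : ℕ → ℝ≥0) : ℕ → ℝ≥0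
  | 0 => 0
  | n + 1 => a n

/-- The metric on `[0, withZero y n]` obtained after gluing `n` branches: the branch
`(withZero y n, withZero y (n + 1)]` is glued at position `withZero z n`.
(Only the values at points of `[0, withZero y n]` are relevant.) -/
def stickDistAux (y z : ℕ → ℝ≥0) : ℕ → ℝ≥0 → ℝ≥0 → ℝ
  | 0, _, _ => 0
  | n + 1, s, t =>
    if s ≤ withZero y n then
      if t ≤ withZero y n then stickDistAux y z n s t
      else stickDistAux y z n s (withZero z n) + ((t : ℝ) - withZero y n)
    else
      if t ≤ withZero y n then stickDistAux y z n t (withZero z n) + ((s : ℝ) - withZero y n)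
      else |(s : ℝ) - t|

/-- The stick-breaking metric on `[0, ∞)`: it agrees with `stickDistAux y z n` on
`[0, withZero y n]` for every `n`, see `stickDist_eq`. -/
def stickDist (y z : ℕ → ℝ≥0) (s t : ℝ≥0) : ℝ :=
  stickDistAux y z (sInf {n | s ≤ withZero y n ∧ t ≤ withZero y n}) s t

section Metric

variable {y z : ℕ → ℝ≥0}

theorem IsStick.mono (h : IsStick y z) : Monotone (withZero y) := by
  refine monotone_nat_of_le_succ ?_
  rintro (_ | n)
  · exact zero_le
  · exact h.strictMono.monotone (Nat.le_succ n)

theorem IsStick.glue_le (h : IsStick y z) (n : ℕ) : withZero z n ≤ withZero y n := by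
  cases n with
  | zero => exact le_rfl
  | succ n => exact h.le n

theorem IsStick.exists_le (h : IsStick y z) (s : ℝ≥0) : ∃ n, s ≤ withZero y n := by
  obtain ⟨n, hn⟩ := (h.tendsto.eventually_ge_atTop s).exists
  exact ⟨n + 1, hn⟩

theorem stickDistAux_succ_of_le {n : ℕ} {s t : ℝ≥0} (hs : s ≤ withZero y n)
    (ht : t ≤ withZero y n) : stickDistAux y z (n + 1) s t = stickDistAux y z n s t := by
  simp [stickDistAux, hs, ht]

theorem IsStick.aux_eq (h : IsStick y z) {m n : ℕ} (hmn : m ≤ n) {s t : ℝ≥0}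
    (hs : s ≤ withZero y m) (ht : t ≤ withZero y m) :
    stickDistAux y z n s t = stickDistAux y z m s t := by
  induction n, hmn using Nat.le_induction with
  | base => rfl
  | succ n hmn ih =>
    rw [stickDistAux_succ_of_le (hs.trans (h.mono hmn)) (ht.trans (h.mono hmn)), ih]

theorem IsStick.stickDist_eq (h : IsStick y z) {n : ℕ} {s t : ℝ≥0}
    (hs : s ≤ withZero y n) (ht : t ≤ withZero y n) :
    stickDist y z s t = stickDistAux y z n s t := by
  have hmem := Nat.sInf_mem (s := {n | s ≤ withZero y n ∧ t ≤ withZero y n}) ⟨n, hs, ht⟩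
  have hle := Nat.sInf_le (s := {n | s ≤ withZero y n ∧ t ≤ withZero y n}) ⟨hs, ht⟩
  exact (h.aux_eq hle hmem.1 hmem.2).symm

theorem IsStick.aux_metric (h : IsStick y z) (n : ℕ) :
    (∀ s, s ≤ withZero y n → stickDistAux y z n s s = 0) ∧
    (∀ s t, s ≤ withZero y n → t ≤ withZero y n →
      stickDistAux y z n s t = stickDistAux y z n t s) ∧
    (∀ s t u, s ≤ withZero y n → t ≤ withZero y n → u ≤ withZero y n →
      stickDistAux y z n s u ≤ stickDistAux y z n s t + stickDistAux y z n t u) ∧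
    (∀ s t, s ≤ withZero y n → t ≤ withZero y n → 0 ≤ stickDistAux y z n s t) ∧
    (∀ s t, s ≤ withZero y n → t ≤ withZero y n → stickDistAux y z n s t = 0 → s = t) := by
  induction n with
  | zero =>
    refine ⟨fun _ _ => rfl, fun _ _ _ _ => rfl, fun _ _ _ _ _ _ => by simp [stickDistAux],
      fun _ _ _ _ => le_rfl, fun s t hs ht _ => ?_⟩
    simp only [withZero, nonpos_iff_eq_zero] at hs ht
    rw [hs, ht]
  | succ n ih =>
    obtain ⟨ih0, ihs, iht, ihp, ihe⟩ := ih
    have hg := h.glue_le n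
    have key : ∀ s : ℝ≥0, ¬ s ≤ withZero y n → (0 : ℝ) < (s : ℝ) - withZero y n := by
      intro s hs
      have : (withZero y n : ℝ) < s := by exact_mod_cast not_le.1 hs
      linarith
    refine ⟨?_, ?_, ?_, ?_, ?_⟩
    · intro s _
      by_cases hs : s ≤ withZero y n <;> simp [stickDistAux, hs, ih0]
    · intro s t _ _
      by_cases hs : s ≤ withZero y n <;> by_cases ht : t ≤ withZero y n <;>
        simp [stickDistAux, hs, ht]
      · exact ihs s t hs ht
      · exact abs_sub_comm _ _
    · intro s t u _ _ _
      by_cases hs : s ≤ withZero y n <;> by_cases ht : t ≤ withZero y n <;>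
        by_cases hu : u ≤ withZero y n <;> simp only [stickDistAux, hs, ht, hu, if_true, if_false]
      · exact iht s t u hs ht hu
      · linarith [iht s t _ hs ht hg]
      · linarith [iht s _ u hs hg hu, ihs u _ hu hg, key t ht]
      · have := le_abs_self ((u : ℝ) - t)
        rw [abs_sub_comm] at this
        linarith
      · linarith [iht u t _ hu ht hg, ihs u t hu ht]
      · have h1 := abs_le.2 ⟨(by linarith [key s hs, key u hu] :
          -(((s : ℝ) - withZero y n) + (u - withZero y n)) ≤ (s : ℝ) - u),
          (by linarith [key s hs, key u hu])⟩
        linarith [ihp t _ ht hg]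
      · linarith [le_abs_self ((s : ℝ) - t)]
      · exact abs_sub_le _ _ _
    · intro s t _ _
      by_cases hs : s ≤ withZero y n <;> by_cases ht : t ≤ withZero y n <;>
        simp only [stickDistAux, hs, ht, if_true, if_false]
      · exact ihp s t hs ht
      · linarith [ihp s _ hs hg, key t ht]
      · linarith [ihp t _ ht hg, key s hs]
      · exact abs_nonneg _
    · intro s t _ _
      by_cases hs : s ≤ withZero y n <;> by_cases ht : t ≤ withZero y n <;>
        simp only [stickDistAux, hs, ht, if_true, if_false]
      · exact ihe s t hs ht
      · intro h0; linarith [ihp s _ hs hg, key t ht]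
      · intro h0; linarith [ihp t _ ht hg, key s hs]
      · intro h0
        exact NNReal.coe_injective (sub_eq_zero.1 (abs_eq_zero.1 h0))

/-- The half-line `[0, ∞)`, to be equipped with the stick-breaking metric. -/
@[ext]
structure StickLine (h : IsStick y z) where
  pos : ℝ≥0

instance (h : IsStick y z) : MetricSpace (StickLine h) where
  dist s t := stickDist y z s.pos t.pos
  dist_self s := by
    obtain ⟨n, hn⟩ := h.exists_le s.pos
    rw [h.stickDist_eq hn hn]
    exact (h.aux_metric n).1 _ hn
  dist_comm s t := by
    obtain ⟨n, hn⟩ := h.exists_le (max s.pos t.pos)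
    obtain ⟨hs, ht⟩ := max_le_iff.1 hn
    rw [h.stickDist_eq hs ht, h.stickDist_eq ht hs]
    exact (h.aux_metric n).2.1 _ _ hs ht
  dist_triangle s t u := by
    obtain ⟨n, hn⟩ := h.exists_le (max (max s.pos t.pos) u.pos)
    obtain ⟨hst, hu⟩ := max_le_iff.1 hn
    obtain ⟨hs, ht⟩ := max_le_iff.1 hst
    rw [h.stickDist_eq hs ht, h.stickDist_eq ht hu, h.stickDist_eq hs hu]
    exact (h.aux_metric n).2.2.1 _ _ _ hs ht hu
  eq_of_dist_eq_zero := by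
    intro s t hst
    obtain ⟨n, hn⟩ := h.exists_le (max s.pos t.pos)
    obtain ⟨hs, ht⟩ := max_le_iff.1 hn
    change stickDist y z s.pos t.pos = 0 at hst
    rw [h.stickDist_eq hs ht] at hst
    exact StickLine.ext ((h.aux_metric n).2.2.2.2 _ _ hs ht hst)

/-- The stick-breaking tree: the completion of `[0, ∞)` for the stick-breaking metric. -/
abbrev Tree (h : IsStick y z) : Type := UniformSpace.Completion (StickLine h)

/-- The vertex of the tree given by a point of the half-line. -/
def vertex (h : IsStick y z) (s : ℝ≥0) : Tree h := ((⟨s⟩ : StickLine h) : Tree h)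

end Metric

/-! ### Angle functions -/

/-- Angle functions on a tree `T` with root `ρ`. -/
structure IsAngleFunction {T : Type*} [TopologicalSpace T] (ρ : T) (U : T → T → I) : Prop where
  root : ∀ x, U x ρ = 0
  self : ∀ x, U x x = 0
  eq_iff : ∀ x y z, y ≠ x → z ≠ x → (U x y = U x z ↔ z ∈ connectedComponentIn {x}ᶜ y)

/-- The first cut after position `s`, i.e. the end of the branch which contains `s`
(when `s` is not itself a cut). -/
def nextCut (y : ℕ → ℝ≥0) (s : ℝ≥0) : ℝ≥0 := y (sInf {a | s < y a})

/-- The conditions prescribing the angle function of the plane tree. The atom `x i` of weight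
`θ (i + 1)` is disregarded when `θ (i + 1) = 0` (an exponential variable of parameter `0` is `∞`).
-/
structure IsUniformAngle (θ : ℕ → ℝ≥0) (x : ℕ → ℝ≥0) {y z : ℕ → ℝ≥0} (h : IsStick y z)
    (uX uZ : ℕ → I) (U : Tree h → Tree h → I) : Prop where
  angle : IsAngleFunction (vertex h 0) U
  atom : ∀ i, 0 < θ (i + 1) → U (vertex h (x i)) (vertex h (nextCut y (x i))) = uX i
  glue : ∀ i, U (vertex h (z i)) (vertex h (y (i + 1))) = uZ i
  other : ∀ s, (∀ i, 0 < θ (i + 1) → s ≠ x i) → (∀ i, s ≠ y i) →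
    (U (vertex h s) (vertex h (nextCut y s)) : ℝ) = 1 / 2

/-! ### The looptree -/

/-- The set `T × [0,1]`, to be equipped with the looptree pseudo-distance. -/
structure PreLooptree (θ : ℕ → ℝ≥0) (x : ℕ → ℝ≥0) {y z : ℕ → ℝ≥0} (h : IsStick y z)
    (U : Tree h → Tree h → I) where
  vert : Tree h
  ang : I

open Classical in
/-- `U_{x,w,u}`: the angle `U x w` if `x ≠ w`, and `u` otherwise. -/
def extAngle {T : Type*} (U : T → T → I) (x w : T) (u : I) : I :=
  if x = w then u else U x w

/-- The distance on `[0,1]` seen as the torus `ℝ / ℤ`. -/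
def torusEDist (u v : I) : ℝ≥0∞ := edist ((u : ℝ) : UnitAddCircle) ((v : ℝ) : UnitAddCircle)

/-- The looptree pseudo-distance on `T × [0,1]`, a priori with values in `[0,∞]`. -/
def loopEDist {θ : ℕ → ℝ≥0} {x : ℕ → ℝ≥0} {y z : ℕ → ℝ≥0} {h : IsStick y z}
    {U : Tree h → Tree h → I} (α β : PreLooptree θ x h U) : ℝ≥0∞ :=
  ((θ 0 ^ 2 / 4 : ℝ≥0) : ℝ≥0∞) * edist α.vert β.vert +
    ∑' i, (θ (i + 1) : ℝ≥0∞) * torusEDist (extAngle U (vertex h (x i)) α.vert α.ang)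
      (extAngle U (vertex h (x i)) β.vert β.ang)

instance (θ : ℕ → ℝ≥0) (x : ℕ → ℝ≥0) {y z : ℕ → ℝ≥0} (h : IsStick y z)
    (U : Tree h → Tree h → I) : PseudoEMetricSpace (PreLooptree θ x h U) where
  edist := loopEDist
  edist_self α := by simp [loopEDist, torusEDist]
  edist_comm α β := by simp only [loopEDist, torusEDist, edist_comm]
  edist_triangle α β γ := by
    simp only [loopEDist, torusEDist]
    rw [add_add_add_comm, ← mul_add, ← ENNReal.tsum_add]
    refine add_le_add ?_ (ENNReal.tsum_le_tsum fun i => ?_)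
    · gcongr
      exact edist_triangle _ _ _
    · rw [← mul_add]
      gcongr
      exact edist_triangle _ _ _

/-- The looptree: the completion of `T × [0,1]` for the looptree pseudo-distance. -/
abbrev Looptree (θ : ℕ → ℝ≥0) (x : ℕ → ℝ≥0) {y z : ℕ → ℝ≥0} (h : IsStick y z)
    (U : Tree h → Tree h → I) : Type :=
  UniformSpace.Completion (PreLooptree θ x h U)

/-! ### The random ingredients -/

/-- The parameter set of ICRTs: `θ 0` is the Brownian part, `θ 1 ≥ θ 2 ≥ …` are the weights of the
atoms. -/
structure IsParameter (θ : ℕ → ℝ≥0) : Prop where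
  hasSum : HasSum (fun i => θ i ^ 2) 1
  antitone : Antitone fun i => θ (i + 1)

/-- Lebesgue measure on `[0, ∞)`. -/
def lebesgue : Measure ℝ≥0 := (volume : Measure ℝ).comap ((↑) : ℝ≥0 → ℝ)

/-- The measure `μ = θ₀² dx + ∑ θᵢ δ_{Xᵢ}` on `[0, ∞)`; `x i` has weight `θ (i + 1)`. -/
def massMeasure (θ : ℕ → ℝ≥0) (x : ℕ → ℝ≥0) : Measure ℝ≥0 :=
  (θ 0 ^ 2) • lebesgue + Measure.sum fun i => θ (i + 1) • Measure.dirac (x i)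

/-- `Q` is the law of the increasing enumeration of a Poisson point process on `[0, ∞)` with
intensity measure `ν`: the numbers of points in disjoint sets of finite intensity are independent
Poisson variables whose parameters are the intensities of the sets. -/
structure IsPoissonLaw (ν : Measure ℝ≥0) (Q : Measure (ℕ → ℝ≥0)) : Prop where
  strictMono : ∀ᵐ y ∂Q, StrictMono y
  count : ∀ (n : ℕ) (B : Fin n → Set ℝ≥0), (∀ j, MeasurableSet (B j)) →
    (∀ i j, i ≠ j → Disjoint (B i) (B j)) → (∀ j, ν (B j) ≠ ∞) → ∀ k : Fin n → ℕ,
      Q {y | ∀ j, {i | y i ∈ B j}.encard = k j} =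
        ∏ j, poissonMeasure (ν (B j)).toNNReal {k j}

/-- The joint law of the variables from which the plane ICRT of parameter `θ` is built:
* the `X i` are independent, exponential of parameter `θ (i + 1)`
  (no condition on the law of `X i`, which is then irrelevant, if `θ (i + 1) = 0`);
* given `X`, `Y` is a Poisson point process of rate `μ[0,l] dl`, in increasing order;
* given `X` and `Y`, the `Z i` are independent with laws `μ` conditioned to `[0, Y i]`;
* the angles `UX i`, `UZ i` are independent, uniform, and independent of `(X, Y, Z)`. -/
structure IsPlaneICRT {Ω : Type*} [MeasurableSpace Ω] (P : Measure Ω) [IsProbabilityMeasure P]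
    (θ : ℕ → ℝ≥0) (X Y Z : Ω → ℕ → ℝ≥0) (UX UZ : Ω → ℕ → I) : Prop where
  measurable_X : Measurable X
  measurable_Y : Measurable Y
  measurable_Z : Measurable Z
  measurable_UX : Measurable UX
  measurable_UZ : Measurable UZ
  indep_X : iIndepFun (fun i ω => X ω i) P
  law_X : ∀ i, 0 < θ (i + 1) → P.map (fun ω => (X ω i : ℝ)) = expMeasure (θ (i + 1))
  law_Y : ∀ᵐ x ∂(P.map X),
    IsPoissonLaw (lebesgue.withDensity fun l => massMeasure θ x (Iic l)) (condDistrib Y X P x)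
  indep_Z : ∀ᵐ q ∂(P.map fun ω => (X ω, Y ω)),
    iIndepFun (fun i (z : ℕ → ℝ≥0) => z i) (condDistrib Z (fun ω => (X ω, Y ω)) P q)
  law_Z : ∀ᵐ q ∂(P.map fun ω => (X ω, Y ω)), ∀ i,
    (condDistrib Z (fun ω => (X ω, Y ω)) P q).map (fun z => z i) =
      (massMeasure θ q.1)[|Iic (q.2 i)]
  indep_U : iIndepFun (fun (j : ℕ ⊕ ℕ) ω => Sum.elim (UX ω) (UZ ω) j) P
  law_UX : ∀ i, P.map (fun ω => UX ω i) = volume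
  law_UZ : ∀ i, P.map (fun ω => UZ ω i) = volume
  indep : IndepFun (fun ω => (X ω, Y ω, Z ω)) (fun ω => (UX ω, UZ ω)) P

end ICRT

end

open MeasureTheory ProbabilityTheory Set Filter
open scoped NNReal ENNReal unitInterval

noncomputable section

namespace ICRT

/-! ### Metric geometry of the stick-breaking tree and the sides of its points. -/

section TreeGeometry

open scoped Topology

variable {y z : ℕ → ℝ≥0}

/-! ### Geometry of the stick-breaking tree -/

/-! Angles. Gluing a segment preserves the four-point condition, which then passes to the completion
(`four_point`). Hence "`x` is not between `w` and `w'`" (`SameSide`) is an equivalence relation off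
`x`. Its classes are open and connected, so they are the components of the punctured tree
(`connectedComponentIn_compl_singleton`). Seen from a point `r` of the half-line, they are the side
of the root, the side of the end of the branch containing `r` when `r` is not a cut, and one side
for each branch glued at `r` (`sameSide_cases`). A point of the completion outside the half-line has
a single side. The root side must get the angle `0` and every other side receives exactly one
prescribed angle. Almost surely these are nonzero and distinct at each point, which gives existence
and uniqueness.

Compactness, given the masses of branches. Moving from a point of a branch to its glue point costs
at most the `μ`-mass of the path: an atom off the path sees both ends on the same side, and the
angle at the glue point can be chosen so that an atom sitting there costs nothing (`edist_glue_le`).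
So the distance to the tree of stage `n` is at most a sum of branch masses along a line of ancestors
(`height`). Given atoms and cuts, the parent of a branch is chosen with probability proportional to
its mass, as in a weighted recursive tree. If the branches of index at least `64 ^ k` have mass at
most `8 / 2 ^ k`, exponential moments (`lintegral_exp_height_le`) and Borel–Cantelli bound the
heights between the stages `64 ^ k` and `64 ^ (k + 1)` by `160 * k / 2 ^ k`. This is summable.
Finite stages being totally bounded, so is the half-line; lower semicontinuity reaches the rest of
the completion (`exists_edist_le_of_totallyBounded`).

Masses of branches. Beyond `4 ^ k`, use cells of length `2 ^ k / scale θ (4 ^ k)`, where `scale` is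
comparable with the mean of `μ[0, l]`. A Chernoff bound gives every relevant cell mass at most `4 /
2 ^ k`. Also `μ[0, 4 ^ k]` is at least `scale θ (4 ^ k) / (K * (k + 1))`, so the Poisson cuts miss a
cell with probability at most `exp (-2 ^ k / (K * (k + 1)))`: the scale cancels, and no growth
condition on `θ` is needed. Every cell being hit, a branch meets at most two cells. Finally `μ[0, 4
^ k] ≤ 8 ^ k` bounds the number of cuts before `4 ^ k`, which turns positions into indices
(`IsRegular.eventually_massMeasure_branch_le`). -/

theorem dist_vertex (h : IsStick y z) (s t : ℝ≥0) :
    dist (vertex h s) (vertex h t) = stickDist y z s t :=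
  UniformSpace.Completion.dist_eq _ _

theorem IsStick.stickDist_comm (h : IsStick y z) (s t : ℝ≥0) :
    stickDist y z s t = stickDist y z t s :=
  dist_comm (⟨s⟩ : StickLine h) ⟨t⟩

theorem IsStick.stickDist_self (h : IsStick y z) (s : ℝ≥0) : stickDist y z s s = 0 :=
  dist_self (⟨s⟩ : StickLine h)

theorem IsStick.stickDist_nonneg (h : IsStick y z) (s t : ℝ≥0) : 0 ≤ stickDist y z s t :=
  dist_nonneg (x := (⟨s⟩ : StickLine h)) (y := ⟨t⟩)

theorem IsStick.stickDist_triangle (h : IsStick y z) (s t u : ℝ≥0) :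
    stickDist y z s u ≤ stickDist y z s t + stickDist y z t u :=
  dist_triangle (⟨s⟩ : StickLine h) ⟨t⟩ ⟨u⟩

theorem IsStick.stickDist_pos (h : IsStick y z) {s t : ℝ≥0} (hst : s ≠ t) :
    0 < stickDist y z s t :=
  dist_pos.2 fun e : (⟨s⟩ : StickLine h) = ⟨t⟩ => hst (congrArg StickLine.pos e)

theorem vertex_injective (h : IsStick y z) : Function.Injective (vertex h) := by
  intro s t hst
  by_contra hne
  have := h.stickDist_pos hne
  rw [← dist_vertex h, hst, dist_self] at this
  exact lt_irrefl _ this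

theorem denseRange_vertex (h : IsStick y z) : DenseRange (vertex h) := by
  have := UniformSpace.Completion.denseRange_coe (α := StickLine h)
  refine this.mono ?_
  rintro _ ⟨⟨s⟩, rfl⟩
  exact ⟨s, rfl⟩

theorem IsStick.stickDist_old_new (h : IsStick y z) {n : ℕ} {s t : ℝ≥0} (hs : s ≤ withZero y n)
    (ht : withZero y n < t) (ht' : t ≤ withZero y (n + 1)) :
    stickDist y z s t = stickDist y z s (withZero z n) + ((t : ℝ) - withZero y n) := by
  rw [h.stickDist_eq (hs.trans (h.mono n.le_succ)) ht', h.stickDist_eq hs (h.glue_le n)]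
  simp [stickDistAux, hs, ht.not_ge]

theorem IsStick.stickDist_same (h : IsStick y z) {n : ℕ} {s t : ℝ≥0} (hs : withZero y n < s)
    (hs' : s ≤ withZero y (n + 1)) (ht : withZero y n < t) (ht' : t ≤ withZero y (n + 1)) :
    stickDist y z s t = |(s : ℝ) - t| := by
  rw [h.stickDist_eq hs' ht']
  simp [stickDistAux, hs.not_ge, ht.not_ge]

theorem IsStick.exists_branch (h : IsStick y z) {s : ℝ≥0} (hs : 0 < s) :
    ∃ n, withZero y n < s ∧ s ≤ withZero y (n + 1) := by
  classical
  have hex := h.exists_le s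
  obtain ⟨n, hn⟩ : ∃ n, Nat.find hex = n + 1 := by
    refine Nat.exists_eq_succ_of_ne_zero fun h0 => ?_
    have := Nat.find_spec hex
    rw [h0] at this
    exact hs.not_ge this
  exact ⟨n, not_le.1 (Nat.find_min hex (by omega)), hn ▸ Nat.find_spec hex⟩

/-- Induction along branches. -/
theorem IsStick.branch_induction (h : IsStick y z) {p : ℝ≥0 → Prop} (h0 : p 0)
    (hstep : ∀ n s, withZero y n < s → s ≤ withZero y (n + 1) → (∀ t ≤ withZero y n, p t) → p s)
    (s : ℝ≥0) : p s := by
  obtain ⟨n, hn⟩ := h.exists_le s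
  induction n generalizing s with
  | zero =>
    obtain rfl : s = 0 := le_antisymm hn zero_le
    exact h0
  | succ n ih =>
    rcases le_or_gt s (withZero y n) with hs | hs
    · exact ih s hs
    · exact hstep n s hs hn fun t ht => ih t ht

/-- The four-point condition on the real line, used when at least three of the four points share the
last branch. -/
theorem abs_four_point (a b c d : ℝ) :
    |a - c| + |b - d| ≤ max (|a - b| + |c - d|) (|b - c| + |a - d|) := by
  rw [le_max_iff]
  by_contra! hcon
  cases abs_cases (a - c) <;> cases abs_cases (b - d) <;> cases abs_cases (a - b) <;>
    cases abs_cases (c - d) <;> cases abs_cases (b - c) <;> cases abs_cases (a - d) <;> linarith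

/-- Induction on the number of branches, according to which points are on the new one. A single new
point can be replaced by the glue point `c`, all sums changing by the same amount. With two new
points, one of the sums on the right dominates directly or through the case of older points. With
three or four, everything embeds in a line. -/
theorem IsStick.four_point_aux (h : IsStick y z) (n : ℕ) : ∀ s t u x, s ≤ withZero y n →
    t ≤ withZero y n → u ≤ withZero y n → x ≤ withZero y n →
    stickDist y z s u + stickDist y z t x ≤
      max (stickDist y z s t + stickDist y z u x) (stickDist y z t u + stickDist y z s x) := by
  induction n with
  | zero =>
    intro s t u x hs ht hu hx
    obtain rfl : s = 0 := le_antisymm hs zero_le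
    obtain rfl : t = 0 := le_antisymm ht zero_le
    obtain rfl : u = 0 := le_antisymm hu zero_le
    obtain rfl : x = 0 := le_antisymm hx zero_le
    simp
  | succ n ih =>
    intro s t u x hs' ht' hu' hx'
    set c := withZero z n
    have hc : c ≤ withZero y n := h.glue_le n
    have hnew : ∀ {s}, ¬ s ≤ withZero y n → (0 : ℝ) < (s : ℝ) - withZero y n := by
      intro s hs
      have : (withZero y n : ℝ) < s := by exact_mod_cast not_le.1 hs
      linarith
    have hon : ∀ {s t}, s ≤ withZero y n → ¬ t ≤ withZero y n → t ≤ withZero y (n + 1) →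
        stickDist y z s t = stickDist y z s c + ((t : ℝ) - withZero y n) :=
      fun hs ht ht' => h.stickDist_old_new hs (not_le.1 ht) ht'
    have hno : ∀ {s t}, s ≤ withZero y n → ¬ t ≤ withZero y n → t ≤ withZero y (n + 1) →
        stickDist y z t s = stickDist y z s c + ((t : ℝ) - withZero y n) :=
      fun hs ht ht' => by rw [h.stickDist_comm]; exact hon hs ht ht'
    have hnn : ∀ {s t}, ¬ s ≤ withZero y n → s ≤ withZero y (n + 1) → ¬ t ≤ withZero y n →
        t ≤ withZero y (n + 1) → stickDist y z s t = |(s : ℝ) - t| :=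
      fun hs hs' ht ht' => h.stickDist_same (not_le.1 hs) hs' (not_le.1 ht) ht'
    -- Seen from the new branch, an old point `p` is at the distances of a point of the line
    -- extending the branch backwards beyond `c`, by the distance from `p` to `c`.
    have habs : ∀ p {s}, ¬ s ≤ withZero y n →
        |(s : ℝ) - (withZero y n - stickDist y z p c)| =
          stickDist y z p c + ((s : ℝ) - withZero y n) := fun p s hs => by
      rw [abs_of_nonneg (by linarith [hnew hs, h.stickDist_nonneg p c])]
      ring
    have habs' : ∀ p {s}, ¬ s ≤ withZero y n →
        |(withZero y n - stickDist y z p c) - (s : ℝ)| =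
          stickDist y z p c + ((s : ℝ) - withZero y n) := fun p s hs => by
      rw [abs_sub_comm, habs p hs]
    by_cases hs : s ≤ withZero y n <;> by_cases ht : t ≤ withZero y n <;>
      by_cases hu : u ≤ withZero y n <;> by_cases hx : x ≤ withZero y n
    · exact ih s t u x hs ht hu hx
    · rw [hon ht hx hx', hon hu hx hx', hon hs hx hx', ← add_assoc, ← add_assoc, ← add_assoc,
        max_add_add_right]
      exact add_le_add_left (ih s t u c hs ht hu hc) _
    · rw [hon hs hu hu', hno hx hu hu', hon ht hu hu']
      have := ih s t c x hs ht hc hx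
      rw [h.stickDist_comm c x] at this
      rcases le_max_iff.1 this with h1 | h1
      · exact le_max_of_le_left (by linarith)
      · exact le_max_of_le_right (by linarith)
    · rw [hon hs hu hu', hon ht hx hx', hnn hu hu' hx hx', hon ht hu hu', hon hs hx hx']
      exact le_max_of_le_right (by linarith)
    · rw [hon hs ht ht', hno hx ht ht', hno hu ht ht']
      have := ih s c u x hs hc hu hx
      rw [h.stickDist_comm c x, h.stickDist_comm c u] at this
      rcases le_max_iff.1 this with h1 | h1
      · exact le_max_of_le_left (by linarith)
      · exact le_max_of_le_right (by linarith)
    · rw [hnn ht ht' hx hx', hon hs ht ht', hon hu hx hx', hno hu ht ht', hon hs hx hx']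
      refine le_max_of_le_left ?_
      have := abs_le.2 ⟨(by linarith [hnew ht, hnew hx] :
          -(((t : ℝ) - withZero y n) + (x - withZero y n)) ≤ (t : ℝ) - x),
          (by linarith [hnew ht, hnew hx])⟩
      have := h.stickDist_triangle s c u
      rw [h.stickDist_comm c u] at this
      linarith
    · rw [hon hs hu hu', hno hx ht ht', hon hs ht ht', hno hx hu hu', hnn ht ht' hu hu']
      exact le_max_of_le_left (by linarith)
    · have := abs_four_point (withZero y n - stickDist y z s c) t u x
      rwa [hon hs hu hu', hnn ht ht' hx hx', hon hs ht ht', hnn hu hu' hx hx', hnn ht ht' hu hu',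
        hon hs hx hx', ← habs' s hu, ← habs' s ht, ← habs' s hx]
    · rw [hno hu hs hs', hno ht hs hs', hno hx hs hs']
      have := ih c t u x hc ht hu hx
      rw [h.stickDist_comm c x, h.stickDist_comm c u, h.stickDist_comm c t] at this
      rcases le_max_iff.1 this with h1 | h1
      · exact le_max_of_le_left (by linarith)
      · exact le_max_of_le_right (by linarith)
    · rw [hno hu hs hs', hon ht hx hx', hno ht hs hs', hon hu hx hx', hnn hs hs' hx hx']
      exact le_max_of_le_left (by linarith)
    · rw [hnn hs hs' hu hu', hno ht hs hs', hno hx hu hu', hon ht hu hu', hno hx hs hs']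
      refine le_max_of_le_left ?_
      have := abs_le.2 ⟨(by linarith [hnew hs, hnew hu] :
          -(((s : ℝ) - withZero y n) + (u - withZero y n)) ≤ (s : ℝ) - u),
          (by linarith [hnew hs, hnew hu])⟩
      have := h.stickDist_triangle t c x
      rw [h.stickDist_comm c x] at this
      linarith
    · have := abs_four_point s (withZero y n - stickDist y z t c) u x
      rwa [hnn hs hs' hu hu', hon ht hx hx', hno ht hs hs', hnn hu hu' hx hx', hon ht hu hu',
        hnn hs hs' hx hx', ← habs' t hu, ← habs t hs, ← habs' t hx]
    · rw [hno hu hs hs', hno hx ht ht', hnn hs hs' ht ht', hno hu ht ht', hno hx hs hs']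
      exact le_max_of_le_right (by linarith)
    · have := abs_four_point s t (withZero y n - stickDist y z u c) x
      rwa [hno hu hs hs', hnn ht ht' hx hx', hnn hs hs' ht ht', hon hu hx hx', hno hu ht ht',
        hnn hs hs' hx hx', ← habs u hs, ← habs u ht, ← habs' u hx]
    · have := abs_four_point s t u (withZero y n - stickDist y z x c)
      rwa [hnn hs hs' hu hu', hno hx ht ht', hnn hs hs' ht ht', hno hx hu hu', hnn ht ht' hu hu',
        hno hx hs hs', ← habs x hs, ← habs x ht, ← habs x hu]
    · rw [hnn hs hs' hu hu', hnn ht ht' hx hx', hnn hs hs' ht ht', hnn hu hu' hx hx',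
        hnn ht ht' hu hu', hnn hs hs' hx hx']
      exact abs_four_point _ _ _ _

theorem IsStick.four_point (h : IsStick y z) (s t u x : ℝ≥0) :
    stickDist y z s u + stickDist y z t x ≤
      max (stickDist y z s t + stickDist y z u x) (stickDist y z t u + stickDist y z s x) := by
  obtain ⟨n, hn⟩ := h.exists_le (max (max s t) (max u x))
  simp only [max_le_iff] at hn
  exact h.four_point_aux n s t u x hn.1.1 hn.1.2 hn.2.1 hn.2.2

theorem four_point (h : IsStick y z) (s t u x : Tree h) :
    dist s u + dist t x ≤ max (dist s t + dist u x) (dist t u + dist s x) := by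
  have hd := denseRange_vertex h
  refine hd.induction_on s ?_ fun s => hd.induction_on t ?_ fun t => hd.induction_on u ?_ fun u =>
    hd.induction_on x ?_ fun x => ?_
  · exact isClosed_le (by fun_prop) (by fun_prop)
  · exact isClosed_le (by fun_prop) (by fun_prop)
  · exact isClosed_le (by fun_prop) (by fun_prop)
  · exact isClosed_le (by fun_prop) (by fun_prop)
  · simp only [dist_vertex]
    exact h.four_point s t u x

/-! ### Connected components of a punctured tree -/

/-- `w` and `w'` lie on the same side of `x`: `x` is not on the path from `w` to `w'`. -/
def SameSide {T : Type*} [Dist T] (x w w' : T) : Prop := dist w w' < dist w x + dist x w'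

theorem SameSide.symm {T : Type*} [PseudoMetricSpace T] {x w w' : T} (hw : SameSide x w w') :
    SameSide x w' w := by
  unfold SameSide at *
  rw [dist_comm w' w, dist_comm w' x, dist_comm x w]
  linarith

theorem SameSide.ne_left {T : Type*} [PseudoMetricSpace T] {x w w' : T} (hw : SameSide x w w') :
    w ≠ x := by
  rintro rfl
  simp [SameSide] at hw

theorem SameSide.ne_right {T : Type*} [PseudoMetricSpace T] {x w w' : T}
    (hw : SameSide x w w') : w' ≠ x := hw.symm.ne_left

theorem sameSide_self {T : Type*} [MetricSpace T] {x w : T} (hw : w ≠ x) : SameSide x w w := by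
  have := dist_pos.2 hw
  simp only [SameSide, dist_self]
  linarith [dist_comm x w]

/-- The four-point condition applied to `s, t, u, x`: either sum of its right-hand side is smaller
than the sum of the three distances to `x`, and subtracting the distance from `t` to `x` concludes.
-/
theorem SameSide.trans {h : IsStick y z} {x s t u : Tree h} (hst : SameSide x s t)
    (htu : SameSide x t u) : SameSide x s u := by
  unfold SameSide at *
  have h4 := four_point h s t u x
  have := dist_comm t x
  have := dist_comm u x
  rcases le_max_iff.1 h4 with h1 | h1 <;> linarith

theorem isOpen_sameSide {T : Type*} [PseudoMetricSpace T] (x w : T) :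
    IsOpen {w' | SameSide x w w'} :=
  isOpen_lt (by fun_prop) (by fun_prop)

/-- The parametrization of the `n`-th branch, from its glue point, by arc length. -/
def branchPoint (h : IsStick y z) (n : ℕ) (a : ℝ) : StickLine h :=
  if a ≤ 0 then ⟨withZero z n⟩ else ⟨withZero y n + Real.toNNReal a⟩

/-- One formula down to `a = 0`: the parametrization starts at the glue point, since the position
`withZero y n` belongs to the earlier tree. -/
theorem dist_branchPoint_old (h : IsStick y z) {n : ℕ} {a : ℝ} (ha : 0 ≤ a)
    (ha' : a ≤ withZero y (n + 1) - withZero y n) {s : ℝ≥0} (hs : s ≤ withZero y n) :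
    dist (⟨s⟩ : StickLine h) (branchPoint h n a) = stickDist y z s (withZero z n) + a := by
  unfold branchPoint
  split_ifs with h0
  · obtain rfl : a = 0 := le_antisymm h0 ha
    rw [add_zero]
    rfl
  · have hpos : 0 < a := not_le.1 h0
    have := h.stickDist_old_new hs (t := withZero y n + Real.toNNReal a)
      (lt_add_of_pos_right _ (Real.toNNReal_pos.2 hpos))
      (by rw [← NNReal.coe_le_coe]; push_cast; rw [Real.coe_toNNReal _ ha]; linarith)
    refine this.trans ?_
    push_cast
    rw [Real.coe_toNNReal _ ha]
    ring

theorem branchPoint_sub (h : IsStick y z) {n : ℕ} {s : ℝ≥0} (hs : withZero y n < s) :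
    branchPoint h n (s - withZero y n) = ⟨s⟩ := by
  have hs' : (withZero y n : ℝ) < s := by exact_mod_cast hs
  rw [branchPoint, if_neg (by linarith)]
  congr
  rw [← NNReal.coe_inj]
  push_cast
  rw [Real.coe_toNNReal _ (by linarith)]
  ring

theorem dist_branchPoint (h : IsStick y z) {n : ℕ} {a b : ℝ} (ha : 0 ≤ a)
    (ha' : a ≤ withZero y (n + 1) - withZero y n) (hb : 0 ≤ b)
    (hb' : b ≤ withZero y (n + 1) - withZero y n) :
    dist (branchPoint h n a) (branchPoint h n b) = |a - b| := by
  rcases ha.eq_or_lt with rfl | ha0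
  · have := dist_branchPoint_old h hb hb' (h.glue_le n)
    rw [h.stickDist_self, zero_add] at this
    rw [branchPoint, if_pos le_rfl, this, zero_sub, abs_neg, abs_of_nonneg hb]
  rcases hb.eq_or_lt with rfl | hb0
  · have := dist_branchPoint_old h ha ha' (h.glue_le n)
    rw [h.stickDist_self, zero_add] at this
    rw [dist_comm, branchPoint, if_pos le_rfl, this, sub_zero, abs_of_nonneg ha]
  have key : ∀ {a : ℝ}, 0 < a → a ≤ withZero y (n + 1) - withZero y n →
      withZero y n < withZero y n + Real.toNNReal a ∧
        withZero y n + Real.toNNReal a ≤ withZero y (n + 1) := fun {a} ha ha' =>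
    ⟨lt_add_of_pos_right _ (Real.toNNReal_pos.2 ha), by
      rw [← NNReal.coe_le_coe]; push_cast; rw [Real.coe_toNNReal _ ha.le]; linarith⟩
  rw [branchPoint, branchPoint, if_neg ha0.not_ge, if_neg hb0.not_ge]
  refine (h.stickDist_same (key ha0 ha').1 (key ha0 ha').2 (key hb0 hb').1 (key hb0 hb').2).trans ?_
  push_cast
  rw [Real.coe_toNNReal _ ha, Real.coe_toNNReal _ hb, add_sub_add_left_eq_sub]

theorem lipschitzOnWith_branchPoint (h : IsStick y z) (n : ℕ) :
    LipschitzOnWith 1 (branchPoint h n) (Icc 0 (withZero y (n + 1) - withZero y n)) :=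
  LipschitzOnWith.of_dist_le_mul fun a ha b hb => by
    rw [dist_branchPoint h ha.1 ha.2 hb.1 hb.2, NNReal.coe_one, one_mul, Real.dist_eq]

/-- The path from an old point to a new one goes through the glue point, then along the branch.
Connectedness of `C` and equality in the triangle inequality are all that is needed of geodesics. -/
theorem IsStick.exists_segment (h : IsStick y z) (s t : ℝ≥0) : ∃ C : Set (StickLine h),
    IsPreconnected C ∧ ⟨s⟩ ∈ C ∧ ⟨t⟩ ∈ C ∧
      ∀ p ∈ C, dist ⟨s⟩ p + dist p ⟨t⟩ = stickDist y z s t := by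
  obtain ⟨n, hn⟩ := h.exists_le (max s t)
  obtain ⟨hs, ht⟩ := max_le_iff.1 hn
  clear hn
  induction n generalizing s t with
  | zero =>
    obtain rfl : s = 0 := le_antisymm hs zero_le
    obtain rfl : t = 0 := le_antisymm ht zero_le
    exact ⟨{⟨0⟩}, isPreconnected_singleton, rfl, rfl, by
      rintro _ rfl; simp [h.stickDist_self]⟩
  | succ n ih =>
    wlog hst : s ≤ t generalizing s t
    · obtain ⟨C, h1, h2, h3, h4⟩ := this t s ht hs (le_of_not_ge hst)
      exact ⟨C, h1, h3, h2, fun p hp => by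
        rw [h.stickDist_comm, ← h4 p hp, add_comm, dist_comm p, dist_comm p]⟩
    have hL : (t : ℝ) ≤ withZero y (n + 1) := by exact_mod_cast ht
    have himg : ∀ a, 0 ≤ a →
        IsPreconnected (branchPoint h n '' Icc a (t - withZero y n)) := fun a ha =>
      isPreconnected_Icc.image _
        ((lipschitzOnWith_branchPoint h n).continuousOn.mono (Icc_subset_Icc ha (by linarith)))
    rcases le_or_gt t (withZero y n) with htn | htn
    · exact ih s t (hst.trans htn) htn
    have htn' : (withZero y n : ℝ) < t := by exact_mod_cast htn
    rcases le_or_gt s (withZero y n) with hsn | hsn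
    · obtain ⟨C, h1, h2, h3, h4⟩ := ih s (withZero z n) hsn (h.glue_le n)
      have hc : branchPoint h n 0 = ⟨withZero z n⟩ := if_pos le_rfl
      refine ⟨C ∪ branchPoint h n '' Icc 0 (t - withZero y n), ?_, Or.inl h2,
        Or.inr ⟨t - withZero y n, ⟨by linarith, le_rfl⟩, branchPoint_sub h htn⟩, ?_⟩
      · exact h1.union _ h3 ⟨0, ⟨le_rfl, by linarith⟩, hc⟩ (himg 0 le_rfl)
      · rintro p (hp | ⟨a, ha, rfl⟩)
        · refine le_antisymm ?_ (dist_triangle (⟨s⟩ : StickLine h) p ⟨t⟩)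
          have e1 := h4 p hp
          have e2 := dist_triangle p (⟨withZero z n⟩ : StickLine h) ⟨t⟩
          have e3 := h.stickDist_old_new (h.glue_le n) htn ht
          have e4 := h.stickDist_old_new hsn htn ht
          rw [h.stickDist_self, zero_add] at e3
          change _ ≤ _ + stickDist y z _ _ at e2
          linarith
        · have e1 := dist_branchPoint_old h ha.1 (by linarith [ha.2]) hsn
          have e2 := dist_branchPoint h (b := t - withZero y n) ha.1 (by linarith [ha.2])
            (by linarith) (by linarith)
          rw [branchPoint_sub h htn, abs_of_nonpos (by linarith [ha.2])] at e2
          rw [e1, e2, h.stickDist_old_new hsn htn ht]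
          ring
    · have hsn' : (withZero y n : ℝ) < s := by exact_mod_cast hsn
      have hst' : (s : ℝ) ≤ t := by exact_mod_cast hst
      refine ⟨branchPoint h n '' Icc (s - withZero y n) (t - withZero y n), himg _ (by linarith),
        ⟨_, ⟨le_rfl, by linarith⟩, branchPoint_sub h hsn⟩,
        ⟨_, ⟨by linarith, le_rfl⟩, branchPoint_sub h htn⟩, ?_⟩
      rintro _ ⟨a, ha, rfl⟩
      have ha0 : 0 ≤ a := by linarith [ha.1]
      rw [← branchPoint_sub h hsn, ← branchPoint_sub h htn,
        dist_branchPoint h (by linarith) (by linarith) ha0 (by linarith [ha.2]),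
        dist_branchPoint h ha0 (by linarith [ha.2]) (by linarith) (by linarith),
        h.stickDist_same hsn hs htn ht, abs_of_nonpos (by linarith [ha.1]),
        abs_of_nonpos (by linarith [ha.2]), abs_of_nonpos (by linarith [ha.2])]
      ring

/-- The points of a segment whose ends are on the same side of `x` stay on that side, by the
triangle inequality. So the points of the half-line on this side form a connected set, and they are
dense in the side, which is open. -/
theorem isPreconnected_sameSide (h : IsStick y z) (x w : Tree h) :
    IsPreconnected {w' | SameSide x w w'} := by
  have hd := denseRange_vertex h
  have hpre : IsPreconnected ({w' | SameSide x w w'} ∩ range (vertex h)) := by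
    refine isPreconnected_of_forall_pair ?_
    rintro _ ⟨hs, s, rfl⟩ _ ⟨ht, t, rfl⟩
    obtain ⟨C, h1, h2, h3, h4⟩ := h.exists_segment s t
    refine ⟨(fun p : StickLine h => (p : Tree h)) '' C, ?_, ⟨_, h2, rfl⟩, ⟨_, h3, rfl⟩,
      h1.image _ (UniformSpace.Completion.continuous_coe _).continuousOn⟩
    rintro _ ⟨p, hp, rfl⟩
    refine ⟨hs.trans ?_, p.pos, rfl⟩
    have e1 := h4 p hp
    rw [← dist_vertex h] at e1
    have e2 : dist (⟨s⟩ : StickLine h) p = dist (vertex h s) (vertex h p.pos) :=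
      (dist_vertex h _ _).symm
    have e3 : dist p (⟨t⟩ : StickLine h) = dist (vertex h p.pos) (vertex h t) :=
      (dist_vertex h _ _).symm
    rw [e2, e3] at e1
    have hst : SameSide x (vertex h s) (vertex h t) := SameSide.trans hs.symm ht
    change dist (vertex h s) (vertex h p.pos) < _ + dist x (vertex h p.pos)
    unfold SameSide at hst
    have := dist_triangle x (vertex h p.pos) (vertex h t)
    linarith
  refine hpre.subset_closure inter_subset_left ?_
  exact hd.open_subset_closure_inter (isOpen_sameSide x w)

/-- The sides are open and partition the complement of `x`, so a connected subset lies in one of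
them; conversely each side is connected. -/
theorem connectedComponentIn_compl_singleton (h : IsStick y z) {x w : Tree h} (hw : w ≠ x) :
    connectedComponentIn {x}ᶜ w = {w' | SameSide x w w'} := by
  refine subset_antisymm ?_ ((isPreconnected_sameSide h x w).subset_connectedComponentIn
    (sameSide_self hw) fun w' hw' => SameSide.ne_right hw')
  have hpre : IsPreconnected (connectedComponentIn {x}ᶜ w) := isPreconnected_connectedComponentIn
  have hmem : w ∈ connectedComponentIn {x}ᶜ w := mem_connectedComponentIn hw
  have hO : IsOpen (⋃ w' ∈ {w' | w' ≠ x ∧ ¬ SameSide x w w'}, {u | SameSide x w' u}) :=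
    isOpen_biUnion fun w' _ => isOpen_sameSide x w'
  refine hpre.subset_left_of_subset_union (isOpen_sameSide x w) hO ?_ ?_
    ⟨w, hmem, sameSide_self hw⟩
  · rw [Set.disjoint_left]
    intro u hu hu'
    simp only [mem_iUnion] at hu'
    obtain ⟨w', hw', hu'⟩ := hu'
    exact hw'.2 (SameSide.trans hu (SameSide.symm hu'))
  · intro u hu
    have hux : u ≠ x := connectedComponentIn_subset _ _ hu
    by_cases hs : SameSide x w u
    · exact Or.inl hs
    · refine Or.inr ?_
      simp only [mem_iUnion]
      exact ⟨u, ⟨hux, hs⟩, sameSide_self hux⟩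

theorem isAngleFunction_iff (h : IsStick y z) (ρ : Tree h) (U : Tree h → Tree h → I) :
    IsAngleFunction ρ U ↔ (∀ x, U x ρ = 0) ∧ (∀ x, U x x = 0) ∧
      ∀ x w w', w ≠ x → w' ≠ x → (U x w = U x w' ↔ SameSide x w w') := by
  constructor
  · rintro ⟨h1, h2, h3⟩
    refine ⟨h1, h2, fun x w w' hw hw' => ?_⟩
    rw [h3 x w w' hw hw', connectedComponentIn_compl_singleton h hw]
    rfl
  · rintro ⟨h1, h2, h3⟩
    refine ⟨h1, h2, fun x w w' hw hw' => ?_⟩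
    rw [h3 x w w' hw hw', connectedComponentIn_compl_singleton h hw]
    rfl

theorem sameSide_vertex (h : IsStick y z) (r s t : ℝ≥0) :
    SameSide (vertex h r) (vertex h s) (vertex h t) ↔
      stickDist y z s t < stickDist y z s r + stickDist y z r t := by
  simp only [SameSide, dist_vertex]

/-- A point of the tree outside of the half-line does not disconnect the tree. -/
theorem sameSide_of_notMem_range (h : IsStick y z) {x : Tree h} (hx : x ∉ range (vertex h))
    {w w' : Tree h} (hw : w ≠ x) (hw' : w' ≠ x) : SameSide x w w' := by
  have hd := denseRange_vertex h
  have key : ∀ {w}, w ≠ x → SameSide x w (vertex h 0) := by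
    intro w hw
    obtain ⟨_, hs, s, rfl⟩ := hd.inter_open_nonempty _ (isOpen_sameSide x w) ⟨w, sameSide_self hw⟩
    refine SameSide.trans hs ?_
    have hne : ∀ s, vertex h s ≠ x := fun s hs => hx ⟨s, hs⟩
    -- Segments between points of the half-line stay in the half-line, so they avoid `x`.
    have hsub : range (vertex h) ⊆ connectedComponentIn {x}ᶜ (vertex h s) := by
      refine IsPreconnected.subset_connectedComponentIn ?_ ⟨s, rfl⟩ ?_
      · refine isPreconnected_of_forall_pair ?_
        rintro _ ⟨s, rfl⟩ _ ⟨t, rfl⟩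
        obtain ⟨C, h1, h2, h3, -⟩ := h.exists_segment s t
        refine ⟨(fun p : StickLine h => (p : Tree h)) '' C, ?_, ⟨_, h2, rfl⟩, ⟨_, h3, rfl⟩,
          h1.image _ (UniformSpace.Completion.continuous_coe _).continuousOn⟩
        rintro _ ⟨p, hp, rfl⟩
        exact ⟨p.pos, rfl⟩
      · rintro _ ⟨t, rfl⟩
        exact hne t
    rw [connectedComponentIn_compl_singleton h (hne s)] at hsub
    exact hsub ⟨0, rfl⟩
  exact SameSide.trans (key hw) (key hw').symm

end TreeGeometry

/-! ### Classification of the sides of a point, and the angle function. -/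

section Angles

variable {y z : ℕ → ℝ≥0}

/-! ### Relative position of points of the half-line -/

theorem IsStick.lt_of_withZero_lt (h : IsStick y z) {m n : ℕ}
    (hmn : withZero y m < withZero y n) : m < n :=
  not_le.1 fun hle => hmn.not_ge (h.mono hle)

/-- Reaching a later point `r` from an earlier stage requires a final piece of positive length on
the branch of `r`, so `r` does not separate points of that stage. -/
theorem sameSide_of_le_of_lt (h : IsStick y z) {n : ℕ} {r s t : ℝ≥0} (hs : s ≤ withZero y n)
    (ht : t ≤ withZero y n) (hr : withZero y n < r) :
    SameSide (vertex h r) (vertex h s) (vertex h t) := by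
  obtain ⟨k, hk, hk'⟩ := h.exists_branch (zero_le.trans_lt hr)
  have hnk : withZero y n ≤ withZero y k :=
    h.mono (Nat.lt_succ_iff.1 (h.lt_of_withZero_lt (hr.trans_le hk')))
  have e1 := h.stickDist_old_new (hs.trans hnk) hk hk'
  have e2 := h.stickDist_old_new (ht.trans hnk) hk hk'
  have e3 := h.stickDist_triangle s (withZero z k) t
  have e4 : (withZero y k : ℝ) < r := by exact_mod_cast hk
  rw [sameSide_vertex, h.stickDist_comm r t, e1, e2]
  rw [h.stickDist_comm (withZero z k) t] at e3
  linarith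

/-- From a point of a branch to the glue point of the branch, the path runs along the branch. -/
theorem sameSide_glue (h : IsStick y z) {n : ℕ} {r s : ℝ≥0} (hs : withZero y n < s)
    (hs' : s ≤ withZero y (n + 1)) (hr : r ∉ Ioc (withZero y n) s) (hrz : r ≠ withZero z n) :
    SameSide (vertex h r) (vertex h s) (vertex h (withZero z n)) := by
  have e0 := h.stickDist_old_new (h.glue_le n) hs hs'
  rw [h.stickDist_self, zero_add] at e0
  rcases le_or_gt r (withZero y n) with hrn | hrn
  · have e1 := h.stickDist_old_new hrn hs hs'
    rw [sameSide_vertex, h.stickDist_comm s, e0, h.stickDist_comm s, e1]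
    linarith [h.stickDist_pos hrz]
  have hsr : s < r := not_le.1 fun hle => hr ⟨hrn, hle⟩
  rcases le_or_gt r (withZero y (n + 1)) with hrn' | hrn'
  · have e1 := h.stickDist_old_new (h.glue_le n) hrn hrn'
    rw [h.stickDist_self, zero_add] at e1
    have : (s : ℝ) < r := by exact_mod_cast hsr
    rw [sameSide_vertex, h.stickDist_comm s, e0, h.stickDist_comm r, e1]
    linarith [h.stickDist_nonneg s r]
  · exact sameSide_of_le_of_lt h hs' ((h.glue_le n).trans (h.mono n.le_succ)) hrn'

/-- The branch started at the cut `i` hangs from `z i`, so every path from the earlier tree to its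
end passes there. In particular two branches glued at the same point are on different sides of it.
-/
theorem not_sameSide_glue (h : IsStick y z) {i : ℕ} {p : ℝ≥0} (hp : p ≤ y i) :
    ¬ SameSide (vertex h (z i)) (vertex h p) (vertex h (y (i + 1))) := by
  have hlt : withZero y (i + 1) < y (i + 1) := h.strictMono i.lt_succ_self
  have e1 := h.stickDist_old_new (n := i + 1) hp hlt le_rfl
  have e2 := h.stickDist_old_new (n := i + 1) (h.le i) hlt le_rfl
  rw [sameSide_vertex, e1, e2, not_lt]
  simp only [withZero, h.stickDist_self]
  linarith

theorem sameSide_glue_end (h : IsStick y z) {n : ℕ} {s : ℝ≥0} (hs : withZero y n < s)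
    (hs' : s ≤ withZero y (n + 1)) :
    SameSide (vertex h (withZero z n)) (vertex h s) (vertex h (withZero y (n + 1))) := by
  have e1 := h.stickDist_old_new (h.glue_le n) hs hs'
  have e2 := h.stickDist_old_new (h.glue_le n) (hs.trans_le hs') le_rfl
  have e3 := h.stickDist_same hs hs' (hs.trans_le hs') le_rfl
  rw [h.stickDist_self, zero_add] at e1 e2
  have h1 : (withZero y n : ℝ) < s := by exact_mod_cast hs
  have h2 : (s : ℝ) ≤ withZero y (n + 1) := by exact_mod_cast hs'
  rw [sameSide_vertex, h.stickDist_comm s (withZero z n), e1, e2, e3, abs_of_nonpos (by linarith)]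
  linarith

/-- The interval is closed on the left: at a cut, `nextCut` is the end of the following branch,
which does not contain the cut. This is why cuts are excluded from the prescriptions involving
`nextCut`. -/
theorem IsStick.nextCut_eq (h : IsStick y z) {n : ℕ} {r : ℝ≥0} (hr : withZero y n ≤ r)
    (hr' : r < withZero y (n + 1)) : nextCut y r = withZero y (n + 1) := by
  suffices sInf {a | r < y a} = n by rw [nextCut, this]; rfl
  refine le_antisymm (Nat.sInf_le hr') ?_
  have hmem : r < y (sInf {a | r < y a}) := Nat.sInf_mem (s := {a | r < y a}) ⟨n, hr'⟩
  exact Nat.lt_succ_iff.1 (h.lt_of_withZero_lt (n := sInf {a | r < y a} + 1) (hr.trans_lt hmem))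

/-- A point which is not a cut is in the interior of a branch, or is the root. -/
theorem IsStick.exists_interior (h : IsStick y z) (hy : 0 < y 0) {r : ℝ≥0} (hr : r ∉ range y) :
    ∃ n, withZero y n ≤ r ∧ r < withZero y (n + 1) ∧ (r = 0 ∨ withZero y n < r) := by
  rcases eq_zero_or_pos r with rfl | h0
  · exact ⟨0, le_rfl, hy, Or.inl rfl⟩
  · obtain ⟨n, h1, h2⟩ := h.exists_branch h0
    exact ⟨n, h1.le, h2.lt_of_ne fun e => hr ⟨n, e.symm⟩, Or.inr h1⟩

theorem not_sameSide_nextCut (h : IsStick y z) (hy : 0 < y 0) {r : ℝ≥0} (hr : r ∉ range y) :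
    ¬ SameSide (vertex h r) (vertex h 0) (vertex h (nextCut y r)) := by
  obtain ⟨n, h1, h2, h3⟩ := h.exists_interior hy hr
  rw [h.nextCut_eq h1 h2]
  rcases h3 with rfl | h3
  · exact fun hs => SameSide.ne_left hs rfl
  · have h3' : (withZero y n : ℝ) < r := by exact_mod_cast h3
    have h2' : (r : ℝ) < withZero y (n + 1) := by exact_mod_cast h2
    have e1 := h.stickDist_old_new (s := 0) zero_le h3 h2.le
    have e2 := h.stickDist_old_new (s := 0) zero_le (h3.trans h2) le_rfl
    have e3 := h.stickDist_same h3 h2.le (h3.trans h2) le_rfl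
    rw [sameSide_vertex, e1, e2, e3, not_lt, abs_of_nonpos (by linarith)]
    linarith

theorem IsStick.nextCut_le (h : IsStick y z) {r : ℝ≥0} (hr : r ∉ range y) {i : ℕ} (hi : r ≤ y i) :
    nextCut y r ≤ y i := by
  have hlt : r < y i := hi.lt_of_ne fun e => hr ⟨i, e.symm⟩
  exact h.strictMono.monotone (Nat.sInf_le hlt)

/-- The sides of a point of the half-line: the side of the root, the side of the end of its branch,
and one side for every branch glued at this point. -/
theorem sameSide_cases_vertex (h : IsStick y z) (hy : 0 < y 0) {r : ℝ≥0} (s : ℝ≥0) (hsr : s ≠ r) :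
    SameSide (vertex h r) (vertex h s) (vertex h 0) ∨
      (r ∉ range y ∧ SameSide (vertex h r) (vertex h s) (vertex h (nextCut y r))) ∨
      ∃ i, z i = r ∧ SameSide (vertex h r) (vertex h s) (vertex h (y (i + 1))) := by
  revert hsr
  refine h.branch_induction (p := fun s => s ≠ r →
    SameSide (vertex h r) (vertex h s) (vertex h 0) ∨
      (r ∉ range y ∧ SameSide (vertex h r) (vertex h s) (vertex h (nextCut y r))) ∨
      ∃ i, z i = r ∧ SameSide (vertex h r) (vertex h s) (vertex h (y (i + 1)))) ?_ ?_ s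
  · exact fun h0 => Or.inl (sameSide_self ((vertex_injective h).ne h0))
  intro n s hs hs' ih hsr
  by_cases hrz : r = withZero z n
  · have hend := sameSide_glue_end h hs hs'
    rw [← hrz] at hend
    cases n with
    -- The first branch is glued at the root `0`, where its end counts as `nextCut` and not as the
    -- end of a glued branch.
    | zero =>
      refine Or.inr (Or.inl ⟨?_, ?_⟩)
      · rintro ⟨i, hi⟩
        have : y 0 ≤ y i := h.strictMono.monotone i.zero_le
        rw [hi, hrz] at this
        exact hy.not_ge this
      · rwa [h.nextCut_eq (n := 0) zero_le (by rw [hrz]; exact hy)]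
    | succ i => exact Or.inr (Or.inr ⟨i, hrz.symm, hend⟩)
  by_cases hr : r ∈ Ioc (withZero y n) s
  · have hrs : r < s := hr.2.lt_of_ne hsr.symm
    have h1 : (withZero y n : ℝ) < r := by exact_mod_cast hr.1
    have h2 : (r : ℝ) < s := by exact_mod_cast hrs
    have h3 : (s : ℝ) ≤ withZero y (n + 1) := by exact_mod_cast hs'
    have hr1 := hrs.trans_le hs'
    refine Or.inr (Or.inl ⟨?_, ?_⟩)
    · rintro ⟨i, rfl⟩
      have a1 := h.lt_of_withZero_lt (n := i + 1) hr.1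
      have a2 := h.lt_of_withZero_lt (m := i + 1) hr1
      omega
    · rw [h.nextCut_eq hr.1.le hr1, sameSide_vertex,
        h.stickDist_same hs hs' (hs.trans_le hs') le_rfl,
        h.stickDist_same hs hs' hr.1 hr1.le, h.stickDist_same hr.1 hr1.le (hs.trans_le hs') le_rfl,
        abs_of_nonpos (by linarith), abs_of_nonneg (by linarith), abs_of_nonpos (by linarith)]
      linarith
  -- Now `r` is off the path from `s` to the glue point, which may therefore replace `s`.
  · have hg := sameSide_glue h hs hs' hr hrz
    rcases ih _ (h.glue_le n) (Ne.symm hrz) with h1 | ⟨h1, h2⟩ | ⟨i, h1, h2⟩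
    · exact Or.inl (SameSide.trans hg h1)
    · exact Or.inr (Or.inl ⟨h1, SameSide.trans hg h2⟩)
    · exact Or.inr (Or.inr ⟨i, h1, SameSide.trans hg h2⟩)

theorem exists_sameSide_vertex (h : IsStick y z) {x w : Tree h} (hw : w ≠ x) :
    ∃ s, SameSide x w (vertex h s) := by
  obtain ⟨_, hs, s, rfl⟩ :=
    (denseRange_vertex h).inter_open_nonempty _ (isOpen_sameSide x w) ⟨w, sameSide_self hw⟩
  exact ⟨s, hs⟩

theorem sameSide_cases (h : IsStick y z) (hy : 0 < y 0) {r : ℝ≥0} {w : Tree h}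
    (hw : w ≠ vertex h r) :
    SameSide (vertex h r) w (vertex h 0) ∨
      (r ∉ range y ∧ SameSide (vertex h r) w (vertex h (nextCut y r))) ∨
      ∃ i, z i = r ∧ SameSide (vertex h r) w (vertex h (y (i + 1))) := by
  obtain ⟨s, hs⟩ := exists_sameSide_vertex h hw
  have hsr : s ≠ r := fun e => SameSide.ne_right hs (by rw [e])
  rcases sameSide_cases_vertex h hy s hsr with h1 | ⟨h1, h2⟩ | ⟨i, h1, h2⟩
  · exact Or.inl (SameSide.trans hs h1)
  · exact Or.inr (Or.inl ⟨h1, SameSide.trans hs h2⟩)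
  · exact Or.inr (Or.inr ⟨i, h1, SameSide.trans hs h2⟩)

/-! ### Existence and uniqueness of the angle function -/

/-- The almost sure properties of the atoms, cuts and angles which make the prescribed angles
compatible. -/
structure IsGeneric (θ x y : ℕ → ℝ≥0) (uX uZ : ℕ → I) : Prop where
  cut_pos : 0 < y 0
  atom_inj : ∀ i j, 0 < θ (i + 1) → 0 < θ (j + 1) → x i = x j → i = j
  atom_notMem : ∀ i, 0 < θ (i + 1) → x i ∉ range y
  angle_inj : Function.Injective (Sum.elim uX uZ)
  angle_ne_zero : ∀ j, Sum.elim uX uZ j ≠ 0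
  angle_ne_half : ∀ j, ((Sum.elim uX uZ j : I) : ℝ) ≠ 1 / 2

open Classical in
/-- The prescribed angle of the end of the branch of `r`, seen from `r`. -/
def branchAngle (θ x : ℕ → ℝ≥0) (uX : ℕ → I) (r : ℝ≥0) : I :=
  if hr : ∃ i, 0 < θ (i + 1) ∧ r = x i then uX hr.choose
  else ⟨1 / 2, by norm_num, by norm_num⟩

/-- `c` is the prescribed angle of the side of `w` seen from `r`, which is not the side of the
root. -/
def IsLabel (θ x : ℕ → ℝ≥0) (h : IsStick y z) (uX uZ : ℕ → I) (r : ℝ≥0) (w : Tree h) (c : I) :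
    Prop :=
  (r ∉ range y ∧ SameSide (vertex h r) w (vertex h (nextCut y r)) ∧ c = branchAngle θ x uX r) ∨
    ∃ i, z i = r ∧ SameSide (vertex h r) w (vertex h (y (i + 1))) ∧ c = uZ i

open Classical in
/-- The angle function with the prescribed angles. -/
def planeAngle (θ x : ℕ → ℝ≥0) (h : IsStick y z) (uX uZ : ℕ → I) (v w : Tree h) : I :=
  if hc : ∃ c, ∃ r, vertex h r = v ∧ IsLabel θ x h uX uZ r w c then hc.choose else 0

variable {θ x : ℕ → ℝ≥0} {h : IsStick y z} {uX uZ : ℕ → I}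

theorem IsGeneric.branchAngle_atom (hg : IsGeneric θ x y uX uZ) {i : ℕ} (hi : 0 < θ (i + 1)) :
    branchAngle θ x uX (x i) = uX i := by
  have hr : ∃ j, 0 < θ (j + 1) ∧ x i = x j := ⟨i, hi, rfl⟩
  rw [branchAngle, dif_pos hr]
  congr 1
  exact (hg.atom_inj _ _ hi hr.choose_spec.1 hr.choose_spec.2).symm

theorem branchAngle_other {r : ℝ≥0} (hr : ∀ i, 0 < θ (i + 1) → r ≠ x i) :
    (branchAngle θ x uX r : ℝ) = 1 / 2 := by
  rw [branchAngle, dif_neg]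
  rintro ⟨i, hi, e⟩
  exact hr i hi e

theorem IsGeneric.branchAngle_ne (hg : IsGeneric θ x y uX uZ) (r : ℝ≥0) :
    branchAngle θ x uX r ≠ 0 ∧ ∀ i, branchAngle θ x uX r ≠ uZ i := by
  by_cases hr : ∃ i, 0 < θ (i + 1) ∧ r = x i
  · obtain ⟨i, hi, rfl⟩ := hr
    rw [hg.branchAngle_atom hi]
    refine ⟨hg.angle_ne_zero (Sum.inl i), fun j e => ?_⟩
    exact absurd (hg.angle_inj (a₁ := Sum.inl i) (a₂ := Sum.inr j) e) (by simp)
  · have e := branchAngle_other (θ := θ) (x := x) (uX := uX) (r := r)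
      fun i hi e => hr ⟨i, hi, e⟩
    refine ⟨fun e0 => ?_, fun i ei => hg.angle_ne_half (Sum.inr i) ?_⟩
    · rw [e0] at e
      norm_num at e
    · rw [← e, ei]
      rfl

theorem IsLabel.congr {r : ℝ≥0} {w w' : Tree h} {c : I} (hc : IsLabel θ x h uX uZ r w c)
    (hw : SameSide (vertex h r) w' w) : IsLabel θ x h uX uZ r w' c := by
  rcases hc with ⟨h1, h2, h3⟩ | ⟨i, h1, h2, h3⟩
  · exact Or.inl ⟨h1, SameSide.trans hw h2, h3⟩
  · exact Or.inr ⟨i, h1, SameSide.trans hw h2, h3⟩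

theorem IsLabel.ne {r : ℝ≥0} {w : Tree h} {c : I} (hc : IsLabel θ x h uX uZ r w c) :
    w ≠ vertex h r := by
  rcases hc with ⟨-, h2, -⟩ | ⟨i, -, h2, -⟩ <;> exact SameSide.ne_left h2

/-- Labels separate exactly the sides. Ends of different branches are on different sides because `r`
is the glue point of the later one (`not_sameSide_glue`), and genericity makes their labels
different. -/
theorem IsLabel.eq_iff (hg : IsGeneric θ x y uX uZ) {r : ℝ≥0} {w w' : Tree h} {c c' : I}
    (hc : IsLabel θ x h uX uZ r w c) (hc' : IsLabel θ x h uX uZ r w' c') :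
    c = c' ↔ SameSide (vertex h r) w w' := by
  rcases hc with ⟨h1, h2, rfl⟩ | ⟨i, h1, h2, rfl⟩ <;>
    rcases hc' with ⟨h1', h2', rfl⟩ | ⟨j, h1', h2', rfl⟩
  · exact ⟨fun _ => SameSide.trans h2 h2'.symm, fun _ => rfl⟩
  · refine ⟨fun e => absurd e ((hg.branchAngle_ne r).2 j), fun hs => ?_⟩
    subst h1'
    exact absurd (SameSide.trans h2.symm (SameSide.trans hs h2'))
      (not_sameSide_glue h (h.nextCut_le h1 (h.le j)))
  · refine ⟨fun e => absurd e.symm ((hg.branchAngle_ne r).2 i), fun hs => ?_⟩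
    subst h1
    exact absurd (SameSide.trans h2'.symm (SameSide.trans hs.symm h2))
      (not_sameSide_glue h (h.nextCut_le h1' (h.le i)))
  · rcases lt_trichotomy i j with hij | rfl | hij
    · refine ⟨fun e => ?_, fun hs => ?_⟩
      · exact absurd (hg.angle_inj (a₁ := Sum.inr i) (a₂ := Sum.inr j) e) (by simp [hij.ne])
      · subst h1'
        exact absurd (SameSide.trans h2.symm (SameSide.trans hs h2'))
          (not_sameSide_glue h (h.strictMono.monotone hij))
    · exact ⟨fun _ => SameSide.trans h2 h2'.symm, fun _ => rfl⟩
    · refine ⟨fun e => ?_, fun hs => ?_⟩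
      · exact absurd (hg.angle_inj (a₁ := Sum.inr i) (a₂ := Sum.inr j) e) (by simp [hij.ne'])
      · subst h1
        exact absurd (SameSide.trans h2'.symm (SameSide.trans hs.symm h2))
          (not_sameSide_glue h (h.strictMono.monotone hij))

theorem IsLabel.ne_zero (hg : IsGeneric θ x y uX uZ) {r : ℝ≥0} {w : Tree h} {c : I}
    (hc : IsLabel θ x h uX uZ r w c) : c ≠ 0 := by
  rcases hc with ⟨h1, h2, rfl⟩ | ⟨i, h1, h2, rfl⟩
  · exact (hg.branchAngle_ne r).1
  · exact hg.angle_ne_zero (Sum.inr i)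

theorem IsLabel.not_root (hg : IsGeneric θ x y uX uZ) {r : ℝ≥0} {w : Tree h} {c : I}
    (hc : IsLabel θ x h uX uZ r w c) : ¬ SameSide (vertex h r) w (vertex h 0) := by
  intro hs
  rcases hc with ⟨h1, h2, rfl⟩ | ⟨i, h1, h2, rfl⟩
  · exact not_sameSide_nextCut h hg.cut_pos h1 (SameSide.trans hs.symm h2)
  · subst h1
    exact not_sameSide_glue h zero_le (SameSide.trans hs.symm h2)

theorem IsGeneric.exists_label_or (hg : IsGeneric θ x y uX uZ) {r : ℝ≥0} {w : Tree h}
    (hw : w ≠ vertex h r) :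
    (∃ c, IsLabel θ x h uX uZ r w c) ∨ SameSide (vertex h r) w (vertex h 0) := by
  rcases sameSide_cases h hg.cut_pos hw with h1 | ⟨h1, h2⟩ | ⟨i, h1, h2⟩
  · exact Or.inr h1
  · exact Or.inl ⟨_, Or.inl ⟨h1, h2, rfl⟩⟩
  · exact Or.inl ⟨_, Or.inr ⟨i, h1, h2, rfl⟩⟩

/-- The choice in `planeAngle` is harmless: a vertex has one position and a side has one label. -/
theorem IsLabel.planeAngle_eq (hg : IsGeneric θ x y uX uZ) {r : ℝ≥0} {w : Tree h} {c : I}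
    (hc : IsLabel θ x h uX uZ r w c) : planeAngle θ x h uX uZ (vertex h r) w = c := by
  have hex : ∃ c, ∃ r', vertex h r' = vertex h r ∧ IsLabel θ x h uX uZ r' w c := ⟨c, r, rfl, hc⟩
  rw [planeAngle, dif_pos hex]
  obtain ⟨r', hr', hc'⟩ := hex.choose_spec
  obtain rfl := vertex_injective h hr'
  exact (IsLabel.eq_iff hg hc' hc).2 (sameSide_self hc.ne)

theorem planeAngle_eq_zero {v w : Tree h}
    (hc : ∀ c r, vertex h r = v → ¬ IsLabel θ x h uX uZ r w c) :
    planeAngle θ x h uX uZ v w = 0 := by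
  rw [planeAngle, dif_neg]
  rintro ⟨c, r, hr, hl⟩
  exact hc c r hr hl

/-- An unlabelled point different from the vertex is on the root side. Since labels are nonzero, the
default value `0` distinguishes this side from all the others. -/
theorem IsGeneric.isAngleFunction_planeAngle (hg : IsGeneric θ x y uX uZ) (h : IsStick y z) :
    IsAngleFunction (vertex h 0) (planeAngle θ x h uX uZ) := by
  have hself : ∀ v, planeAngle θ x h uX uZ v v = 0 := fun v =>
    planeAngle_eq_zero fun c r hr hl => hl.ne hr.symm
  rw [isAngleFunction_iff]
  refine ⟨fun v => ?_, hself, fun v w w' hw hw' => ?_⟩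
  · by_cases hv : v = vertex h 0
    · rw [hv, hself]
    · refine planeAngle_eq_zero fun c r hr hl => hl.not_root hg ?_
      rw [hr]
      exact sameSide_self (Ne.symm hv)
  · by_cases hv : v ∈ range (vertex h)
    · obtain ⟨r, rfl⟩ := hv
      by_cases hl : ∃ c, IsLabel θ x h uX uZ r w c
      · obtain ⟨c, hc⟩ := hl
        by_cases hl' : ∃ c, IsLabel θ x h uX uZ r w' c
        · obtain ⟨c', hc'⟩ := hl'
          rw [hc.planeAngle_eq hg, hc'.planeAngle_eq hg]
          exact hc.eq_iff hg hc'
        · rw [hc.planeAngle_eq hg, planeAngle_eq_zero (w := w')]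
          · exact ⟨fun e => absurd e (hc.ne_zero hg),
              fun hs => absurd ⟨c, hc.congr hs.symm⟩ hl'⟩
          · intro c' r' hr' hc'
            obtain rfl := vertex_injective h hr'
            exact hl' ⟨c', hc'⟩
      · have hw0 := (hg.exists_label_or hw).resolve_left hl
        rw [planeAngle_eq_zero (w := w)]
        · by_cases hl' : ∃ c, IsLabel θ x h uX uZ r w' c
          · obtain ⟨c', hc'⟩ := hl'
            rw [hc'.planeAngle_eq hg]
            exact ⟨fun e => absurd e.symm (hc'.ne_zero hg),
              fun hs => absurd ⟨c', hc'.congr hs⟩ hl⟩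
          · have hw0' := (hg.exists_label_or hw').resolve_left hl'
            rw [planeAngle_eq_zero (w := w')]
            · exact ⟨fun _ => SameSide.trans hw0 hw0'.symm, fun _ => rfl⟩
            · intro c' r' hr' hc'
              obtain rfl := vertex_injective h hr'
              exact hl' ⟨c', hc'⟩
        · intro c' r' hr' hc'
          obtain rfl := vertex_injective h hr'
          exact hl ⟨c', hc'⟩
    · rw [planeAngle_eq_zero fun c r hr _ => hv ⟨r, hr⟩,
        planeAngle_eq_zero fun c r hr _ => hv ⟨r, hr⟩]
      exact ⟨fun _ => sameSide_of_notMem_range h hv hw hw', fun _ => rfl⟩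

theorem IsStick.lt_nextCut (h : IsStick y z) (r : ℝ≥0) : r < nextCut y r := by
  obtain ⟨n, hn⟩ := (h.tendsto.eventually_gt_atTop r).exists
  exact Nat.sInf_mem (s := {a | r < y a}) ⟨n, hn⟩

theorem IsGeneric.planeAngle_nextCut (hg : IsGeneric θ x y uX uZ) (h : IsStick y z) {r : ℝ≥0}
    (hr : r ∉ range y) :
    planeAngle θ x h uX uZ (vertex h r) (vertex h (nextCut y r)) = branchAngle θ x uX r :=
  IsLabel.planeAngle_eq hg <| Or.inl ⟨hr, sameSide_self
    ((vertex_injective h).ne (h.lt_nextCut r).ne'), rfl⟩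

theorem IsGeneric.isUniformAngle_planeAngle (hg : IsGeneric θ x y uX uZ) (h : IsStick y z) :
    IsUniformAngle θ x h uX uZ (planeAngle θ x h uX uZ) where
  angle := hg.isAngleFunction_planeAngle h
  atom i hi := by rw [hg.planeAngle_nextCut h (hg.atom_notMem i hi), hg.branchAngle_atom hi]
  glue i := IsLabel.planeAngle_eq hg <| Or.inr ⟨i, rfl, sameSide_self
    ((vertex_injective h).ne ((h.le i).trans_lt (h.strictMono i.lt_succ_self)).ne'), rfl⟩
  other s hs hs' := by
    rw [hg.planeAngle_nextCut h fun ⟨i, hi⟩ => hs' i hi.symm, branchAngle_other hs]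

theorem IsUniformAngle.eq_of_isLabel (hg : IsGeneric θ x y uX uZ) {U : Tree h → Tree h → I}
    (hU : IsUniformAngle θ x h uX uZ U) {r : ℝ≥0} {w : Tree h} {c : I}
    (hc : IsLabel θ x h uX uZ r w c) : U (vertex h r) w = c := by
  have hiff := ((isAngleFunction_iff h _ _).1 hU.angle).2.2
  rcases hc with ⟨h1, h2, rfl⟩ | ⟨i, rfl, h2, rfl⟩
  · rw [(hiff _ _ _ (SameSide.ne_left h2) (SameSide.ne_right h2)).2 h2]
    by_cases hr : ∃ i, 0 < θ (i + 1) ∧ r = x i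
    · obtain ⟨i, hi, rfl⟩ := hr
      rw [hU.atom i hi, hg.branchAngle_atom hi]
    · have hr' : ∀ i, 0 < θ (i + 1) → r ≠ x i := fun i hi e => hr ⟨i, hi, e⟩
      exact Subtype.ext ((hU.other r hr' fun i e => h1 ⟨i, e.symm⟩).trans
        (branchAngle_other hr').symm)
  · rw [(hiff _ _ _ (SameSide.ne_left h2) (SameSide.ne_right h2)).2 h2, hU.glue]

/-- An angle function is constant on each side, and each side contains a point where its value is
imposed: the root, the next cut, or the end of a glued branch. Outside the half-line the root side
is the only one. -/
theorem IsUniformAngle.eq_planeAngle (hg : IsGeneric θ x y uX uZ) {U : Tree h → Tree h → I}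
    (hU : IsUniformAngle θ x h uX uZ U) : U = planeAngle θ x h uX uZ := by
  obtain ⟨hroot, hself, hiff⟩ := (isAngleFunction_iff h _ _).1 hU.angle
  have hside : ∀ {v w}, SameSide v w (vertex h 0) → U v w = 0 := fun {v w} hs => by
    rw [(hiff _ _ _ (SameSide.ne_left hs) (SameSide.ne_right hs)).2 hs, hroot]
  funext v w
  by_cases hw : w = v
  · subst hw
    rw [hself, (hg.isAngleFunction_planeAngle h).self]
  by_cases hv : v ∈ range (vertex h)
  · obtain ⟨r, rfl⟩ := hv
    by_cases hl : ∃ c, IsLabel θ x h uX uZ r w c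
    · obtain ⟨c, hc⟩ := hl
      rw [hU.eq_of_isLabel hg hc, hc.planeAngle_eq hg]
    · rw [hside ((hg.exists_label_or hw).resolve_left hl), planeAngle_eq_zero]
      intro c' r' hr' hc'
      obtain rfl := vertex_injective h hr'
      exact hl ⟨c', hc'⟩
  · rw [planeAngle_eq_zero fun c r hr _ => hv ⟨r, hr⟩]
    exact hside (sameSide_of_notMem_range h hv hw fun e => hv ⟨0, e⟩)

theorem IsGeneric.existsUnique_isUniformAngle (hg : IsGeneric θ x y uX uZ) (h : IsStick y z) :
    ∃! U, IsUniformAngle θ x h uX uZ U :=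
  ⟨_, hg.isUniformAngle_planeAngle h, fun _ hU => hU.eq_planeAngle hg⟩

end Angles

/-! ### Deterministic criterion for finiteness and compactness of the looptree. -/

section LooptreeCompact

open scoped Topology

variable {y z : ℕ → ℝ≥0}

/-! ### Bounds on the looptree distance -/

theorem totallyBounded_of_edist_le {α : Type*} [PseudoEMetricSpace α] {s : Set α}
    (H : ∀ ε : ℝ≥0∞, 0 < ε → ε ≠ ∞ → ∃ t : Set α, t.Finite ∧ ∀ a ∈ s, ∃ b ∈ t, edist a b ≤ ε) :
    TotallyBounded s := by
  refine EMetric.totallyBounded_iff.2 fun ε hε => ?_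
  obtain ⟨δ, hδ, hδε⟩ := exists_between (lt_min hε ENNReal.zero_lt_top)
  obtain ⟨t, ht, hst⟩ := H δ hδ (hδε.trans_le (min_le_right _ _)).ne
  refine ⟨t, ht, fun a ha => ?_⟩
  obtain ⟨b, hb, hab⟩ := hst a ha
  simp only [mem_iUnion]
  exact ⟨b, hb, hab.trans_lt (hδε.trans_le (min_le_left _ _))⟩

theorem torusEDist_le_one (u v : I) : torusEDist u v ≤ 1 := by
  rw [torusEDist, edist_dist, ← ENNReal.ofReal_one, dist_eq_norm]
  refine ENNReal.ofReal_le_ofReal ((AddCircle.norm_le_half_period 1 one_ne_zero).trans ?_)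
  norm_num

theorem torusEDist_self (u : I) : torusEDist u u = 0 := edist_self _

theorem lebesgue_Ioc (a b : ℝ≥0) : lebesgue (Ioc a b) = ENNReal.ofReal (b - a) := by
  have he : MeasurableEmbedding ((↑) : ℝ≥0 → ℝ) :=
    MeasurableEmbedding.subtype_coe measurableSet_Ici
  have himg : ((↑) : ℝ≥0 → ℝ) '' Ioc a b = Ioc (a : ℝ) b := by
    ext t
    constructor
    · rintro ⟨s, hs, rfl⟩
      exact ⟨NNReal.coe_lt_coe.2 hs.1, NNReal.coe_le_coe.2 hs.2⟩
    · intro ht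
      exact ⟨⟨t, a.2.trans ht.1.le⟩, ⟨NNReal.coe_lt_coe.1 ht.1, NNReal.coe_le_coe.1 ht.2⟩, rfl⟩
  rw [lebesgue, he.comap_apply, himg, Real.volume_Ioc]

theorem massMeasure_apply (θ x : ℕ → ℝ≥0) {B : Set ℝ≥0} (hB : MeasurableSet B) :
    massMeasure θ x B = (θ 0 : ℝ≥0∞) ^ 2 * lebesgue B +
      ∑' i, (θ (i + 1) : ℝ≥0∞) * B.indicator 1 (x i) := by
  simp only [massMeasure, Measure.coe_add, Pi.add_apply, Measure.smul_apply, Measure.sum_apply _ hB,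
    Measure.dirac_apply' _ hB, ENNReal.smul_def, smul_eq_mul, ENNReal.coe_pow]

variable {θ x : ℕ → ℝ≥0} {h : IsStick y z} {U : Tree h → Tree h → I}

theorem edist_preLooptree (α β : PreLooptree θ x h U) :
    edist α β = ((θ 0 ^ 2 / 4 : ℝ≥0) : ℝ≥0∞) * edist α.vert β.vert +
      ∑' i, (θ (i + 1) : ℝ≥0∞) * torusEDist (extAngle U (vertex h (x i)) α.vert α.ang)
        (extAngle U (vertex h (x i)) β.vert β.ang) := rfl

/-- Neither point is `v`, so the additional coordinates `u` and `u'` play no role. -/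
theorem extAngle_congr (hU : IsAngleFunction (vertex h 0) U) {v w w' : Tree h}
    (hw : SameSide v w w') (u u' : I) : extAngle U v w u = extAngle U v w' u' := by
  have h1 := SameSide.ne_left hw
  have h2 := SameSide.ne_right hw
  rw [extAngle, extAngle, if_neg h1.symm, if_neg h2.symm]
  exact (((isAngleFunction_iff h _ _).1 hU).2.2 _ _ _ h1 h2).2 hw

/-- Moving to the glue point of a branch costs at most the mass of the path. -/
theorem edist_glue_le (hU : IsAngleFunction (vertex h 0) U) {n : ℕ} {s : ℝ≥0}
    (hs : withZero y n < s) (hs' : s ≤ withZero y (n + 1)) (u : I) :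
    edist (⟨vertex h s, u⟩ : PreLooptree θ x h U)
      ⟨vertex h (withZero z n), U (vertex h (withZero z n)) (vertex h s)⟩ ≤
        massMeasure θ x (Ioc (withZero y n) s) := by
  rw [edist_preLooptree, massMeasure_apply θ x measurableSet_Ioc]
  refine add_le_add ?_ (ENNReal.tsum_le_tsum fun i => ?_)
  · have e := h.stickDist_old_new (h.glue_le n) hs hs'
    rw [h.stickDist_self, zero_add] at e
    rw [edist_dist, dist_comm, dist_vertex, e, lebesgue_Ioc]
    gcongr
    rw [← ENNReal.coe_pow, ENNReal.coe_le_coe]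
    exact div_le_self zero_le (by norm_num)
  · gcongr
    by_cases hx : x i ∈ Ioc (withZero y n) s
    · rw [indicator_of_mem hx]
      exact torusEDist_le_one _ _
    rw [indicator_of_notMem hx]
    refine le_of_eq ?_
    -- An atom at the glue point contributes nothing, because the second coordinate there was chosen
    -- to be the angle of `s`. Any other atom off the path sees its two ends on the same side.
    by_cases hz : x i = withZero z n
    · have hne : vertex h (withZero z n) ≠ vertex h s :=
        (vertex_injective h).ne ((h.glue_le n).trans_lt hs).ne
      rw [hz, extAngle, if_neg hne, extAngle, if_pos rfl, torusEDist_self]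
    · rw [extAngle_congr hU (sameSide_glue h hs hs' hx hz) u
        (U (vertex h (withZero z n)) (vertex h s)), torusEDist_self]

/-- The pairs whose vertex lies in the tree obtained after `n` steps. -/
def stepSet (θ x : ℕ → ℝ≥0) (h : IsStick y z) (U : Tree h → Tree h → I) (n : ℕ) :
    Set (PreLooptree θ x h U) := {α | ∃ s ≤ withZero y n, vertex h s = α.vert}

/-- Atoms located after the stage `n` do not separate its points, so only those in `[0, withZero y
n]` count. Their total weight will be finite. -/
theorem edist_stepSet_le (hU : IsAngleFunction (vertex h 0) U) {n : ℕ} {α β : PreLooptree θ x h U}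
    (hα : α ∈ stepSet θ x h U n) (hβ : β ∈ stepSet θ x h U n) :
    edist α β ≤ ((θ 0 ^ 2 / 4 : ℝ≥0) : ℝ≥0∞) * edist α.vert β.vert +
      ∑' i, (θ (i + 1) : ℝ≥0∞) * (Iic (withZero y n)).indicator 1 (x i) *
        torusEDist (extAngle U (vertex h (x i)) α.vert α.ang)
          (extAngle U (vertex h (x i)) β.vert β.ang) := by
  obtain ⟨s, hs, hsα⟩ := hα
  obtain ⟨t, ht, htβ⟩ := hβ
  rw [edist_preLooptree]
  refine add_le_add le_rfl (ENNReal.tsum_le_tsum fun i => ?_)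
  by_cases hx : x i ∈ Iic (withZero y n)
  · rw [indicator_of_mem hx, Pi.one_apply, mul_one]
  · rw [← hsα, ← htβ, extAngle_congr hU (sameSide_of_le_of_lt h hs ht (not_le.1 hx)) α.ang β.ang,
      torusEDist_self, mul_zero]
    exact zero_le

theorem tsum_atoms_ne_top {B : Set ℝ≥0} (hB : MeasurableSet B) (hfin : massMeasure θ x B ≠ ∞) :
    ∑' i, (θ (i + 1) : ℝ≥0∞) * B.indicator 1 (x i) ≠ ∞ := by
  rw [massMeasure_apply θ x hB] at hfin
  exact (ENNReal.add_ne_top.1 hfin).2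

theorem edist_stepSet_ne_top (hU : IsAngleFunction (vertex h 0) U) {n : ℕ}
    (hfin : massMeasure θ x (Iic (withZero y n)) ≠ ∞) {α β : PreLooptree θ x h U}
    (hα : α ∈ stepSet θ x h U n) (hβ : β ∈ stepSet θ x h U n) : edist α β ≠ ∞ := by
  refine ne_top_of_le_ne_top (ENNReal.add_ne_top.2 ⟨?_, ?_⟩) (edist_stepSet_le hU hα hβ)
  · exact ENNReal.mul_ne_top ENNReal.coe_ne_top (edist_ne_top _ _)
  · refine ne_top_of_le_ne_top (tsum_atoms_ne_top measurableSet_Iic hfin)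
      (ENNReal.tsum_le_tsum fun i => ?_)
    exact mul_le_of_le_one_right zero_le (torusEDist_le_one _ _)

theorem isCompact_vertex_image (h : IsStick y z) (n : ℕ) :
    IsCompact (vertex h '' Iic (withZero y n)) := by
  induction n with
  | zero =>
    have : Iic (withZero y 0) = {0} := by
      ext s
      simp [withZero]
    rw [this, image_singleton]
    exact isCompact_singleton
  | succ n ih =>
    have hc : IsCompact ((fun p : StickLine h => (p : Tree h)) '' (branchPoint h n ''
        Icc 0 (withZero y (n + 1) - withZero y n : ℝ))) :=
      (isCompact_Icc.image_of_continuousOn (lipschitzOnWith_branchPoint h n).continuousOn).image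
        (UniformSpace.Completion.continuous_coe _)
    convert ih.union hc using 1
    ext w
    constructor
    · rintro ⟨s, hs, rfl⟩
      rcases le_or_gt s (withZero y n) with hsn | hsn
      · exact Or.inl ⟨s, hsn, rfl⟩
      · have h1 : (withZero y n : ℝ) < s := by exact_mod_cast hsn
        have h2 : (s : ℝ) ≤ withZero y (n + 1) := by exact_mod_cast hs
        exact Or.inr ⟨_, ⟨s - withZero y n, ⟨by linarith, by linarith⟩, branchPoint_sub h hsn⟩, rfl⟩
    · rintro (⟨s, hs, rfl⟩ | ⟨_, ⟨a, ha, rfl⟩, rfl⟩)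
      · exact ⟨s, le_trans hs (h.mono n.le_succ), rfl⟩
      · unfold branchPoint
        split_ifs with h0
        · exact ⟨_, (h.glue_le n).trans (h.mono n.le_succ), rfl⟩
        · refine ⟨_, ?_, rfl⟩
          rw [mem_Iic, ← NNReal.coe_le_coe]
          push_cast
          rw [Real.coe_toNNReal _ ha.1]
          linarith [ha.2]

theorem totallyBounded_stepSet (hU : IsAngleFunction (vertex h 0) U) {n : ℕ}
    (hfin : massMeasure θ x (Iic (withZero y n)) ≠ ∞) : TotallyBounded (stepSet θ x h U n) := by
  refine totallyBounded_of_edist_le fun ε hε hεt => ?_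
  have hε2 : 0 < ε / 2 := ENNReal.half_pos hε.ne'
  have hsum := tsum_atoms_ne_top measurableSet_Iic hfin
  obtain ⟨F, hF⟩ := ((tendsto_order.1 (ENNReal.tendsto_tsum_compl_atTop_zero hsum)).2 _ hε2).exists
  set C : ℝ≥0∞ := ((θ 0 ^ 2 / 4 : ℝ≥0) : ℝ≥0∞) +
    ∑ i ∈ F, (θ (i + 1) : ℝ≥0∞) * (Iic (withZero y n)).indicator 1 (x i)
  have hC : C ≠ ∞ := ENNReal.add_ne_top.2 ⟨ENNReal.coe_ne_top,
    ne_top_of_le_ne_top hsum (ENNReal.sum_le_tsum F)⟩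
  -- The `+ 1` avoids a division by zero when `C = 0`.
  set δ : ℝ≥0∞ := ε / 2 / (C + 1)
  have hδ : 0 < δ := ENNReal.div_pos hε2.ne' (ENNReal.add_ne_top.2 ⟨hC, ENNReal.one_ne_top⟩)
  have hCδ : C * δ ≤ ε / 2 := by
    refine (mul_le_mul_left (le_add_right le_rfl : C ≤ C + 1) δ).trans ?_
    exact (ENNReal.mul_div_cancel (by simp) (ENNReal.add_ne_top.2 ⟨hC, ENNReal.one_ne_top⟩)).le
  -- Up to a tail of weight less than `ε / 2`, the distance is controlled by the vertex and by
  -- finitely many angles, which range in a compact product.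
  let Φ : PreLooptree θ x h U → Tree h × (F → UnitAddCircle) := fun α =>
    (α.vert, fun i => ((extAngle U (vertex h (x i)) α.vert α.ang : ℝ) : UnitAddCircle))
  have hΦ : TotallyBounded (Φ '' stepSet θ x h U n) := by
    refine ((isCompact_vertex_image h n).prod isCompact_univ).totallyBounded.subset ?_
    rintro _ ⟨α, ⟨s, hs, hsα⟩, rfl⟩
    exact ⟨⟨s, hs, hsα⟩, mem_univ _⟩
  obtain ⟨t, hts, htf, ht⟩ := EMetric.totallyBounded_iff'.1 hΦ δ hδ
  obtain ⟨t'', ht''s, ht''f, rfl⟩ := exists_subset_image_finite_and.1 ⟨t, hts, htf, rfl⟩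
  refine ⟨t'', ht''f, fun α hα => ?_⟩
  have hmem := ht ⟨α, hα, rfl⟩
  simp only [mem_iUnion] at hmem
  obtain ⟨_, ⟨β, hβ, rfl⟩, hαβ⟩ := hmem
  refine ⟨β, hβ, (edist_stepSet_le hU hα (ht''s hβ)).trans ?_⟩
  have hd : edist (Φ α) (Φ β) ≤ δ := le_of_lt hαβ
  rw [Prod.edist_eq, max_le_iff] at hd
  rw [← ENNReal.add_halves ε]
  have hd2 : ∀ i ∈ F, torusEDist (extAngle U (vertex h (x i)) α.vert α.ang)
      (extAngle U (vertex h (x i)) β.vert β.ang) ≤ δ := fun i hi =>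
    (edist_le_pi_edist (Φ α).2 (Φ β).2 ⟨i, hi⟩).trans hd.2
  rw [← ENNReal.sum_add_tsum_compl F, ← add_assoc]
  refine add_le_add (le_trans ?_ hCδ) (le_trans ?_ hF.le)
  · rw [add_mul, Finset.sum_mul]
    refine add_le_add (mul_le_mul_right hd.1 _) (Finset.sum_le_sum fun i hi => ?_)
    exact mul_le_mul_right (hd2 i hi) _
  · exact ENNReal.tsum_le_tsum fun i => mul_le_of_le_one_right zero_le (torusEDist_le_one _ _)

/-- The sum of the lengths `m` of the branches from the branch `j` down to the first branch whose
glue point lies in the tree obtained after `n` steps. -/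
def height (y z : ℕ → ℝ≥0) (m : ℕ → ℝ) (n j : ℕ) : ℝ :=
  m j + ∑ i : Fin j, if n ≤ i ∧ withZero z j ∈ Ioc (withZero y i) (withZero y (i + 1)) then
    height y z m n i else 0
termination_by j

theorem height_nonneg {m : ℕ → ℝ} (hm : ∀ j, 0 ≤ m j) (n j : ℕ) : 0 ≤ height y z m n j := by
  induction j using Nat.strong_induction_on with
  | _ j ih =>
    rw [height]
    refine add_nonneg (hm j) (Finset.sum_nonneg fun i _ => ?_)
    split_ifs
    · exact ih i i.2
    · exact le_rfl

/-- Go down from glue point to glue point until stage `n` is reached, paying the mass of one branch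
at each step. The angle at each glue point is imposed by the previous step, hence the statement for
all `u`. -/
theorem exists_edist_le_height (hU : IsAngleFunction (vertex h 0) U) {m : ℕ → ℝ}
    (hm : ∀ j, 0 ≤ m j)
    (hmass : ∀ j, massMeasure θ x (Ioc (withZero y j) (withZero y (j + 1))) ≤ ENNReal.ofReal (m j))
    {n j : ℕ} (hnj : n ≤ j) {s : ℝ≥0} (hs : withZero y j < s) (hs' : s ≤ withZero y (j + 1))
    (u : I) : ∃ β ∈ stepSet θ x h U n, edist (⟨vertex h s, u⟩ : PreLooptree θ x h U) β ≤
      ENNReal.ofReal (height y z m n j) := by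
  induction j using Nat.strong_induction_on generalizing s u with
  | _ j ih =>
    have hstep := (edist_glue_le (θ := θ) (x := x) hU hs hs' u).trans
      ((measure_mono (Ioc_subset_Ioc_right hs')).trans (hmass j))
    have hterm : ∀ i : Fin j, 0 ≤ if n ≤ i ∧ withZero z j ∈ Ioc (withZero y i)
        (withZero y (i + 1)) then height y z m n i else 0 := fun i => by
      split_ifs
      · exact height_nonneg hm n i
      · exact le_rfl
    rcases le_or_gt (withZero z j) (withZero y n) with hz | hz
    · refine ⟨_, ⟨_, hz, rfl⟩, hstep.trans (ENNReal.ofReal_le_ofReal ?_)⟩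
      rw [height]
      exact le_add_of_nonneg_right (Finset.sum_nonneg fun i _ => hterm i)
    · obtain ⟨i, hi, hi'⟩ := h.exists_branch (zero_le.trans_lt hz)
      have hij : i < j := h.lt_of_withZero_lt (hi.trans_le (h.glue_le j))
      have hni : n ≤ i := Nat.lt_succ_iff.1 (h.lt_of_withZero_lt (hz.trans_le hi'))
      obtain ⟨β, hβ, hd⟩ := ih i hij hni hi hi' (U (vertex h (withZero z j)) (vertex h s))
      refine ⟨β, hβ, (edist_triangle _ _ _).trans ((add_le_add hstep hd).trans ?_)⟩
      rw [← ENNReal.ofReal_add (hm j) (height_nonneg hm n i), height.eq_1 y z m n j]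
      refine ENNReal.ofReal_le_ofReal (add_le_add_right ?_ _)
      have := Finset.single_le_sum (fun i _ => hterm i) (Finset.mem_univ (⟨i, hij⟩ : Fin j))
      rwa [if_pos ⟨hni, hi, hi'⟩] at this

/-- Chaining through the stages `N l`: passing from stage `N (l + 1)` to stage `N l` costs at most
`c l`. -/
theorem exists_mem_stepSet_edist_le (hU : IsAngleFunction (vertex h 0) U) {m : ℕ → ℝ}
    (hm : ∀ j, 0 ≤ m j)
    (hmass : ∀ j, massMeasure θ x (Ioc (withZero y j) (withZero y (j + 1))) ≤ ENNReal.ofReal (m j))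
    {N : ℕ → ℕ} {c : ℕ → ℝ} {k : ℕ}
    (hc : ∀ l ≥ k, ∀ j, N l ≤ j → j < N (l + 1) → height y z m (N l) j ≤ c l)
    {L : ℕ} (hL : k ≤ L) : ∀ α ∈ stepSet θ x h U (N L), ∃ β ∈ stepSet θ x h U (N k),
      edist α β ≤ ∑ l ∈ Finset.Ico k L, ENNReal.ofReal (c l) := by
  induction L, hL using Nat.le_induction with
  | base => exact fun α hα => ⟨α, hα, by simp⟩
  | succ L hL ih =>
    have hsum : ∑ l ∈ Finset.Ico k L, ENNReal.ofReal (c l) ≤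
        ∑ l ∈ Finset.Ico k (L + 1), ENNReal.ofReal (c l) :=
      Finset.sum_le_sum_of_subset (Finset.Ico_subset_Ico_right L.le_succ)
    rintro ⟨w, u⟩ ⟨s, hs, hsw : vertex h s = w⟩
    subst hsw
    rcases le_or_gt s (withZero y (N L)) with hsN | hsN
    · obtain ⟨β, hβ, hd⟩ := ih ⟨vertex h s, u⟩ ⟨s, hsN, rfl⟩
      exact ⟨β, hβ, hd.trans hsum⟩
    · obtain ⟨j, hj, hj'⟩ := h.exists_branch (zero_le.trans_lt hsN)
      have h1 : N L ≤ j := Nat.lt_succ_iff.1 (h.lt_of_withZero_lt (hsN.trans_le hj'))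
      have h2 : j < N (L + 1) := h.lt_of_withZero_lt (hj.trans_le hs)
      obtain ⟨β, hβ, hd⟩ := exists_edist_le_height (θ := θ) (x := x) hU hm hmass h1 hj hj' u
      obtain ⟨γ, hγ, hd'⟩ := ih β hβ
      refine ⟨γ, hγ, (edist_triangle _ _ _).trans ((add_le_add hd hd').trans ?_)⟩
      rw [Finset.sum_Ico_succ_top hL, add_comm]
      gcongr
      exact hc L hL j h1 h2

theorem totallyBounded_range_vertex (hU : IsAngleFunction (vertex h 0) U) {m : ℕ → ℝ}
    (hm : ∀ j, 0 ≤ m j)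
    (hmass : ∀ j, massMeasure θ x (Ioc (withZero y j) (withZero y (j + 1))) ≤ ENNReal.ofReal (m j))
    (hfin : ∀ n, massMeasure θ x (Iic (withZero y n)) ≠ ∞) {N : ℕ → ℕ} (hN : Tendsto N atTop atTop)
    {c : ℕ → ℝ} (hcs : ∑' l, ENNReal.ofReal (c l) ≠ ∞)
    (hc : ∀ᶠ l in atTop, ∀ j, N l ≤ j → j < N (l + 1) → height y z m (N l) j ≤ c l) :
    TotallyBounded {α : PreLooptree θ x h U | α.vert ∈ range (vertex h)} := by
  refine totallyBounded_of_edist_le fun ε hε hεt => ?_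
  have hε2 : 0 < ε / 2 := ENNReal.half_pos hε.ne'
  obtain ⟨k, hk, hk'⟩ := ((eventually_forall_ge_atTop.2 hc).and
    ((tendsto_order.1 (ENNReal.tendsto_sum_nat_add _ hcs)).2 _ hε2)).exists
  obtain ⟨t, htf, ht⟩ := EMetric.totallyBounded_iff.1
    (totallyBounded_stepSet (θ := θ) (x := x) hU (hfin (N k))) (ε / 2) hε2
  refine ⟨t, htf, ?_⟩
  rintro ⟨w, u⟩ ⟨s, hsw : vertex h s = w⟩
  subst hsw
  obtain ⟨n, hn⟩ := h.exists_le s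
  obtain ⟨L, hL, hL'⟩ := ((eventually_ge_atTop k).and (hN.eventually_ge_atTop n)).exists
  obtain ⟨β, hβ, hd⟩ := exists_mem_stepSet_edist_le (θ := θ) (x := x) hU hm hmass hk hL
    ⟨vertex h s, u⟩ ⟨s, hn.trans (h.mono hL'), rfl⟩
  have hmem := ht hβ
  simp only [mem_iUnion] at hmem
  obtain ⟨γ, hγ, hd'⟩ := hmem
  refine ⟨γ, hγ, (edist_triangle _ β _).trans ?_⟩
  rw [← ENNReal.add_halves ε]
  refine add_le_add (hd.trans (le_trans ?_ hk'.le)) (le_of_lt hd')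
  rw [Finset.sum_Ico_eq_sum_range]
  simp_rw [add_comm k]
  exact ENNReal.sum_le_tsum _

/-- The points of the completion are approximated, for the looptree distance, by points of the
half-line. -/
theorem exists_edist_le_of_totallyBounded (hU : IsAngleFunction (vertex h 0) U)
    (hS : TotallyBounded {α : PreLooptree θ x h U | α.vert ∈ range (vertex h)})
    {ε : ℝ≥0∞} (hε : 0 < ε) : ∃ t : Set (PreLooptree θ x h U), t.Finite ∧
      t ⊆ {α | α.vert ∈ range (vertex h)} ∧ ∀ α, ∃ β ∈ t, edist α β ≤ ε := by
  have hε2 : 0 < ε / 2 := ENNReal.half_pos hε.ne'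
  obtain ⟨t, hts, htf, ht⟩ := EMetric.totallyBounded_iff'.1 hS (ε / 2) hε2
  refine ⟨t, htf, hts, fun α => ?_⟩
  by_cases hα : α.vert ∈ range (vertex h)
  · have hmem := ht hα
    simp only [mem_iUnion] at hmem
    obtain ⟨γ, hγ, hd'⟩ := hmem
    exact ⟨γ, hγ, (le_of_lt hd').trans ENNReal.half_le_self⟩
  have hne : (comap (vertex h) (𝓝 α.vert)).NeBot := comap_neBot fun s hs => by
    obtain ⟨_, hw, a, rfl⟩ := mem_closure_iff_nhds.1 (denseRange_vertex h α.vert) s hs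
    exact ⟨a, hw⟩
  -- Take an ultrafilter on the half-line converging to `α.vert`. A finite cover of its points by
  -- balls has one member in the ultrafilter, so a single centre `β` serves for all nearby
  -- positions.
  obtain ⟨𝒰, h𝒰⟩ := Ultrafilter.exists_le (comap (vertex h) (𝓝 α.vert))
  have htend : Tendsto (vertex h) 𝒰 (𝓝 α.vert) := tendsto_comap.mono_left h𝒰
  have hcov : (⋃ β ∈ t, {s | edist (⟨vertex h s, 0⟩ : PreLooptree θ x h U) β < ε / 2}) ∈ 𝒰 := by
    refine mem_of_superset univ_mem fun s _ => ?_
    have hmem := ht (show (⟨vertex h s, 0⟩ : PreLooptree θ x h U) ∈ _ from ⟨s, rfl⟩)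
    simp only [mem_iUnion] at hmem ⊢
    exact hmem
  obtain ⟨β, hβ, hβ𝒰⟩ := (Ultrafilter.finite_biUnion_mem_iff htf).1 hcov
  refine ⟨β, hβ, ?_⟩
  have hdist : Tendsto (fun s => ((θ 0 ^ 2 / 4 : ℝ≥0) : ℝ≥0∞) * edist (vertex h s) β.vert) 𝒰
      (𝓝 (((θ 0 ^ 2 / 4 : ℝ≥0) : ℝ≥0∞) * edist α.vert β.vert)) :=
    ENNReal.Tendsto.const_mul (htend.edist tendsto_const_nhds) (Or.inr ENNReal.coe_ne_top)
  -- Lower semicontinuity: it is enough to bound the sums over finite sets `F` of atoms. As `α.vert`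
  -- is not an atom, positions close to it are on its side of every atom of `F`, and the angle terms
  -- agree exactly.
  rw [edist_preLooptree, ENNReal.tsum_eq_iSup_sum, ENNReal.add_iSup]
  refine iSup_le fun F => ?_
  refine le_trans ?_ (ENNReal.half_le_self (a := ε))
  refine le_of_tendsto (hdist.add (tendsto_const_nhds (x := ∑ i ∈ F, (θ (i + 1) : ℝ≥0∞) *
    torusEDist (extAngle U (vertex h (x i)) α.vert α.ang)
      (extAngle U (vertex h (x i)) β.vert β.ang)))) ?_
  have hF : ∀ᶠ s in (𝒰 : Filter ℝ≥0), ∀ i ∈ F,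
      SameSide (vertex h (x i)) α.vert (vertex h s) := by
    refine (Finset.eventually_all F).2 fun i _ => htend.eventually ?_
    exact (isOpen_sameSide _ _).mem_nhds (sameSide_self fun e => hα ⟨x i, e.symm⟩)
  filter_upwards [hF, hβ𝒰] with s hs hsβ
  refine le_trans ?_ (le_of_lt hsβ)
  rw [edist_preLooptree]
  refine add_le_add le_rfl (le_trans (le_of_eq ?_) (ENNReal.sum_le_tsum F))
  refine Finset.sum_congr rfl fun i hi => ?_
  rw [extAngle_congr hU (hs i hi) α.ang 0]

theorem edist_ne_top_and_compactSpace (hU : IsAngleFunction (vertex h 0) U)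
    (hfin : ∀ n, massMeasure θ x (Iic (withZero y n)) ≠ ∞)
    (hS : TotallyBounded {α : PreLooptree θ x h U | α.vert ∈ range (vertex h)}) :
    (∀ α β : PreLooptree θ x h U, edist α β ≠ ∞) ∧ CompactSpace (Looptree θ x h U) := by
  constructor
  · obtain ⟨t, -, hts, ht⟩ :=
      exists_edist_le_of_totallyBounded hU hS one_pos
    intro α β
    obtain ⟨α', hα't, hα'⟩ := ht α
    obtain ⟨β', hβ't, hβ'⟩ := ht β
    obtain ⟨s, hs⟩ := hts hα't
    obtain ⟨s', hs'⟩ := hts hβ't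
    obtain ⟨n, hn⟩ := h.exists_le (max s s')
    have hfin' := edist_stepSet_ne_top hU (hfin n)
      (show α' ∈ stepSet θ x h U n from ⟨s, (le_max_left _ _).trans hn, hs⟩)
      (show β' ∈ stepSet θ x h U n from ⟨s', (le_max_right _ _).trans hn, hs'⟩)
    have h1 := (edist_triangle α α' β).trans (add_le_add_right (edist_triangle α' β' β) _)
    refine ne_top_of_le_ne_top (ENNReal.add_ne_top.2 ⟨?_, ENNReal.add_ne_top.2 ⟨hfin', ?_⟩⟩) h1
    · exact ne_top_of_le_ne_top ENNReal.one_ne_top hα'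
    · rw [edist_comm]
      exact ne_top_of_le_ne_top ENNReal.one_ne_top hβ'
  · have hT : TotallyBounded (univ : Set (PreLooptree θ x h U)) :=
      totallyBounded_of_edist_le fun ε hε _ => by
        obtain ⟨t, htf, -, ht⟩ := exists_edist_le_of_totallyBounded hU hS hε
        exact ⟨t, htf, fun α _ => ht α⟩
    have hR : TotallyBounded (univ : Set (Looptree θ x h U)) := by
      have := (hT.image (UniformSpace.Completion.uniformContinuous_coe _)).closure
      rwa [image_univ, UniformSpace.Completion.denseRange_coe.closure_range] at this
    exact ⟨hR.isCompact_of_isComplete isClosed_univ.isComplete⟩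

end LooptreeCompact

/-! ### Height bounds for weighted recursive trees. -/

section RecursiveTree

open scoped Topology

variable {y z : ℕ → ℝ≥0}

/-! ### Heights in weighted recursive trees -/

/-- The height of the branch `j` involves only the glue points of index less than `j` (its own being
`z (j - 1)`). This gives the independence used in the moment recursion. -/
theorem height_congr {z' : ℕ → ℝ≥0} (m : ℕ → ℝ) (n j : ℕ) (hz : ∀ l < j, z l = z' l) :
    height y z m n j = height y z' m n j := by
  induction j using Nat.strong_induction_on with
  | _ j ih =>
    have hj : withZero z j = withZero z' j := by
      cases j with
      | zero => rfl
      | succ j => exact hz j j.lt_succ_self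
    rw [height, height, hj]
    congr 1
    refine Finset.sum_congr rfl fun i _ => ?_
    rw [ih i i.2 fun l hl => hz l (hl.trans i.2)]

theorem measurable_withZero {α : Type*} [MeasurableSpace α] {f : α → ℕ → ℝ≥0} (hf : Measurable f)
    (j : ℕ) : Measurable fun a => withZero (f a) j := by
  cases j with
  | zero => exact measurable_const
  | succ j => exact (measurable_pi_apply j).comp hf

theorem measurable_height {α : Type*} [MeasurableSpace α] {f g : α → ℕ → ℝ≥0} {m : α → ℕ → ℝ}
    (hf : Measurable f) (hg : Measurable g) (hm : Measurable m) (n j : ℕ) :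
    Measurable fun a => height (f a) (g a) (m a) n j := by
  induction j using Nat.strong_induction_on with
  | _ j ih =>
    simp_rw [height.eq_1 _ _ _ n j]
    refine ((measurable_pi_apply j).comp hm).add (Finset.measurable_sum _ fun i _ => ?_)
    refine Measurable.ite ?_ (ih i i.2) measurable_const
    refine (MeasurableSet.const _).inter ?_
    have h1 := measurableSet_lt (measurable_withZero hf i) (measurable_withZero hg j)
    have h2 := measurableSet_le (measurable_withZero hg j) (measurable_withZero hf (i + 1))
    exact h1.inter h2

/-- The Borel–Cantelli lemma for events whose probabilities are eventually summable. -/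
theorem ae_eventually_of_measure_le {α : Type*} [MeasurableSpace α] {μ : Measure α}
    {p : ℕ → α → Prop} {b : ℕ → ℝ} (hb : Summable b)
    (hp : ∀ᶠ k in atTop, μ {a | ¬ p k a} ≤ ENNReal.ofReal (b k)) :
    ∀ᵐ a ∂μ, ∀ᶠ k in atTop, p k a := by
  obtain ⟨k₀, hk₀⟩ := eventually_atTop.1 hp
  have hsum : ∑' k, μ {a | ¬ p (k + k₀) a} ≠ ∞ := by
    refine ne_top_of_le_ne_top ?_ (ENNReal.tsum_le_tsum fun k =>
      (hk₀ (k + k₀) (Nat.le_add_left _ _)).trans (ENNReal.ofReal_le_ofReal (le_abs_self _)))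
    rw [← ENNReal.ofReal_tsum_of_nonneg (fun k => abs_nonneg _)
      ((summable_nat_add_iff k₀).2 hb.abs)]
    exact ENNReal.ofReal_ne_top
  filter_upwards [ae_eventually_notMem hsum] with a ha
  rw [← map_add_atTop_eq_nat k₀, eventually_map]
  filter_upwards [ha] with k hk
  exact not_not.1 hk

theorem lintegral_indicator_mul_of_iIndepFun {κ : Measure (ℕ → ℝ≥0)}
    (hind : iIndepFun (fun i (z : ℕ → ℝ≥0) => z i) κ) {f : (ℕ → ℝ≥0) → ℝ≥0∞} (hf : Measurable f)
    {k : ℕ} (hfk : ∀ z z' : ℕ → ℝ≥0, (∀ l < k, z l = z' l) → f z = f z') {B : Set ℝ≥0}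
    (hB : MeasurableSet B) :
    ∫⁻ z, B.indicator 1 (z k) * f z ∂κ = κ.map (fun z => z k) B * ∫⁻ z, f z ∂κ := by
  -- Padding by `0` exhibits `f` as a measurable function of the first `k` coordinates, to which
  -- independence from the coordinate `k` applies.
  let ext : (Finset.range k → ℝ≥0) → ℕ → ℝ≥0 := fun v l =>
    if hl : l ∈ Finset.range k then v ⟨l, hl⟩ else 0
  have hext : Measurable ext := by
    refine measurable_pi_lambda _ fun l => ?_
    by_cases hl : l ∈ Finset.range k
    · simp only [ext, hl, dif_pos]
      exact measurable_pi_apply _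
    · simp only [ext, hl, dif_neg, not_false_eq_true]
      exact measurable_const
  have h1 := hind.indepFun_finset {k} (Finset.range k) (by simp) fun i => measurable_pi_apply i
  have h2 := h1.comp
    (φ := fun v => B.indicator (1 : ℝ≥0 → ℝ≥0∞) (v ⟨k, Finset.mem_singleton_self k⟩))
    (ψ := f ∘ ext) (by
      exact (measurable_one.indicator hB).comp (measurable_pi_apply _)) (hf.comp hext)
  have h3 : (f ∘ ext) ∘ (fun (z : ℕ → ℝ≥0) (i : Finset.range k) => z i) = f := by
    funext z
    refine hfk _ _ fun l hl => ?_
    simp [ext, hl]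
  rw [h3] at h2
  have h4 := lintegral_mul_eq_lintegral_mul_lintegral_of_indepFun''
    (((measurable_one.indicator hB).comp (measurable_pi_apply k)).aemeasurable) hf.aemeasurable h2
  refine h4.trans ?_
  congr 1
  rw [Measure.map_apply (measurable_pi_apply k) hB, ← lintegral_indicator_one
    (measurable_pi_apply k hB)]
  rfl

/-- The glue point lies either in the tree of stage `n` or on one branch `i`, with `n ≤ i < j`. The
corresponding indicator selects the right term; the sum is linear in the indicators, ready for
integration. -/
theorem exp_height_le (hy : Monotone (withZero y)) {m : ℕ → ℝ} {l : ℝ} {n j : ℕ} (hnj : n ≤ j)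
    (hz : withZero z j ≤ withZero y j) :
    ENNReal.ofReal (Real.exp (l * height y z m n j)) ≤ ENNReal.ofReal (Real.exp (l * m j)) *
      ((Iic (withZero y n)).indicator 1 (withZero z j) + ∑ i ∈ Finset.Ico n j,
        (Ioc (withZero y i) (withZero y (i + 1))).indicator 1 (withZero z j) *
          ENNReal.ofReal (Real.exp (l * height y z m n i))) := by
  rw [height, mul_add, Real.exp_add, ENNReal.ofReal_mul (Real.exp_nonneg _)]
  gcongr
  by_cases hzn : withZero z j ≤ withZero y n
  · rw [Finset.sum_eq_zero, mul_zero, Real.exp_zero, ENNReal.ofReal_one,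
      indicator_of_mem (show withZero z j ∈ Iic _ from hzn)]
    · exact le_add_right le_rfl
    · intro i _
      rw [if_neg]
      rintro ⟨h1, h2, -⟩
      exact (hzn.trans (hy h1)).not_gt h2
  · have hex : ∃ i, withZero z j ≤ withZero y (i + 1) := ⟨j, hz.trans (hy j.le_succ)⟩
    have hj0 : withZero z j ≤ withZero y j := hz
    obtain ⟨i, hi1, hi2, hi3⟩ : ∃ i, n ≤ i ∧ i < j ∧
        withZero z j ∈ Ioc (withZero y i) (withZero y (i + 1)) := by
      classical
      have hspec := Nat.find_spec hex
      have hni : n ≤ Nat.find hex := by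
        by_contra hlt
        exact hzn (hspec.trans (hy (by omega)))
      refine ⟨Nat.find hex, hni, ?_, ?_, hspec⟩
      · obtain ⟨j', rfl⟩ : ∃ j', j = j' + 1 := by
          refine Nat.exists_eq_succ_of_ne_zero ?_
          rintro rfl
          exact hzn (hz.trans (hy (Nat.zero_le n)))
        exact Nat.lt_succ_of_le (Nat.find_min' hex hz)
      · rcases Nat.eq_zero_or_pos (Nat.find hex) with h0 | h0
        · rw [h0]
          exact lt_of_le_of_lt zero_le (not_le.1 hzn)
        · have := Nat.find_min hex (m := Nat.find hex - 1) (by omega)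
          rw [Nat.sub_add_cancel h0] at this
          exact not_le.1 this
    have hone : ∀ i' : Fin j, i' ≠ ⟨i, hi2⟩ →
        ¬ (n ≤ i' ∧ withZero z j ∈ Ioc (withZero y i') (withZero y (i' + 1))) := by
      rintro i' hne ⟨-, h2⟩
      rcases lt_or_gt_of_ne (Fin.val_ne_of_ne hne) with hlt | hlt
      · exact (h2.2.trans (hy (Nat.succ_le_of_lt hlt))).not_gt hi3.1
      · exact (hi3.2.trans (hy (Nat.succ_le_of_lt hlt))).not_gt h2.1
    rw [Finset.sum_eq_single (⟨i, hi2⟩ : Fin j) (fun i' _ hne => if_neg (hone i' hne)) (by simp),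
      if_pos ⟨hi1, hi3⟩]
    refine le_trans ?_ (le_add_left (Finset.single_le_sum (fun _ _ => zero_le)
      (Finset.mem_Ico.2 ⟨hi1, hi2⟩)))
    rw [indicator_of_mem hi3, Pi.one_apply, one_mul]

theorem cond_apply_toReal {μ : Measure ℝ≥0} {b : ℝ≥0} (hpos : μ (Iic b) ≠ 0)
    (hfin : μ (Iic b) ≠ ∞) {B : Set ℝ≥0} (hB : B ⊆ Iic b) :
    (μ[|Iic b]) B = ENNReal.ofReal ((μ B).toReal / (μ (Iic b)).toReal) := by
  have hBfin : μ B ≠ ∞ := ne_top_of_le_ne_top hfin (measure_mono hB)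
  rw [cond_apply measurableSet_Iic, inter_eq_self_of_subset_right hB,
    ENNReal.ofReal_div_of_pos (ENNReal.toReal_pos hpos hfin), ENNReal.ofReal_toReal hBfin,
    ENNReal.ofReal_toReal hfin, ENNReal.div_eq_inv_mul]

theorem measure_Iic_succ {μ : Measure ℝ≥0} (hy : Monotone (withZero y))
    (hfin : ∀ j, μ (Iic (withZero y j)) ≠ ∞) (j : ℕ) :
    (μ (Iic (withZero y (j + 1)))).toReal = (μ (Iic (withZero y j))).toReal +
      (μ (Ioc (withZero y j) (withZero y (j + 1)))).toReal := by
  have hle := hy j.le_succ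
  rw [← Iic_union_Ioc_eq_Iic hle, measure_union (Iic_disjoint_Ioc le_rfl) measurableSet_Ioc,
    ENNReal.toReal_add (hfin j) (ne_top_of_le_ne_top (hfin (j + 1))
      (measure_mono Ioc_subset_Iic_self))]

/-- Exponential moments of the heights of a weighted recursive tree. -/
theorem lintegral_exp_height_le {κ : Measure (ℕ → ℝ≥0)} [IsProbabilityMeasure κ]
    (hind : iIndepFun (fun i (z : ℕ → ℝ≥0) => z i) κ) {μ : Measure ℝ≥0}
    (hlaw : ∀ i, κ.map (fun z => z i) = μ[|Iic (y i)]) (hy : Monotone (withZero y))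
    (hfin : ∀ j, μ (Iic (withZero y j)) ≠ ∞) {n : ℕ} (hn : 1 ≤ n)
    (hpos : 0 < μ (Iic (withZero y n))) {l : ℝ}
    (hl : ∀ j ≥ n, l * (μ (Ioc (withZero y j) (withZero y (j + 1)))).toReal ≤ 1) {j : ℕ}
    (hnj : n ≤ j) :
    ∫⁻ z, ENNReal.ofReal (Real.exp (l * height y z
        (fun j => (μ (Ioc (withZero y j) (withZero y (j + 1)))).toReal) n j)) ∂κ ≤
      ENNReal.ofReal
          (3 * ((μ (Iic (withZero y j))).toReal / (μ (Iic (withZero y n))).toReal) ^ 2) := by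
  set m : ℕ → ℝ := fun j => (μ (Ioc (withZero y j) (withZero y (j + 1)))).toReal with hm
  set M : ℕ → ℝ := fun j => (μ (Iic (withZero y j))).toReal with hM
  have hmeas : ∀ i, Measurable fun z : ℕ → ℝ≥0 =>
      ENNReal.ofReal (Real.exp (l * height y z m n i)) := fun i =>
    (Real.measurable_exp.comp ((measurable_height measurable_const measurable_id measurable_const
      n i).const_mul l)).ennreal_ofReal
  have hMsucc : ∀ j, M (j + 1) = M j + m j := measure_Iic_succ hy hfin
  have hMn : 0 < M n := ENNReal.toReal_pos hpos.ne' (hfin n)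
  have hm0 : ∀ j, 0 ≤ m j := fun j => ENNReal.toReal_nonneg
  have hMpos : ∀ j ≥ n, 0 < M j := fun j hj =>
    hMn.trans_le (ENNReal.toReal_mono (hfin j) (measure_mono (Iic_subset_Iic.2 (hy hj))))
  -- Discrete form of `∫ 3 * M ^ 2 dM = M ^ 3`. Dividing by `M j` gives back `(M j / M n) ^ 2`, and
  -- the factor `exp (l * m j) ≤ exp 1 ≤ 3` restores the constant, so the exponent `2` with constant
  -- `3` closes the induction.
  have hreal : ∀ j ≥ n, M n + ∑ i ∈ Finset.Ico n j, m i * (3 * (M i / M n) ^ 2) ≤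
      M j ^ 3 / M n ^ 2 := by
    intro j hj
    induction j, hj using Nat.le_induction with
    | base =>
      rw [Finset.Ico_self, Finset.sum_empty, add_zero, le_div_iff₀ (by positivity)]
      exact le_of_eq (by ring)
    | succ j hj ih =>
      rw [Finset.sum_Ico_succ_top hj, ← add_assoc, hMsucc]
      have h1 : m j * (3 * (M j / M n) ^ 2) = 3 * m j * M j ^ 2 / M n ^ 2 := by
        rw [div_pow]; ring
      rw [h1]
      refine (add_le_add_left ih _).trans ?_
      rw [← add_div]
      have h2 := hm0 j
      have h3 := hMpos j hj
      gcongr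
      have : (M j + m j) ^ 3 = M j ^ 3 + 3 * m j * M j ^ 2 + (3 * M j * m j ^ 2 + m j ^ 3) := by
        ring
      rw [this]
      have : 0 ≤ 3 * M j * m j ^ 2 + m j ^ 3 := by positivity
      linarith
  induction j using Nat.strong_induction_on with
  | _ j ih =>
    obtain ⟨k, rfl⟩ : ∃ k, j = k + 1 := Nat.exists_eq_succ_of_ne_zero (by omega)
    have hp := hMpos (k + 1) hnj
    have hpos' : μ (Iic (y k)) ≠ 0 :=
      (hpos.trans_le (measure_mono (Iic_subset_Iic.2 (hy hnj)))).ne'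
    have hfin' : μ (Iic (y k)) ≠ ∞ := hfin (k + 1)
    have hae : ∀ᵐ z ∂κ, z k ≤ y k := by
      have : ∀ᵐ s ∂(κ.map fun z => z k), s ∈ Iic (y k) := by
        rw [hlaw]
        exact ae_cond_mem measurableSet_Iic
      exact ae_of_ae_map (measurable_pi_apply k).aemeasurable this
    have hlawB : ∀ B ⊆ Iic (y k), κ.map (fun z => z k) B =
        ENNReal.ofReal ((μ B).toReal / M (k + 1)) := fun B hB => by
      rw [hlaw]
      exact cond_apply_toReal hpos' hfin' hB
    calc ∫⁻ z, ENNReal.ofReal (Real.exp (l * height y z m n (k + 1))) ∂κ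
        ≤ ∫⁻ z, ENNReal.ofReal (Real.exp (l * m (k + 1))) *
            ((Iic (withZero y n)).indicator 1 (z k) + ∑ i ∈ Finset.Ico n (k + 1),
              (Ioc (withZero y i) (withZero y (i + 1))).indicator 1 (z k) *
                ENNReal.ofReal (Real.exp (l * height y z m n i))) ∂κ :=
          lintegral_mono_ae (hae.mono fun z hz => exp_height_le hy hnj hz)
      _ = ENNReal.ofReal (Real.exp (l * m (k + 1))) *
            (κ.map (fun z => z k) (Iic (withZero y n)) + ∑ i ∈ Finset.Ico n (k + 1),
              κ.map (fun z => z k) (Ioc (withZero y i) (withZero y (i + 1))) *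
                ∫⁻ z, ENNReal.ofReal (Real.exp (l * height y z m n i)) ∂κ) := by
          have hi : ∀ {B : Set ℝ≥0}, MeasurableSet B →
              Measurable fun z : ℕ → ℝ≥0 => B.indicator (1 : ℝ≥0 → ℝ≥0∞) (z k) := fun hB =>
            (measurable_one.indicator hB).comp (measurable_pi_apply k)
          have hprod : ∀ i, Measurable fun z : ℕ → ℝ≥0 =>
              (Ioc (withZero y i) (withZero y (i + 1))).indicator 1 (z k) *
                ENNReal.ofReal (Real.exp (l * height y z m n i)) := fun i =>
            (hi measurableSet_Ioc).mul (hmeas i)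
          rw [lintegral_const_mul' _ _ ENNReal.ofReal_ne_top,
            lintegral_add_left (hi measurableSet_Iic), lintegral_finsetSum _ fun i _ => hprod i]
          congr 2
          · rw [Measure.map_apply (measurable_pi_apply k) measurableSet_Iic,
              ← lintegral_indicator_one (measurable_pi_apply k measurableSet_Iic)]
            rfl
          · refine Finset.sum_congr rfl fun i hi => ?_
            refine lintegral_indicator_mul_of_iIndepFun hind (hmeas i) (fun z z' hzz => ?_)
              measurableSet_Ioc
            rw [height_congr m n i fun l hl => hzz l
              (hl.trans_le (Nat.lt_succ_iff.1 (Finset.mem_Ico.1 hi).2))]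
      _ ≤ ENNReal.ofReal 3 * (ENNReal.ofReal (M n / M (k + 1)) + ∑ i ∈ Finset.Ico n (k + 1),
              ENNReal.ofReal (m i / M (k + 1)) * ENNReal.ofReal (3 * (M i / M n) ^ 2)) := by
          gcongr with i hi
          · exact (Real.exp_le_exp.2 (hl _ hnj)).trans (Real.exp_one_lt_d9.le.trans (by norm_num))
          · exact (hlawB _ (Iic_subset_Iic.2 (hy hnj))).le
          · exact (hlawB _ (Ioc_subset_Iic_self.trans
              (Iic_subset_Iic.2 (hy (Finset.mem_Ico.1 hi).2)))).le
          · exact ih i (Finset.mem_Ico.1 hi).2 (Finset.mem_Ico.1 hi).1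
      _ = ENNReal.ofReal (3 * ((M n + ∑ i ∈ Finset.Ico n (k + 1), m i * (3 * (M i / M n) ^ 2)) /
            M (k + 1))) := by
          rw [ENNReal.ofReal_mul (by norm_num), add_div, Finset.sum_div, ENNReal.ofReal_add
            (by positivity) (Finset.sum_nonneg fun i _ => div_nonneg
              (mul_nonneg (hm0 i) (by positivity)) hp.le),
            ENNReal.ofReal_sum_of_nonneg fun i _ => div_nonneg
              (mul_nonneg (hm0 i) (by positivity)) hp.le]
          congr 2
          refine Finset.sum_congr rfl fun i _ => ?_
          rw [← ENNReal.ofReal_mul (div_nonneg (hm0 i) hp.le)]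
          congr 1
          ring
      _ ≤ ENNReal.ofReal (3 * (M (k + 1) / M n) ^ 2) := by
          refine ENNReal.ofReal_le_ofReal ?_
          gcongr
          rw [div_le_iff₀ hp]
          refine (hreal _ hnj).trans (le_of_eq ?_)
          rw [div_pow]
          ring

theorem measure_lt_height_le {κ : Measure (ℕ → ℝ≥0)} [IsProbabilityMeasure κ]
    (hind : iIndepFun (fun i (z : ℕ → ℝ≥0) => z i) κ) {μ : Measure ℝ≥0}
    (hlaw : ∀ i, κ.map (fun z => z i) = μ[|Iic (y i)]) (hy : Monotone (withZero y))
    (hfin : ∀ j, μ (Iic (withZero y j)) ≠ ∞) {n : ℕ} (hn : 1 ≤ n)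
    (hpos : 0 < μ (Iic (withZero y n))) {l : ℝ} (hl0 : 0 ≤ l)
    (hl : ∀ j ≥ n, l * (μ (Ioc (withZero y j) (withZero y (j + 1)))).toReal ≤ 1) {j : ℕ}
    (hnj : n ≤ j) (c : ℝ) :
    κ {z | c < height y z (fun j => (μ (Ioc (withZero y j) (withZero y (j + 1)))).toReal) n j} ≤
      ENNReal.ofReal (3 * ((μ (Iic (withZero y j))).toReal /
        (μ (Iic (withZero y n))).toReal) ^ 2 * Real.exp (-(l * c))) := by
  set m : ℕ → ℝ := fun j => (μ (Ioc (withZero y j) (withZero y (j + 1)))).toReal with hm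
  have hmeas : Measurable fun z : ℕ → ℝ≥0 =>
      ENNReal.ofReal (Real.exp (l * height y z m n j)) :=
    (Real.measurable_exp.comp ((measurable_height measurable_const measurable_id measurable_const
      n j).const_mul l)).ennreal_ofReal
  have h0 : ENNReal.ofReal (Real.exp (l * c)) ≠ 0 := by simp [Real.exp_pos]
  calc κ {z | c < height y z m n j}
      ≤ κ {z | ENNReal.ofReal (Real.exp (l * c)) ≤
          ENNReal.ofReal (Real.exp (l * height y z m n j))} := by
        refine measure_mono fun z hz => ENNReal.ofReal_le_ofReal (Real.exp_le_exp.2 ?_)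
        exact mul_le_mul_of_nonneg_left (le_of_lt hz) hl0
    _ ≤ (∫⁻ z, ENNReal.ofReal (Real.exp (l * height y z m n j)) ∂κ) /
          ENNReal.ofReal (Real.exp (l * c)) :=
        meas_ge_le_lintegral_div hmeas.aemeasurable h0 ENNReal.ofReal_ne_top
    _ ≤ _ := by
        rw [Real.exp_neg, ← div_eq_mul_inv, ENNReal.ofReal_div_of_pos (Real.exp_pos _)]
        exact ENNReal.div_le_div_right
          (lintegral_exp_height_le hind hlaw hy hfin hn hpos hl hnj) _

/-- If the branch lengths decay like a power of the index, then so do the heights. -/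
theorem ae_eventually_height_le {κ : Measure (ℕ → ℝ≥0)} [IsProbabilityMeasure κ]
    (hind : iIndepFun (fun i (z : ℕ → ℝ≥0) => z i) κ) {μ : Measure ℝ≥0}
    (hlaw : ∀ i, κ.map (fun z => z i) = μ[|Iic (y i)]) (hy : Monotone (withZero y))
    (hfin : ∀ j, μ (Iic (withZero y j)) ≠ ∞) (hpos : 0 < μ (Iic (y 0)))
    (hdec : ∀ᶠ k : ℕ in atTop, ∀ j ≥ 64 ^ k,
      (μ (Ioc (withZero y j) (withZero y (j + 1)))).toReal ≤ 8 / 2 ^ k) :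
    ∀ᵐ z ∂κ, ∀ᶠ k : ℕ in atTop, ∀ j, 64 ^ k ≤ j → j < 64 ^ (k + 1) →
      height y z (fun j => (μ (Ioc (withZero y j) (withZero y (j + 1)))).toReal) (64 ^ k) j ≤
        160 * k / 2 ^ k := by
  set m : ℕ → ℝ := fun j => (μ (Ioc (withZero y j) (withZero y (j + 1)))).toReal with hm
  set M : ℕ → ℝ := fun j => (μ (Iic (withZero y j))).toReal with hM
  have hm0 : ∀ j, 0 ≤ m j := fun j => ENNReal.toReal_nonneg
  have hMmono : Monotone M := fun i j hij =>
    ENNReal.toReal_mono (hfin j) (measure_mono (Iic_subset_Iic.2 (hy hij)))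
  have hM1 : 0 < M 1 := ENNReal.toReal_pos hpos.ne' (hfin 1)
  obtain ⟨k₀, hk₀⟩ := eventually_atTop.1 hdec
  -- From the index `64 ^ k₀` on, each branch adds at most `8`, so the masses grow at most linearly.
  obtain ⟨A, hA0, hA⟩ : ∃ A, 0 ≤ A ∧ ∀ j ≥ 1, M j ≤ A * j := by
    refine ⟨M (64 ^ k₀) + 8, by positivity, fun j hj => ?_⟩
    have hj1 : (1 : ℝ) ≤ j := by exact_mod_cast hj
    suffices h : M j ≤ M (64 ^ k₀) + 8 * j by
      nlinarith [(ENNReal.toReal_nonneg : 0 ≤ M (64 ^ k₀))]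
    rcases le_total j (64 ^ k₀) with hle | hle
    · linarith [hMmono hle]
    · clear hj1 hj
      induction j, hle using Nat.le_induction with
      | base => simp
      | succ j hle ih =>
        have h1 := hk₀ k₀ le_rfl j hle
        have h2 : (8 : ℝ) / 2 ^ k₀ ≤ 8 := div_le_self (by norm_num) (one_le_pow₀ (by norm_num))
        have h3 : M (j + 1) = M j + m j := measure_Iic_succ hy hfin j
        push_cast
        linarith
  set C : ℝ := 3 * (A / M 1) ^ 2 * 64 ^ 3 with hC
  -- With `l = 2 ^ k / 8` the branch masses satisfy `l * m ≤ 1`, and the threshold gives `exp (-20 *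
  -- k) ≤ 2 ^ (-20 * k)`. The union bound and the squared mass ratio cost a constant times `64 ^ (3
  -- * k) = 2 ^ (18 * k)`, leaving `(1 / 4) ^ k`.
  have hbound : ∀ k ≥ k₀, κ {z | ∃ j, 64 ^ k ≤ j ∧ j < 64 ^ (k + 1) ∧
      160 * k / 2 ^ k < height y z m (64 ^ k) j} ≤ ENNReal.ofReal (C * (1 / 4) ^ k) := by
    intro k hk
    have hone : ∀ j, 64 ^ k ≤ j → j < 64 ^ (k + 1) →
        κ {z | 160 * k / 2 ^ k < height y z m (64 ^ k) j} ≤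
          ENNReal.ofReal (3 * (A / M 1) ^ 2 * (64 ^ (k + 1)) ^ 2 * Real.exp (-(20 * k))) := by
      intro j hj hj'
      have h1k : 1 ≤ 64 ^ k := Nat.one_le_pow _ _ (by norm_num)
      have hMk : M 1 ≤ M (64 ^ k) := hMmono h1k
      have hpos' : 0 < μ (Iic (withZero y (64 ^ k))) :=
        hpos.trans_le (measure_mono (Iic_subset_Iic.2 (hy h1k)))
      have h2k : (0 : ℝ) < 2 ^ k := by positivity
      refine (measure_lt_height_le hind hlaw hy hfin h1k hpos' (l := 2 ^ k / 8) (by positivity)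
        (fun i hi => ?_) hj _).trans (ENNReal.ofReal_le_ofReal ?_)
      · have := hk₀ k hk i hi
        rw [le_div_iff₀ h2k] at this
        linarith
      · have e : (2 : ℝ) ^ k / 8 * (160 * k / 2 ^ k) = 20 * k := by
          field_simp
          ring
        rw [e]
        gcongr ?_ * _
        rw [mul_assoc, ← mul_pow]
        gcongr
        have hj'' : (j : ℝ) ≤ 64 ^ (k + 1) := by exact_mod_cast hj'.le
        calc M j / M (64 ^ k) ≤ (A * j) / M 1 := by
              gcongr
              · exact hA j (h1k.trans hj)
          _ ≤ (A * 64 ^ (k + 1)) / M 1 := by gcongr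
          _ = A / M 1 * 64 ^ (k + 1) := by ring
    calc κ {z | ∃ j, 64 ^ k ≤ j ∧ j < 64 ^ (k + 1) ∧ 160 * k / 2 ^ k < height y z m (64 ^ k) j}
        ≤ κ (⋃ j ∈ Finset.Ico (64 ^ k) (64 ^ (k + 1)),
            {z | 160 * k / 2 ^ k < height y z m (64 ^ k) j}) := by
          refine measure_mono ?_
          rintro z ⟨j, h1, h2, h3⟩
          simp only [mem_iUnion]
          exact ⟨j, Finset.mem_Ico.2 ⟨h1, h2⟩, h3⟩
      _ ≤ ∑ j ∈ Finset.Ico (64 ^ k) (64 ^ (k + 1)), ENNReal.ofReal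
            (3 * (A / M 1) ^ 2 * (64 ^ (k + 1)) ^ 2 * Real.exp (-(20 * k))) := by
          refine (measure_biUnion_finset_le _ _).trans (Finset.sum_le_sum fun j hj => ?_)
          exact hone j (Finset.mem_Ico.1 hj).1 (Finset.mem_Ico.1 hj).2
      _ ≤ ((64 ^ (k + 1) : ℕ) : ℝ≥0∞) * ENNReal.ofReal
            (3 * (A / M 1) ^ 2 * (64 ^ (k + 1)) ^ 2 * Real.exp (-(20 * k))) := by
          rw [Finset.sum_const, nsmul_eq_mul, Nat.card_Ico]
          gcongr
          exact Nat.sub_le _ _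
      _ ≤ ENNReal.ofReal (C * (1 / 4) ^ k) := by
          rw [← ENNReal.ofReal_natCast, ← ENNReal.ofReal_mul (Nat.cast_nonneg _)]
          refine ENNReal.ofReal_le_ofReal ?_
          have hexp : Real.exp (-(20 * k)) ≤ (1 / 2 ^ 20) ^ k := by
            rw [show -(20 * (k : ℝ)) = k * (-20) by ring, Real.exp_nat_mul]
            refine pow_le_pow_left₀ (Real.exp_nonneg _) ?_ k
            rw [Real.exp_neg, ← one_div]
            refine one_div_le_one_div_of_le (by norm_num) ?_
            rw [show (20 : ℝ) = (20 : ℕ) * 1 by norm_num, Real.exp_nat_mul]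
            refine pow_le_pow_left₀ (by norm_num) ?_ _
            linarith [Real.add_one_le_exp (1 : ℝ)]
          have e : (64 : ℝ) ^ k * (64 ^ k) ^ 2 * (1 / 2 ^ 20) ^ k = (1 / 4) ^ k := by
            rw [← pow_mul, mul_comm k 2, pow_mul, ← mul_pow, ← mul_pow]
            norm_num
          have hX : 0 ≤ 3 * (A / M 1) ^ 2 * 64 ^ 3 * ((64 : ℝ) ^ k * (64 ^ k) ^ 2) := by positivity
          push_cast
          calc (64 : ℝ) ^ (k + 1) * (3 * (A / M 1) ^ 2 * (64 ^ (k + 1)) ^ 2 * Real.exp (-(20 * k)))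
              = 3 * (A / M 1) ^ 2 * 64 ^ 3 * ((64 : ℝ) ^ k * (64 ^ k) ^ 2) *
                  Real.exp (-(20 * k)) := by ring
            _ ≤ 3 * (A / M 1) ^ 2 * 64 ^ 3 * ((64 : ℝ) ^ k * (64 ^ k) ^ 2) *
                  (1 / 2 ^ 20) ^ k := mul_le_mul_of_nonneg_left hexp hX
            _ = C * (1 / 4) ^ k := by rw [mul_assoc, e]
  refine ae_eventually_of_measure_le (b := fun k => C * (1 / 4) ^ k)
    ((summable_geometric_of_lt_one (by norm_num) (by norm_num)).mul_left C) ?_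
  filter_upwards [eventually_ge_atTop k₀] with k hk
  refine le_trans (le_of_eq ?_) (hbound k hk)
  congr 1
  ext z
  simp only [mem_ofPred_eq, not_forall, not_le, exists_prop]

end RecursiveTree

/-! ### Tail estimates for the random mass measure, and distinctness of the atoms. -/

section Atoms

open scoped Topology

/-! ### The mass measure of independent exponential atoms -/

variable {θ : ℕ → ℝ≥0} {Ω : Type*} [MeasurableSpace Ω] {P : Measure Ω}
  {X : Ω → ℕ → ℝ≥0}

/-- A deterministic function which is comparable with the expected mass of `[0, l]`. -/
def scale (θ : ℕ → ℝ≥0) (l : ℝ) : ℝ :=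
  (θ 0 : ℝ) ^ 2 * l + ∑' i, (θ (i + 1) : ℝ) * min 1 (θ (i + 1) * l)

theorem IsParameter.hasSum_real (hθ : IsParameter θ) : HasSum (fun i => (θ i : ℝ) ^ 2) 1 := by
  have := NNReal.hasSum_coe.2 hθ.hasSum
  simpa using this

theorem IsParameter.tsum_real (hθ : IsParameter θ) :
    (θ 0 : ℝ) ^ 2 + ∑' i, (θ (i + 1) : ℝ) ^ 2 = 1 := by
  rw [← hθ.hasSum_real.tsum_eq, hθ.hasSum_real.summable.tsum_eq_zero_add]

theorem IsParameter.summable_real (hθ : IsParameter θ) :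
    Summable fun i => (θ (i + 1) : ℝ) ^ 2 :=
  (summable_nat_add_iff 1).2 hθ.hasSum_real.summable

theorem IsParameter.le_one (hθ : IsParameter θ) (i : ℕ) : (θ i : ℝ) ≤ 1 := by
  have h1 := hθ.hasSum_real.summable.le_tsum i fun j _ => sq_nonneg _
  rw [hθ.hasSum_real.tsum_eq] at h1
  exact (sq_le_one_iff₀ (θ i).2).1 h1

theorem scale_term_nonneg (θ : ℕ → ℝ≥0) {l : ℝ} (hl : 0 ≤ l) (i : ℕ) :
    0 ≤ (θ (i + 1) : ℝ) * min 1 (θ (i + 1) * l) :=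
  mul_nonneg (NNReal.coe_nonneg _) (le_min zero_le_one (mul_nonneg (NNReal.coe_nonneg _) hl))

theorem scale_term_le (θ : ℕ → ℝ≥0) (l : ℝ) (i : ℕ) :
    (θ (i + 1) : ℝ) * min 1 (θ (i + 1) * l) ≤ (θ (i + 1) : ℝ) ^ 2 * l := by
  rw [sq, mul_assoc]
  exact mul_le_mul_of_nonneg_left (min_le_right _ _) (NNReal.coe_nonneg _)

theorem IsParameter.summable_scale (hθ : IsParameter θ) {l : ℝ} (hl : 0 ≤ l) :
    Summable fun i => (θ (i + 1) : ℝ) * min 1 (θ (i + 1) * l) :=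
  Summable.of_nonneg_of_le (scale_term_nonneg θ hl) (scale_term_le θ l)
    (hθ.summable_real.mul_right l)

/-- Consequence of `∑ θ i ^ 2 = 1`; it keeps the cells of the grid from being too short. -/
theorem IsParameter.scale_le (hθ : IsParameter θ) {l : ℝ} (hl : 0 ≤ l) : scale θ l ≤ l := by
  have h1 := (hθ.summable_scale hl).tsum_le_tsum (scale_term_le θ l) (hθ.summable_real.mul_right l)
  rw [tsum_mul_right] at h1
  have h2 := hθ.tsum_real
  calc scale θ l ≤ (θ 0 : ℝ) ^ 2 * l + (∑' i, (θ (i + 1) : ℝ) ^ 2) * l := add_le_add_right h1 _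
    _ = ((θ 0 : ℝ) ^ 2 + ∑' i, (θ (i + 1) : ℝ) ^ 2) * l := by ring
    _ = l := by rw [h2, one_mul]

theorem IsParameter.one_le_scale (hθ : IsParameter θ) {l : ℝ} (hl : 1 ≤ l) : 1 ≤ scale θ l := by
  rw [← hθ.tsum_real]
  refine add_le_add (le_mul_of_one_le_right (sq_nonneg _) hl) ?_
  refine hθ.summable_real.tsum_le_tsum (fun i => ?_) (hθ.summable_scale (by linarith))
  rw [sq]
  refine mul_le_mul_of_nonneg_left (le_min (hθ.le_one _) ?_) (NNReal.coe_nonneg _)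
  exact le_mul_of_one_le_right (NNReal.coe_nonneg _) hl

theorem prob_atom_Iic (hX : Measurable X) {i : ℕ} (hi : 0 < θ (i + 1))
    (hlaw : P.map (fun ω => (X ω i : ℝ)) = expMeasure (θ (i + 1))) (t : ℝ≥0) :
    P.real {ω | X ω i ∈ Iic t} = 1 - Real.exp (-(θ (i + 1) * t)) := by
  have hi' : (0 : ℝ) < θ (i + 1) := hi
  have := isProbabilityMeasure_expMeasure hi'
  have h1 := cdf_expMeasure_eq hi' t
  rw [if_pos (NNReal.coe_nonneg t), cdf_eq_real, ← hlaw,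
    map_measureReal_apply (by fun_prop) measurableSet_Iic] at h1
  rw [← h1]
  congr 1

theorem prob_atom_Ioc [IsProbabilityMeasure P] (hX : Measurable X) {i : ℕ} (hi : 0 < θ (i + 1))
    (hlaw : P.map (fun ω => (X ω i : ℝ)) = expMeasure (θ (i + 1))) {s t : ℝ≥0} (hst : s ≤ t) :
    P.real {ω | X ω i ∈ Ioc s t} =
      Real.exp (-(θ (i + 1) * s)) - Real.exp (-(θ (i + 1) * t)) := by
  have hm : Measurable fun ω => X ω i := by fun_prop
  have h1 : {ω | X ω i ∈ Iic t} = {ω | X ω i ∈ Iic s} ∪ {ω | X ω i ∈ Ioc s t} := by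
    rw [← Iic_union_Ioc_eq_Iic hst]
    rfl
  have h2 : P.real {ω | X ω i ∈ Iic t} =
      P.real {ω | X ω i ∈ Iic s} + P.real {ω | X ω i ∈ Ioc s t} := by
    rw [h1]
    refine measureReal_union ?_ (hm measurableSet_Ioc)
    exact Disjoint.preimage (fun ω => X ω i) (Iic_disjoint_Ioc le_rfl)
  rw [prob_atom_Iic hX hi hlaw, prob_atom_Iic hX hi hlaw] at h2
  linarith

/-- Exponential moments of sums of functions of independent indicators. -/
theorem lintegral_exp_sum_indicator_le [IsProbabilityMeasure P] (hX : Measurable X)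
    (hind : iIndepFun (fun i ω => X ω i) P)
    {B : Set ℝ≥0} (hB : MeasurableSet B) {g b : ℕ → ℝ}
    (hgb : ∀ i, 1 + (Real.exp (g i) - 1) * P.real {ω | X ω i ∈ B} ≤ Real.exp (b i)) (n : ℕ) :
    ∫⁻ ω, ENNReal.ofReal (Real.exp (∑ i ∈ Finset.range n, g i * B.indicator 1 (X ω i))) ∂P ≤
      ENNReal.ofReal (Real.exp (∑ i ∈ Finset.range n, b i)) := by
  have hφ : ∀ i, Measurable fun t : ℝ≥0 =>
      ENNReal.ofReal (Real.exp (g i * B.indicator (1 : ℝ≥0 → ℝ) t)) := fun i =>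
    (Real.measurable_exp.comp ((measurable_one.indicator hB).const_mul (g i))).ennreal_ofReal
  have hm : ∀ i, Measurable fun ω => X ω i := fun i => by fun_prop
  have hone : ∀ i, ∫⁻ ω, ENNReal.ofReal (Real.exp (g i * B.indicator (1 : ℝ≥0 → ℝ) (X ω i))) ∂P ≤
      ENNReal.ofReal (Real.exp (b i)) := by
    intro i
    have hBi : MeasurableSet {ω | X ω i ∈ B} := hm i hB
    have hp : P.real {ω | X ω i ∈ B} ≤ 1 := measureReal_le_one
    have e : ∀ ω, ENNReal.ofReal (Real.exp (g i * B.indicator (1 : ℝ≥0 → ℝ) (X ω i))) =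
        {ω | X ω i ∈ B}.indicator (fun _ => ENNReal.ofReal (Real.exp (g i))) ω +
          {ω | X ω i ∈ B}ᶜ.indicator (fun _ => 1) ω := by
      intro ω
      by_cases hω : X ω i ∈ B
      · rw [indicator_of_mem hω, indicator_of_mem (show ω ∈ {ω | X ω i ∈ B} from hω),
          indicator_of_notMem (show ω ∉ {ω | X ω i ∈ B}ᶜ from fun hc => hc hω)]
        simp
      · rw [indicator_of_notMem hω, indicator_of_notMem (show ω ∉ {ω | X ω i ∈ B} from hω),
          indicator_of_mem (show ω ∈ {ω | X ω i ∈ B}ᶜ from hω)]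
        simp
    simp_rw [e]
    rw [lintegral_add_left (measurable_const.indicator hBi), lintegral_indicator_const hBi,
      lintegral_indicator_const hBi.compl, one_mul, ← ofReal_measureReal, ← ofReal_measureReal,
      ← ENNReal.ofReal_mul (Real.exp_nonneg _), ← ENNReal.ofReal_add (by positivity)
      measureReal_nonneg, probReal_compl_eq_one_sub hBi]
    refine ENNReal.ofReal_le_ofReal (le_trans (le_of_eq ?_) (hgb i))
    ring
  have hprod := lintegral_prod_eq_prod_lintegral_of_indepFun (Finset.range n) _
    (hind.comp (fun i t => ENNReal.ofReal (Real.exp (g i * B.indicator (1 : ℝ≥0 → ℝ) t))) hφ)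
    fun i => (hφ i).comp (hm i)
  simp only [Function.comp_apply] at hprod
  simp_rw [Real.exp_sum, ENNReal.ofReal_prod_of_nonneg fun i _ => Real.exp_nonneg _]
  rw [hprod]
  exact Finset.prod_le_prod' fun i _ => hone i

theorem mul_exp_neg_le_min {t : ℝ} (ht : 0 ≤ t) : t * Real.exp (-t) ≤ min 1 t := by
  refine le_min ?_ (mul_le_of_le_one_right ht (Real.exp_le_one_iff.2 (by linarith)))
  rw [Real.exp_neg, ← div_eq_mul_inv, div_le_one (Real.exp_pos _)]
  linarith [Real.add_one_le_exp t]

theorem half_min_le_one_sub_exp {t : ℝ} (ht : 0 ≤ t) : min 1 t / 2 ≤ 1 - Real.exp (-t) := by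
  have h1 : 0 < min 1 t ∨ t = 0 := by
    rcases ht.eq_or_lt with h | h
    · exact Or.inr h.symm
    · exact Or.inl (lt_min one_pos h)
  rcases h1 with h1 | rfl
  · set s := min 1 t
    have hs1 : s ≤ 1 := min_le_left _ _
    have h2 : Real.exp (-t) ≤ Real.exp (-s) :=
      Real.exp_le_exp.2 (neg_le_neg (min_le_right _ _))
    have h3 : Real.exp (-s) ≤ 1 / (1 + s) := by
      rw [Real.exp_neg, ← one_div]
      exact one_div_le_one_div_of_le (by linarith) (by linarith [Real.add_one_le_exp s])
    have h4 : 1 / (1 + s) ≤ 1 - s / 2 := by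
      rw [div_le_iff₀ (by linarith)]
      nlinarith
    linarith
  · simp

theorem lebesgue_Iic (b : ℝ≥0) : lebesgue (Iic b) = ENNReal.ofReal b := by
  have he : MeasurableEmbedding ((↑) : ℝ≥0 → ℝ) :=
    MeasurableEmbedding.subtype_coe measurableSet_Ici
  have himg : ((↑) : ℝ≥0 → ℝ) '' Iic b = Icc (0 : ℝ) b := by
    ext t
    constructor
    · rintro ⟨s, hs, rfl⟩
      exact ⟨s.2, NNReal.coe_le_coe.2 hs⟩
    · intro ht
      exact ⟨⟨t, ht.1⟩, NNReal.coe_le_coe.1 ht.2, rfl⟩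
  rw [lebesgue, he.comap_apply, himg, Real.volume_Icc, sub_zero]

theorem massMeasure_eq_iSup (θ x : ℕ → ℝ≥0) {B : Set ℝ≥0} (hB : MeasurableSet B) {b : ℝ}
    (hb : 0 ≤ b) (hleb : lebesgue B = ENNReal.ofReal b) :
    massMeasure θ x B = ⨆ n, ENNReal.ofReal ((θ 0 : ℝ) ^ 2 * b +
      ∑ i ∈ Finset.range n, (θ (i + 1) : ℝ) * B.indicator 1 (x i)) := by
  rw [massMeasure_apply θ x hB, hleb, ENNReal.tsum_eq_iSup_nat, ENNReal.add_iSup]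
  refine iSup_congr fun n => ?_
  have h0 : ∀ i, 0 ≤ (θ (i + 1) : ℝ) * B.indicator (1 : ℝ≥0 → ℝ) (x i) := fun i =>
    mul_nonneg (NNReal.coe_nonneg _) (indicator_nonneg (fun _ _ => zero_le_one) _)
  rw [ENNReal.ofReal_add (by positivity) (Finset.sum_nonneg fun i _ => h0 i),
    ENNReal.ofReal_mul (by positivity), ENNReal.ofReal_pow (NNReal.coe_nonneg _),
    ENNReal.ofReal_coe_nnreal, ENNReal.ofReal_sum_of_nonneg fun i _ => h0 i]
  congr 1
  refine Finset.sum_congr rfl fun i _ => ?_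
  rw [ENNReal.ofReal_mul (NNReal.coe_nonneg _), ENNReal.ofReal_coe_nnreal]
  congr 1
  by_cases hi : x i ∈ B
  · simp [hi]
  · simp [hi]

theorem measure_exp_le {Y : Ω → ℝ} (hY : Measurable Y) {c a : ℝ}
    (hE : ∫⁻ ω, ENNReal.ofReal (Real.exp (Y ω)) ∂P ≤ ENNReal.ofReal (Real.exp a)) :
    P {ω | c ≤ Y ω} ≤ ENNReal.ofReal (Real.exp (a - c)) := by
  have h0 : ENNReal.ofReal (Real.exp c) ≠ 0 := by simp [Real.exp_pos]
  calc P {ω | c ≤ Y ω}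
      ≤ P {ω | ENNReal.ofReal (Real.exp c) ≤ ENNReal.ofReal (Real.exp (Y ω))} :=
        measure_mono fun ω hω => ENNReal.ofReal_le_ofReal (Real.exp_le_exp.2 hω)
    _ ≤ (∫⁻ ω, ENNReal.ofReal (Real.exp (Y ω)) ∂P) / ENNReal.ofReal (Real.exp c) :=
        meas_ge_le_lintegral_div (Real.measurable_exp.comp hY).ennreal_ofReal.aemeasurable h0
          ENNReal.ofReal_ne_top
    _ ≤ _ := by
        rw [Real.exp_sub, ENNReal.ofReal_div_of_pos (Real.exp_pos _)]
        exact ENNReal.div_le_div_right hE _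

/-- Chernoff bound for the mass of an interval at distance at least `l` of the origin. -/
theorem measure_lt_massMeasure_Ioc_le [IsProbabilityMeasure P] (hθ : IsParameter θ)
    (hX : Measurable X)
    (hind : iIndepFun (fun i ω => X ω i) P)
    (hlaw : ∀ i, 0 < θ (i + 1) → P.map (fun ω => (X ω i : ℝ)) = expMeasure (θ (i + 1)))
    {l s w : ℝ≥0} (hls : l ≤ s) (c : ℝ) :
    P {ω | ENNReal.ofReal c < massMeasure θ (X ω) (Ioc s (s + w))} ≤
      ENNReal.ofReal (Real.exp (w * scale θ l - l / 2 * c)) := by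
  have hleb : lebesgue (Ioc s (s + w)) = ENNReal.ofReal w := by
    rw [lebesgue_Ioc]
    congr 1
    push_cast
    ring
  set S : ℕ → Ω → ℝ := fun n ω => (θ 0 : ℝ) ^ 2 * w +
    ∑ i ∈ Finset.range n, (θ (i + 1) : ℝ) * (Ioc s (s + w)).indicator 1 (X ω i) with hS
  -- Exponential moment of parameter `l / 2`. With `t = θ * l / 2`, the factor `exp t` from the
  -- moment is beaten by the factor `exp (-2 * t)` from the density of an exponential variable
  -- beyond `l`. What remains is `t * exp (-t)`, at most `min 1 (θ * l)`.
  have hgb : ∀ i, 1 + (Real.exp (l / 2 * (θ (i + 1) : ℝ)) - 1) *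
      P.real {ω | X ω i ∈ Ioc s (s + w)} ≤
        Real.exp (w * ((θ (i + 1) : ℝ) * min 1 ((θ (i + 1) : ℝ) * l))) := by
    intro i
    rcases eq_zero_or_pos (θ (i + 1)) with h0 | h0
    · simp [h0]
    rw [prob_atom_Ioc hX h0 (hlaw i h0) le_self_add]
    push_cast
    set a : ℝ := (θ (i + 1) : ℝ)
    have ha : 0 ≤ a := (θ (i + 1)).2
    have hls' : (l : ℝ) ≤ s := hls
    have hl0 : (0 : ℝ) ≤ l := l.2
    have hw0 : (0 : ℝ) ≤ w := w.2
    set t : ℝ := a * l / 2 with ht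
    have ht0 : 0 ≤ t := by positivity
    have h1 : Real.exp (-(a * s)) - Real.exp (-(a * (s + w))) ≤ Real.exp (-(2 * t)) * (a * w) := by
      have e1 : Real.exp (-(a * (s + w))) = Real.exp (-(a * s)) * Real.exp (-(a * w)) := by
        rw [← Real.exp_add]; congr 1; ring
      have e2 : Real.exp (-(a * s)) ≤ Real.exp (-(2 * t)) := by
        refine Real.exp_le_exp.2 (neg_le_neg ?_)
        rw [ht]
        nlinarith
      have e3 : 1 - Real.exp (-(a * w)) ≤ a * w := by linarith [Real.add_one_le_exp (-(a * w))]
      calc _ = Real.exp (-(a * s)) * (1 - Real.exp (-(a * w))) := by rw [e1]; ring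
        _ ≤ Real.exp (-(a * s)) * (a * w) :=
          mul_le_mul_of_nonneg_left e3 (Real.exp_nonneg _)
        _ ≤ _ := mul_le_mul_of_nonneg_right e2 (by positivity)
    have h2 : Real.exp (l / 2 * a) - 1 ≤ t * Real.exp t := by
      have e1 : l / 2 * a = t := by rw [ht]; ring
      rw [e1]
      have e2 : 1 - Real.exp (-t) ≤ t := by linarith [Real.add_one_le_exp (-t)]
      have e3 : Real.exp t * Real.exp (-t) = 1 := by rw [← Real.exp_add]; simp
      nlinarith [Real.exp_pos t]
    have h3 : 0 ≤ Real.exp (l / 2 * a) - 1 := by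
      linarith [Real.add_one_le_exp (l / 2 * a), (by positivity : 0 ≤ (l : ℝ) / 2 * a)]
    have h4 : (Real.exp (l / 2 * a) - 1) * (Real.exp (-(a * s)) - Real.exp (-(a * (s + w)))) ≤
        w * (a * min 1 (a * l)) := by
      calc _ ≤ (t * Real.exp t) * (Real.exp (-(2 * t)) * (a * w)) := by
            refine mul_le_mul h2 h1 ?_ (by positivity)
            rw [sub_nonneg]
            exact Real.exp_le_exp.2 (neg_le_neg (by nlinarith))
        _ = w * (a * (t * Real.exp (-t))) := by
            have : Real.exp t * Real.exp (-(2 * t)) = Real.exp (-t) := by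
              rw [← Real.exp_add]; congr 1; ring
            rw [← this]
            ring
        _ ≤ w * (a * min 1 (a * l)) := by
            gcongr
            refine (mul_exp_neg_le_min ht0).trans (min_le_min_left _ ?_)
            rw [ht]
            linarith [(by positivity : 0 ≤ a * l)]
    linarith [Real.add_one_le_exp (w * (a * min 1 (a * l)))]
  have hSn : ∀ n, P {ω | c < S n ω} ≤ ENNReal.ofReal (Real.exp (w * scale θ l - l / 2 * c)) := by
    intro n
    have hmono : {ω | c < S n ω} ⊆ {ω | l / 2 * c - l / 2 * (θ 0 ^ 2 * w) ≤
        ∑ i ∈ Finset.range n, (l : ℝ) / 2 * (θ (i + 1) : ℝ) *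
          (Ioc s (s + w)).indicator (1 : ℝ≥0 → ℝ) (X ω i)} := by
      intro ω hω
      simp only [mem_ofPred_eq, mul_assoc, ← Finset.mul_sum] at hω ⊢
      rw [← mul_sub]
      refine mul_le_mul_of_nonneg_left ?_ (by positivity)
      simp only [hS] at hω
      linarith
    have hmeas : Measurable fun ω => ∑ i ∈ Finset.range n, (l : ℝ) / 2 * θ (i + 1) *
        (Ioc s (s + w)).indicator (1 : ℝ≥0 → ℝ) (X ω i) := by
      refine Finset.measurable_sum _ fun i _ => Measurable.const_mul ?_ _
      exact (measurable_one.indicator measurableSet_Ioc).comp (by fun_prop)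
    refine (measure_mono hmono).trans ((measure_exp_le hmeas
      (lintegral_exp_sum_indicator_le hX hind measurableSet_Ioc hgb n)).trans
      (ENNReal.ofReal_le_ofReal (Real.exp_le_exp.2 ?_)))
    have hsum := (hθ.summable_scale l.coe_nonneg).sum_le_tsum (Finset.range n)
      fun i _ => scale_term_nonneg θ l.coe_nonneg i
    rw [← Finset.mul_sum, scale]
    have hl0 : (0 : ℝ) ≤ l := l.2
    have hw0 : (0 : ℝ) ≤ w := w.2
    have e1 := mul_le_mul_of_nonneg_left hsum hw0
    have e2 : 0 ≤ (l : ℝ) / 2 * ((θ 0 : ℝ) ^ 2 * w) := by positivity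
    -- The deterministic Brownian part costs half of what `scale` provides for it.
    rw [mul_add, show (w : ℝ) * ((θ 0 : ℝ) ^ 2 * l) = 2 * (l / 2 * ((θ 0 : ℝ) ^ 2 * w)) by ring]
    linarith
  have hset : {ω | ENNReal.ofReal c < massMeasure θ (X ω) (Ioc s (s + w))} ⊆
      ⋃ n, {ω | c < S n ω} := by
    intro ω hω
    rw [mem_ofPred_eq, massMeasure_eq_iSup θ (X ω) measurableSet_Ioc w.2 hleb, lt_iSup_iff] at hω
    obtain ⟨n, hn⟩ := hω
    exact mem_iUnion.2 ⟨n, (ENNReal.ofReal_lt_ofReal_iff'.1 hn).1⟩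
  -- The truncated masses increase to the mass, so the bound uniform in `n` passes to the union.
  have hmonoS : Monotone fun n => {ω | c < S n ω} := by
    intro n n' hn ω hω
    refine lt_of_lt_of_le (show c < S n ω from hω) ?_
    refine add_le_add_right (Finset.sum_le_sum_of_subset_of_nonneg
      (Finset.range_subset_range.2 hn) fun i _ _ => ?_) _
    exact mul_nonneg (NNReal.coe_nonneg _) (indicator_nonneg (fun _ _ => zero_le_one) _)
  refine (measure_mono hset).trans ?_
  rw [hmonoS.measure_iUnion]
  exact iSup_le hSn

/-- Lower tail of the mass of `[0, l]`. -/
theorem measure_massMeasure_Iic_lt_le [IsProbabilityMeasure P] (hθ : IsParameter θ)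
    (hX : Measurable X) (hind : iIndepFun (fun i ω => X ω i) P)
    (hlaw : ∀ i, 0 < θ (i + 1) → P.map (fun ω => (X ω i : ℝ)) = expMeasure (θ (i + 1)))
    (l : ℝ≥0) (k : ℝ) :
    P {ω | massMeasure θ (X ω) (Iic l) < ENNReal.ofReal (scale θ l / 4 - k)} ≤
      ENNReal.ofReal (Real.exp (-k)) := by
  have hl0 : (0 : ℝ) ≤ l := l.2
  -- Laplace transform at `-1`. Since `θ (i + 1) ≤ 1`, both `1 - exp (-θ)` and `1 - exp (-θ * l)`
  -- are at least half of `min 1` of their argument, whence the `4`.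
  have hgb : ∀ i, 1 + (Real.exp (-(θ (i + 1) : ℝ)) - 1) * P.real {ω | X ω i ∈ Iic l} ≤
      Real.exp (-((θ (i + 1) : ℝ) * min 1 ((θ (i + 1) : ℝ) * l) / 4)) := by
    intro i
    rcases eq_zero_or_pos (θ (i + 1)) with h0 | h0
    · simp [h0]
    rw [prob_atom_Iic hX h0 (hlaw i h0)]
    set a : ℝ := (θ (i + 1) : ℝ)
    have ha : 0 ≤ a := (θ (i + 1)).2
    have h1 := half_min_le_one_sub_exp ha
    rw [min_eq_right (hθ.le_one _)] at h1
    have h2 := half_min_le_one_sub_exp (mul_nonneg ha hl0)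
    have h3 : a / 2 * (min 1 (a * l) / 2) ≤ (1 - Real.exp (-a)) * (1 - Real.exp (-(a * l))) :=
      mul_le_mul h1 h2 (by positivity) (by linarith)
    linarith [Real.add_one_le_exp (-(a * min 1 (a * l) / 4))]
  have hbound : ∀ n, P {ω | massMeasure θ (X ω) (Iic l) < ENNReal.ofReal (scale θ l / 4 - k)} ≤
      ENNReal.ofReal (Real.exp (∑ i ∈ Finset.range n,
        -((θ (i + 1) : ℝ) * min 1 ((θ (i + 1) : ℝ) * l) / 4) -
          ((θ 0 : ℝ) ^ 2 * l - (scale θ l / 4 - k)))) := by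
    intro n
    have hmeas : Measurable fun ω => ∑ i ∈ Finset.range n, -(θ (i + 1) : ℝ) *
        (Iic l).indicator (1 : ℝ≥0 → ℝ) (X ω i) := by
      refine Finset.measurable_sum _ fun i _ => Measurable.const_mul ?_ _
      exact (measurable_one.indicator measurableSet_Iic).comp (by fun_prop)
    refine (measure_mono ?_).trans (measure_exp_le hmeas
      (lintegral_exp_sum_indicator_le hX hind measurableSet_Iic hgb n))
    intro ω hω
    rw [mem_ofPred_eq, massMeasure_eq_iSup θ (X ω) measurableSet_Iic hl0 (lebesgue_Iic l)] at hω
    have h1 := (ENNReal.ofReal_lt_ofReal_iff'.1 ((le_iSup _ n).trans_lt hω)).1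
    simp only [mem_ofPred_eq, neg_mul, Finset.sum_neg_distrib]
    linarith
  have hlim : Tendsto (fun n => ENNReal.ofReal (Real.exp (∑ i ∈ Finset.range n,
        -((θ (i + 1) : ℝ) * min 1 ((θ (i + 1) : ℝ) * l) / 4) -
          ((θ 0 : ℝ) ^ 2 * l - (scale θ l / 4 - k))))) atTop
      (𝓝 (ENNReal.ofReal (Real.exp (-((∑' i, (θ (i + 1) : ℝ) *
        min 1 ((θ (i + 1) : ℝ) * l)) / 4) - ((θ 0 : ℝ) ^ 2 * l - (scale θ l / 4 - k)))))) := by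
    refine ENNReal.tendsto_ofReal ((Real.continuous_exp.tendsto _).comp (Tendsto.sub_const ?_ _))
    exact (((hθ.summable_scale hl0).hasSum.div_const 4).neg).tendsto_sum_nat
  refine (ge_of_tendsto' hlim hbound).trans
    (ENNReal.ofReal_le_ofReal (Real.exp_le_exp.2 ?_))
  rw [scale]
  have : 0 ≤ (θ 0 : ℝ) ^ 2 * l := by positivity
  linarith

theorem lintegral_massMeasure_Iic_le [IsProbabilityMeasure P] (hθ : IsParameter θ)
    (hX : Measurable X)
    (hlaw : ∀ i, 0 < θ (i + 1) → P.map (fun ω => (X ω i : ℝ)) = expMeasure (θ (i + 1)))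
    (l : ℝ≥0) : ∫⁻ ω, massMeasure θ (X ω) (Iic l) ∂P ≤ l := by
  have hm : ∀ i, Measurable fun ω => (Iic l).indicator (1 : ℝ≥0 → ℝ≥0∞) (X ω i) := fun i =>
    (measurable_one.indicator measurableSet_Iic).comp (by fun_prop)
  have hterm : ∀ i, ∫⁻ ω, (θ (i + 1) : ℝ≥0∞) * (Iic l).indicator 1 (X ω i) ∂P ≤
      ENNReal.ofReal ((θ (i + 1) : ℝ) ^ 2 * l) := by
    intro i
    rcases eq_zero_or_pos (θ (i + 1)) with h0 | h0
    · simp [h0]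
    have e : ∫⁻ ω, (Iic l).indicator (1 : ℝ≥0 → ℝ≥0∞) (X ω i) ∂P = P {ω | X ω i ∈ Iic l} := by
      rw [← lintegral_indicator_one (show MeasurableSet {ω | X ω i ∈ Iic l} from
        (by fun_prop : Measurable fun ω => X ω i) measurableSet_Iic)]
      rfl
    rw [lintegral_const_mul _ (hm i), e, ← ofReal_measureReal, prob_atom_Iic hX h0 (hlaw i h0),
      ← ENNReal.ofReal_coe_nnreal, ← ENNReal.ofReal_mul (NNReal.coe_nonneg _)]
    refine ENNReal.ofReal_le_ofReal ?_
    rw [sq, mul_assoc]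
    refine mul_le_mul_of_nonneg_left ?_ (NNReal.coe_nonneg _)
    linarith [Real.add_one_le_exp (-((θ (i + 1) : ℝ) * l))]
  simp_rw [massMeasure_apply θ _ measurableSet_Iic]
  rw [lintegral_add_left measurable_const, lintegral_const, measure_univ, mul_one,
    lintegral_tsum fun i => ((hm i).const_mul _).aemeasurable]
  refine (add_le_add_right (ENNReal.tsum_le_tsum hterm) _).trans ?_
  have hs := hθ.summable_real.mul_right (l : ℝ)
  have hn : 0 ≤ (∑' i, (θ (i + 1) : ℝ) ^ 2) * (l : ℝ) :=
    mul_nonneg (tsum_nonneg fun i => sq_nonneg _) l.2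
  rw [← ENNReal.ofReal_tsum_of_nonneg (fun i => by positivity) hs, tsum_mul_right, lebesgue_Iic,
    ← ENNReal.ofReal_coe_nnreal, ← ENNReal.ofReal_pow (NNReal.coe_nonneg _),
    ← ENNReal.ofReal_mul (by positivity), ← ENNReal.ofReal_add (by positivity) hn, ← add_mul, hθ.tsum_real,
    one_mul,
    ENNReal.ofReal_coe_nnreal]

/-- Not all `θ i` vanish. This provides a fixed positive lower bound for the mass, needed when
`scale` does not grow. -/
theorem exists_massMeasure_pos (hθ : IsParameter θ) (x : ℕ → ℝ≥0) :
    ∃ l, 0 < massMeasure θ x (Iic l) := by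
  by_cases h0 : θ 0 = 0
  · obtain ⟨i, hi⟩ : ∃ i, θ (i + 1) ≠ 0 := by
      by_contra! hcon
      have := hθ.tsum_real
      simp [h0, hcon] at this
    refine ⟨x i, ?_⟩
    rw [massMeasure_apply θ x measurableSet_Iic]
    refine lt_of_lt_of_le ?_ (le_add_left (ENNReal.le_tsum i))
    rw [indicator_of_mem (mem_Iic.2 (le_refl (x i)))]
    simpa [pos_iff_ne_zero] using hi
  · refine ⟨1, ?_⟩
    rw [massMeasure_apply θ x measurableSet_Iic, lebesgue_Iic]
    refine lt_of_lt_of_le ?_ (le_add_right le_rfl)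
    simpa [pos_iff_ne_zero] using h0

/-- By Fubini, the product law does not charge the diagonal when one marginal has no atom. -/
theorem ae_ne_of_indepFun {E : Type*} [MeasurableSpace E] [MeasurableSingletonClass E]
    [MeasurableEq E] [IsProbabilityMeasure P] {f g : Ω → E} (hf : Measurable f)
    (hg : Measurable g) (hfg : IndepFun f g P) (h0 : ∀ t, P.map g {t} = 0) :
    ∀ᵐ ω ∂P, f ω ≠ g ω := by
  have h1 := (indepFun_iff_map_prod_eq_prod_map_map hf.aemeasurable hg.aemeasurable).1 hfg
  have hd : MeasurableSet {p : E × E | p.1 = p.2} :=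
    measurableSet_eq_fun measurable_fst measurable_snd
  have := Measure.isProbabilityMeasure_map (μ := P) hg.aemeasurable
  have := Measure.isProbabilityMeasure_map (μ := P) hf.aemeasurable
  have h2 : P.map (fun ω => (f ω, g ω)) {p : E × E | p.1 = p.2} = 0 := by
    rw [h1, Measure.measure_prod_null hd]
    refine Eventually.of_forall fun t => ?_
    refine measure_mono_null (fun a ha => ?_) (h0 t)
    exact (show t = a from ha).symm
  rw [Measure.map_apply (hf.prodMk hg) hd] at h2
  rw [ae_iff]
  simp only [ne_eq, not_not]
  exact h2

/-- Two atoms almost surely do not have the same position. -/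
theorem ae_atom_injective [IsProbabilityMeasure P] (hX : Measurable X)
    (hind : iIndepFun (fun i ω => X ω i) P)
    (hlaw : ∀ i, 0 < θ (i + 1) → P.map (fun ω => (X ω i : ℝ)) = expMeasure (θ (i + 1))) :
    ∀ᵐ ω ∂P, ∀ i j, 0 < θ (i + 1) → 0 < θ (j + 1) → X ω i = X ω j → i = j := by
  have h : ∀ i j, 0 < θ (j + 1) → i ≠ j → ∀ᵐ ω ∂P, X ω i ≠ X ω j := by
    intro i j hj hij
    refine ae_ne_of_indepFun (by fun_prop) (by fun_prop) (hind.indepFun hij) fun t => ?_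
    have h1 : P.map (fun ω => (X ω j : ℝ)) {(t : ℝ)} = 0 := by
      rw [hlaw j hj, expMeasure, gammaMeasure]
      exact measure_singleton _
    rw [Measure.map_apply (by fun_prop) (measurableSet_singleton _)] at h1 ⊢
    refine measure_mono_null (fun ω hω => ?_) h1
    exact congrArg _ (show X ω j = t from hω)
  rw [ae_all_iff]
  intro i
  rw [ae_all_iff]
  intro j
  by_cases hij : i = j
  · exact Eventually.of_forall fun _ _ _ _ => hij
  by_cases hj : 0 < θ (j + 1)
  · filter_upwards [h i j hj hij] with ω hω _ _ h1 using absurd h1 hω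
  · exact Eventually.of_forall fun _ _ h1 => absurd h1 hj

end Atoms

/-! ### Regularity of the atoms and of the Poisson cuts at dyadic scales. -/

section Cuts

open scoped Topology

/-! ### Regularity of the mass measure along a grid -/

variable {θ : ℕ → ℝ≥0}

/-- The grid of step `2 ^ k / scale θ (4 ^ k)` which starts at `4 ^ k`. -/
def gridPoint (θ : ℕ → ℝ≥0) (k a : ℕ) : ℝ≥0 :=
  4 ^ k + a * Real.toNNReal (2 ^ k / scale θ (4 ^ k))

/-- The cells of the grid `gridPoint`. -/
def gridCell (θ : ℕ → ℝ≥0) (k a : ℕ) : Set ℝ≥0 :=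
  Ioc (gridPoint θ k a) (gridPoint θ k (a + 1))

theorem gridPoint_succ (θ : ℕ → ℝ≥0) (k a : ℕ) : gridPoint θ k (a + 1) =
    gridPoint θ k a + Real.toNNReal (2 ^ k / scale θ (4 ^ k)) := by
  simp only [gridPoint]
  push_cast
  ring

theorem IsParameter.scale_pow_pos (hθ : IsParameter θ) (k : ℕ) : 0 < scale θ (4 ^ k) :=
  zero_lt_one.trans_le (hθ.one_le_scale (one_le_pow₀ (by norm_num)))

theorem IsParameter.coe_gridPoint (hθ : IsParameter θ) (k a : ℕ) :
    (gridPoint θ k a : ℝ) = 4 ^ k + a * (2 ^ k / scale θ (4 ^ k)) := by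
  have := hθ.scale_pow_pos k
  rw [gridPoint]
  push_cast
  rw [Real.coe_toNNReal _ (by positivity)]

/-- The properties of the positions of the atoms which make the looptree compact. -/
structure IsRegular (θ x : ℕ → ℝ≥0) : Prop where
  cell_le : ∀ᶠ k : ℕ in atTop, ∀ a ≤ 5 * 8 ^ k,
    massMeasure θ x (gridCell θ k a) ≤ ENNReal.ofReal (4 / 2 ^ k)
  mass_le : ∀ᶠ k : ℕ in atTop, massMeasure θ x (Iic (4 ^ k)) ≤ ENNReal.ofReal (8 ^ k)
  le_mass : ∃ K : ℝ, 0 < K ∧ ∀ᶠ k : ℕ in atTop,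
    ENNReal.ofReal (scale θ (4 ^ k) / (K * (k + 1))) ≤ massMeasure θ x (Iic (4 ^ k))

/-- Union bound over the cells, used once for the masses of the cells and once for the cuts hitting
them. -/
theorem summable_pow_mul_exp_neg {K : ℝ} (hK : 0 < K) :
    Summable fun k : ℕ => (5 * 8 ^ k + 1 : ℝ) * Real.exp (-(2 ^ k / (K * (k + 1)))) := by
  have h1 : Summable fun k : ℕ => ((k : ℝ)) ^ 4 * (1 / 2 : ℝ) ^ k :=
    summable_pow_mul_geometric_of_norm_lt_one 4 (by norm_num)
  have h2 := ((summable_nat_add_iff 1).2 h1).mul_left (288 * K ^ 4)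
  refine Summable.of_nonneg_of_le (fun k => by positivity) (fun k => ?_) h2
  set t : ℝ := 2 ^ k / (K * (k + 1)) with ht
  have ht0 : 0 < t := by positivity
  -- The fourth power is the first to beat `8 ^ k`: it leaves `(1 / 2) ^ k` times a polynomial.
  have h3 : Real.exp (-t) ≤ 24 / t ^ 4 := by
    have := Real.pow_div_factorial_le_exp t ht0.le 4
    rw [Real.exp_neg, ← one_div, div_le_div_iff₀ (Real.exp_pos _) (by positivity)]
    norm_num [Nat.factorial] at this
    linarith
  have h4 : (1 : ℝ) ≤ 8 ^ k := one_le_pow₀ (by norm_num)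
  calc (5 * 8 ^ k + 1 : ℝ) * Real.exp (-t) ≤ (6 * 8 ^ k) * (24 / t ^ 4) := by
        gcongr
        linarith
    _ = 144 * K ^ 4 * (k + 1) ^ 4 * (8 ^ k / (2 ^ k) ^ 4) := by
        rw [ht]
        field_simp
        ring
    _ = 288 * K ^ 4 * (((k + 1 : ℕ) : ℝ) ^ 4 * (1 / 2 : ℝ) ^ (k + 1)) := by
        have : (8 : ℝ) ^ k / (2 ^ k) ^ 4 = (1 / 2) ^ k := by
          rw [← pow_mul, mul_comm k 4, pow_mul, ← div_pow]
          norm_num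
        rw [this, pow_succ]
        push_cast
        ring

/-! ### Almost sure regularity of the atoms. -/

section Random

variable {Ω : Type*} [MeasurableSpace Ω] {P : Measure Ω} {X : Ω → ℕ → ℝ≥0}

theorem measurable_massMeasure {f : Ω → ℕ → ℝ≥0} (B : Ω → Set ℝ≥0)
    (hB : ∀ ω, MeasurableSet (B ω)) (hB' : ∀ i, MeasurableSet {ω | f ω i ∈ B ω})
    (hleb : Measurable fun ω => lebesgue (B ω)) :
    Measurable fun ω => massMeasure θ (f ω) (B ω) := by
  simp_rw [fun ω => massMeasure_apply θ (f ω) (hB ω)]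
  refine (hleb.const_mul _).add (Measurable.tsum fun i => Measurable.const_mul ?_ _)
  exact measurable_one.indicator (hB' i)

theorem measurable_massMeasure_Iic {f : Ω → ℕ → ℝ≥0} (hf : Measurable f) {t : Ω → ℝ≥0}
    (ht : Measurable t) : Measurable fun ω => massMeasure θ (f ω) (Iic (t ω)) := by
  refine measurable_massMeasure _ (fun _ => measurableSet_Iic) (fun i => ?_) ?_
  · exact measurableSet_le (by fun_prop) ht
  · simp_rw [lebesgue_Iic]
    fun_prop

theorem measurable_massMeasure_Ioc {f : Ω → ℕ → ℝ≥0} (hf : Measurable f) {s t : Ω → ℝ≥0}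
    (hs : Measurable s) (ht : Measurable t) :
    Measurable fun ω => massMeasure θ (f ω) (Ioc (s ω) (t ω)) := by
  refine measurable_massMeasure _ (fun _ => measurableSet_Ioc) (fun i => ?_) ?_
  · have h1 : MeasurableSet {ω | s ω < f ω i} := measurableSet_lt hs (by fun_prop)
    have h2 : MeasurableSet {ω | f ω i ≤ t ω} := measurableSet_le (by fun_prop) ht
    exact h1.inter h2
  · simp_rw [lebesgue_Ioc]
    fun_prop

variable [IsProbabilityMeasure P]

theorem ae_eventually_massMeasure_gridCell_le (hθ : IsParameter θ) (hX : Measurable X)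
    (hind : iIndepFun (fun i ω => X ω i) P)
    (hlaw : ∀ i, 0 < θ (i + 1) → P.map (fun ω => (X ω i : ℝ)) = expMeasure (θ (i + 1))) :
    ∀ᵐ ω ∂P, ∀ᶠ k : ℕ in atTop, ∀ a ≤ 5 * 8 ^ k,
      massMeasure θ (X ω) (gridCell θ k a) ≤ ENNReal.ofReal (4 / 2 ^ k) := by
  refine ae_eventually_of_measure_le (summable_pow_mul_exp_neg one_pos)
    (Eventually.of_forall fun k => ?_)
  have hone : ∀ a, P {ω | ENNReal.ofReal (4 / 2 ^ k) < massMeasure θ (X ω) (gridCell θ k a)} ≤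
      ENNReal.ofReal (Real.exp (-(2 ^ k / (1 * (k + 1))))) := by
    intro a
    have h1 := measure_lt_massMeasure_Ioc_le hθ hX hind hlaw (l := 4 ^ k) (s := gridPoint θ k a)
      (w := Real.toNNReal (2 ^ k / scale θ (4 ^ k))) le_self_add (4 / 2 ^ k)
    rw [← gridPoint_succ] at h1
    refine h1.trans (ENNReal.ofReal_le_ofReal (Real.exp_le_exp.2 ?_))
    have h2 := hθ.scale_pow_pos k
    push_cast
    rw [Real.coe_toNNReal _ (by positivity), div_mul_cancel₀ _ h2.ne', one_mul]
    -- The Chernoff exponent is `2 ^ k - 2 * 2 ^ k`: the cell length was chosen so that its product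
    -- with `scale` is `2 ^ k`.
    have h3 : (4 : ℝ) ^ k / 2 * (4 / 2 ^ k) = 2 * 2 ^ k := by
      rw [show (4 : ℝ) = 2 * 2 by norm_num, mul_pow]
      field_simp
    have h4 : (2 : ℝ) ^ k / (k + 1) ≤ 2 ^ k :=
      div_le_self (by positivity) (by linarith [(Nat.cast_nonneg k : (0 : ℝ) ≤ k)])
    rw [h3]
    linarith
  calc P {ω | ¬ ∀ a ≤ 5 * 8 ^ k, massMeasure θ (X ω) (gridCell θ k a) ≤ ENNReal.ofReal (4 / 2 ^ k)}
      ≤ P (⋃ a ∈ Finset.range (5 * 8 ^ k + 1),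
          {ω | ENNReal.ofReal (4 / 2 ^ k) < massMeasure θ (X ω) (gridCell θ k a)}) := by
        refine measure_mono fun ω hω => ?_
        simp only [mem_ofPred_eq, not_forall, not_le] at hω
        obtain ⟨a, ha, h⟩ := hω
        exact mem_biUnion (Finset.mem_coe.2 (Finset.mem_range.2 (Nat.lt_succ_of_le ha))) h
    _ ≤ ∑ a ∈ Finset.range (5 * 8 ^ k + 1),
          P {ω | ENNReal.ofReal (4 / 2 ^ k) < massMeasure θ (X ω) (gridCell θ k a)} :=
        measure_biUnion_finset_le _ _
    _ ≤ ∑ a ∈ Finset.range (5 * 8 ^ k + 1),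
          ENNReal.ofReal (Real.exp (-(2 ^ k / (1 * (k + 1))))) :=
        Finset.sum_le_sum fun a _ => hone a
    _ = _ := by
        rw [Finset.sum_const, Finset.card_range, nsmul_eq_mul, ENNReal.ofReal_mul (by positivity)]
        congr 1
        rw [← ENNReal.ofReal_natCast]
        push_cast
        rfl

/-- Markov's inequality with mean at most `4 ^ k` gives the summable probability `(1 / 2) ^ k`. -/
theorem ae_eventually_massMeasure_Iic_le (hθ : IsParameter θ) (hX : Measurable X)
    (hlaw : ∀ i, 0 < θ (i + 1) → P.map (fun ω => (X ω i : ℝ)) = expMeasure (θ (i + 1))) :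
    ∀ᵐ ω ∂P, ∀ᶠ k : ℕ in atTop,
      massMeasure θ (X ω) (Iic (4 ^ k)) ≤ ENNReal.ofReal (8 ^ k) := by
  refine ae_eventually_of_measure_le summable_geometric_two (Eventually.of_forall fun k => ?_)
  have h8 : ENNReal.ofReal (8 ^ k) ≠ 0 := by simp
  calc P {ω | ¬ massMeasure θ (X ω) (Iic (4 ^ k)) ≤ ENNReal.ofReal (8 ^ k)}
      ≤ P {ω | ENNReal.ofReal (8 ^ k) ≤ massMeasure θ (X ω) (Iic (4 ^ k))} :=
        measure_mono fun ω hω => (not_le.1 hω).le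
    _ ≤ (∫⁻ ω, massMeasure θ (X ω) (Iic (4 ^ k)) ∂P) / ENNReal.ofReal (8 ^ k) :=
        meas_ge_le_lintegral_div
          (measurable_massMeasure_Iic hX measurable_const).aemeasurable h8 ENNReal.ofReal_ne_top
    _ ≤ ((4 ^ k : ℝ≥0) : ℝ≥0∞) / ENNReal.ofReal (8 ^ k) :=
        ENNReal.div_le_div_right (lintegral_massMeasure_Iic_le hθ hX hlaw _) _
    _ = ENNReal.ofReal ((1 / 2) ^ k) := by
        rw [← ENNReal.ofReal_coe_nnreal, ← ENNReal.ofReal_div_of_pos (by positivity)]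
        push_cast
        rw [← div_pow]
        norm_num

theorem ae_exists_eventually_scale_le (hθ : IsParameter θ) (hX : Measurable X)
    (hind : iIndepFun (fun i ω => X ω i) P)
    (hlaw : ∀ i, 0 < θ (i + 1) → P.map (fun ω => (X ω i : ℝ)) = expMeasure (θ (i + 1))) :
    ∀ᵐ ω ∂P, ∃ K : ℝ, 0 < K ∧ ∀ᶠ k : ℕ in atTop,
      ENNReal.ofReal (scale θ (4 ^ k) / (K * (k + 1))) ≤ massMeasure θ (X ω) (Iic (4 ^ k)) := by
  have h1 : ∀ᵐ ω ∂P, ∀ᶠ k : ℕ in atTop,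
      ENNReal.ofReal (scale θ (4 ^ k) / 4 - k) ≤ massMeasure θ (X ω) (Iic (4 ^ k)) := by
    refine ae_eventually_of_measure_le Real.summable_exp_neg_nat
      (Eventually.of_forall fun k => ?_)
    have := measure_massMeasure_Iic_lt_le hθ hX hind hlaw (4 ^ k) k
    push_cast at this
    simpa only [not_le] using this
  filter_upwards [h1] with ω hω
  obtain ⟨l, hl⟩ := exists_massMeasure_pos hθ (X ω)
  obtain ⟨c, hc0, hc, hcl⟩ := ENNReal.lt_iff_exists_real_btwn.1 hl
  have hc0' : 0 < c := ENNReal.ofReal_pos.1 hc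
  refine ⟨4 + 4 / c, by positivity, ?_⟩
  have hpow : Tendsto (fun k : ℕ => (4 : ℝ≥0) ^ k) atTop atTop :=
    tendsto_pow_atTop_atTop_of_one_lt (by norm_num)
  filter_upwards [hω, hpow.eventually_ge_atTop l] with k hk hkl
  have hc2 : ENNReal.ofReal c ≤ massMeasure θ (X ω) (Iic (4 ^ k)) :=
    hcl.le.trans (measure_mono (Iic_subset_Iic.2 hkl))
  by_cases htop : massMeasure θ (X ω) (Iic (4 ^ k)) = ∞
  · rw [htop]
    exact le_top
  rw [ENNReal.ofReal_le_iff_le_toReal htop] at hk hc2 ⊢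
  set m := (massMeasure θ (X ω) (Iic (4 ^ k))).toReal
  rw [div_le_iff₀ (by positivity)]
  have hm : 0 ≤ m := ENNReal.toReal_nonneg
  -- The lower tail bound loses `k`, which may exceed `scale / 4`. Since the mass is eventually at
  -- least `c`, this loss is absorbed by a factor of order `k`.
  have h2 : 4 * (k : ℝ) ≤ m * (4 / c * k) := by
    calc 4 * (k : ℝ) = c * (4 / c * k) := by field_simp
      _ ≤ m * (4 / c * k) := by gcongr
  have h3 : m * ((4 + 4 / c) * (k + 1)) =
      4 * m + m * (4 / c * k) + (m * (4 * k) + m * (4 / c)) := by ring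
  have h4 : 0 ≤ m * (4 * k) + m * (4 / c) := by positivity
  linarith

theorem ae_isRegular (hθ : IsParameter θ) (hX : Measurable X)
    (hind : iIndepFun (fun i ω => X ω i) P)
    (hlaw : ∀ i, 0 < θ (i + 1) → P.map (fun ω => (X ω i : ℝ)) = expMeasure (θ (i + 1))) :
    ∀ᵐ ω ∂P, IsRegular θ (X ω) := by
  filter_upwards [ae_eventually_massMeasure_gridCell_le hθ hX hind hlaw,
    ae_eventually_massMeasure_Iic_le hθ hX hlaw,
    ae_exists_eventually_scale_le hθ hX hind hlaw] with ω h1 h2 h3 using ⟨h1, h2, h3⟩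

end Random

/-! ### The cuts -/

/-- Markov's inequality; the mean is computed by shifting the index in the Poisson weights. -/
theorem poissonMeasure_Ioi_le (r : ℝ≥0) (n : ℕ) :
    poissonMeasure r (Ioi n) ≤ ENNReal.ofReal (r / (n + 1)) := by
  have hmean : ∫⁻ m, (m : ℝ≥0∞) ∂(poissonMeasure r) ≤ r := by
    rw [lintegral_countable', tsum_eq_zero_add' ENNReal.summable]
    have : ∀ m : ℕ, ((m + 1 : ℕ) : ℝ≥0∞) * poissonMeasure r {m + 1} =
        r * poissonMeasure r {m} := by
      intro m
      rw [poissonMeasure_singleton, poissonMeasure_singleton, ← ENNReal.ofReal_natCast,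
        ← ENNReal.ofReal_coe_nnreal, ← ENNReal.ofReal_mul (by positivity),
        ← ENNReal.ofReal_mul (by positivity), Nat.factorial_succ]
      congr 1
      push_cast
      field_simp
      ring
    simp_rw [this]
    rw [ENNReal.tsum_mul_left]
    have h1 : ∑' m, poissonMeasure r {m} = 1 := by
      have := lintegral_countable' (μ := poissonMeasure r) (fun _ : ℕ => (1 : ℝ≥0∞))
      simpa using this.symm
    simp [h1]
  have hset : (Ioi n : Set ℕ) = {m : ℕ | ((n + 1 : ℕ) : ℝ≥0∞) ≤ (m : ℝ≥0∞)} := by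
    ext m
    simp only [mem_Ioi, mem_ofPred_eq, Nat.cast_le]
    exact Iff.rfl
  rw [hset]
  refine (meas_ge_le_lintegral_div (measurable_of_countable _).aemeasurable (by simp)
    (ENNReal.natCast_ne_top _)).trans ?_
  rw [ENNReal.ofReal_div_of_pos (by positivity), ENNReal.ofReal_coe_nnreal]
  refine ENNReal.div_le_div hmean (le_of_eq ?_)
  rw [← ENNReal.ofReal_natCast]
  push_cast
  rfl

/-! ### Void probabilities and counts of a Poisson process. -/

section Poisson

variable {ν : Measure ℝ≥0} {Q : Measure (ℕ → ℝ≥0)}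

theorem IsPoissonLaw.measure_encard_eq (hQ : IsPoissonLaw ν Q) {B : Set ℝ≥0}
    (hB : MeasurableSet B) (hν : ν B ≠ ∞) (k : ℕ) :
    Q {y | {i | y i ∈ B}.encard = k} = poissonMeasure (ν B).toNNReal {k} := by
  have := hQ.count 1 (fun _ => B) (fun _ => hB)
    (fun i j hij => absurd (Subsingleton.elim i j) hij) (fun _ => hν) fun _ => k
  simpa using this

theorem IsPoissonLaw.measure_forall_notMem (hQ : IsPoissonLaw ν Q) {B : Set ℝ≥0}
    (hB : MeasurableSet B) (hν : ν B ≠ ∞) :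
    Q {y | ∀ i, y i ∉ B} = ENNReal.ofReal (Real.exp (-(ν B).toReal)) := by
  have := hQ.measure_encard_eq hB hν 0
  rw [poissonMeasure_singleton] at this
  simp only [Nat.cast_zero, Set.encard_eq_zero, eq_empty_iff_forall_notMem, mem_ofPred_eq, pow_zero,
    mul_one, Nat.factorial_zero, Nat.cast_one, div_one] at this
  rw [this]
  rfl

theorem IsPoissonLaw.ae_notMem [IsProbabilityMeasure Q] (hQ : IsPoissonLaw ν Q) {B : Set ℝ≥0}
    (hB : MeasurableSet B) (hν : ν B = 0) : ∀ᵐ y ∂Q, ∀ i, y i ∉ B := by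
  have h1 := hQ.measure_forall_notMem hB (by simp [hν])
  rw [hν] at h1
  have hm : MeasurableSet {y : ℕ → ℝ≥0 | ∀ i, y i ∉ B} := by
    simp only [ofPred_forall]
    refine MeasurableSet.iInter fun i => ?_
    have : Measurable fun y : ℕ → ℝ≥0 => y i := measurable_pi_apply i
    exact this hB.compl
  rw [ae_iff, ← compl_ofPred, prob_compl_eq_zero_iff hm, h1]
  simp

/-- As `y` is increasing, `y n ≤ b` forces more than `n` points in `[0, b]`. The proof bounds the
complement from below. -/
theorem IsPoissonLaw.measure_le [IsProbabilityMeasure Q] (hQ : IsPoissonLaw ν Q) {b : ℝ≥0}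
    (hν : ν (Iic b) ≠ ∞) (n : ℕ) :
    Q {y | y n ≤ b} ≤ poissonMeasure (ν (Iic b)).toNNReal (Ioi n) := by
  have hmeas : MeasurableSet {y : ℕ → ℝ≥0 | b < y n} :=
    measurableSet_lt measurable_const (measurable_pi_apply n)
  have hcompl : {y : ℕ → ℝ≥0 | y n ≤ b} = {y | b < y n}ᶜ := by
    ext y
    simp
  rw [hcompl, prob_compl_eq_one_sub hmeas, ← compl_Iic, prob_compl_eq_one_sub measurableSet_Iic]
  refine tsub_le_tsub_left ?_ _
  -- `E m` expresses, for increasing `y`, that exactly `m` points lie in `[0, b]`; unlike the event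
  -- about `encard`, it is visibly measurable.
  set E : ℕ → Set (ℕ → ℝ≥0) := fun m => {y | (∀ i < m, y i ≤ b) ∧ b < y m} with hE
  have hEm : ∀ m, MeasurableSet (E m) := by
    intro m
    have h1 : MeasurableSet {y : ℕ → ℝ≥0 | ∀ i < m, y i ≤ b} := by
      simp only [ofPred_forall]
      exact MeasurableSet.iInter fun i => MeasurableSet.iInter fun _ =>
        measurableSet_le (measurable_pi_apply i) measurable_const
    have h2 : MeasurableSet {y : ℕ → ℝ≥0 | b < y m} :=
      measurableSet_lt measurable_const (measurable_pi_apply m)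
    exact h1.inter h2
  have hdisj : ∀ m m', m < m' → Disjoint (E m) (E m') := by
    intro m m' h
    rw [Set.disjoint_left]
    intro y hy hy'
    exact (hy'.1 m h).not_gt hy.2
  have hle : ∀ m : ℕ, poissonMeasure (ν (Iic b)).toNNReal {m} ≤ Q (E m) := by
    intro m
    rw [← hQ.measure_encard_eq measurableSet_Iic hν m]
    refine measure_mono_ae ?_
    filter_upwards [hQ.strictMono] with y hy hcard
    have hcard : {i | y i ∈ Iic b}.encard = m := hcard
    refine ⟨fun i hi => ?_, ?_⟩
    · by_contra hlt
      have hsub : {i | y i ∈ Iic b} ⊆ Iio i := fun j hj =>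
        hy.lt_iff_lt.1 (lt_of_le_of_lt hj (not_le.1 hlt))
      have h1 := encard_le_encard hsub
      rw [hcard, ← Finset.coe_Iio, encard_coe_eq_coe_finsetCard, Nat.card_Iio, Nat.cast_le] at h1
      omega
    · by_contra hlt
      have hsub : Iic m ⊆ {i | y i ∈ Iic b} := fun j hj =>
        (hy.monotone hj).trans (not_lt.1 hlt)
      have h1 := encard_le_encard hsub
      rw [hcard, ← Finset.coe_Iic, encard_coe_eq_coe_finsetCard, Nat.card_Iic, Nat.cast_le] at h1
      omega
  calc poissonMeasure (ν (Iic b)).toNNReal (Iic n)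
      = ∑ m ∈ Finset.Iic n, poissonMeasure (ν (Iic b)).toNNReal {m} := by
        rw [sum_measure_singleton, Finset.coe_Iic]
    _ ≤ ∑ m ∈ Finset.Iic n, Q (E m) := Finset.sum_le_sum fun m _ => hle m
    _ = Q (⋃ m ∈ Finset.Iic n, E m) := by
        refine (measure_biUnion_finset (fun m _ m' _ hmm => ?_) fun m _ => hEm m).symm
        rcases lt_or_gt_of_ne hmm with h | h
        · exact hdisj m m' h
        · exact (hdisj m' m h).symm
    _ ≤ Q {y | b < y n} := by
        refine measure_mono_ae ?_
        filter_upwards [hQ.strictMono] with y hy hmem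
        obtain ⟨m, hm, hym⟩ := mem_iUnion₂.1 hmem
        exact lt_of_lt_of_le hym.2 (hy.monotone (Finset.mem_Iic.1 hm))

end Poisson

variable {x : ℕ → ℝ≥0}

/-- The intensity measure of the cuts. -/
def cutRate (θ x : ℕ → ℝ≥0) : Measure ℝ≥0 :=
  lebesgue.withDensity fun l => massMeasure θ x (Iic l)

theorem cutRate_Iic_le (θ x : ℕ → ℝ≥0) (b : ℝ≥0) :
    cutRate θ x (Iic b) ≤ massMeasure θ x (Iic b) * ENNReal.ofReal b := by
  rw [cutRate, withDensity_apply _ measurableSet_Iic, ← lebesgue_Iic, ← setLIntegral_const]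
  exact setLIntegral_mono' measurableSet_Iic fun l hl => measure_mono (Iic_subset_Iic.2 hl)

theorem le_cutRate_Ioc (θ x : ℕ → ℝ≥0) (c s t : ℝ≥0) (hcs : c ≤ s) :
    massMeasure θ x (Iic c) * ENNReal.ofReal (t - s) ≤ cutRate θ x (Ioc s t) := by
  rw [cutRate, withDensity_apply _ measurableSet_Ioc, ← lebesgue_Ioc, ← setLIntegral_const]
  exact setLIntegral_mono' measurableSet_Ioc fun l hl =>
    measure_mono (Iic_subset_Iic.2 (hcs.trans hl.1.le))

/-- The intensity is diffuse, so the cuts almost surely avoid `0` and the countably many atoms. -/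
theorem cutRate_singleton (θ x : ℕ → ℝ≥0) (t : ℝ≥0) : cutRate θ x {t} = 0 := by
  refine withDensity_absolutelyContinuous _ _ ?_
  have he : MeasurableEmbedding ((↑) : ℝ≥0 → ℝ) :=
    MeasurableEmbedding.subtype_coe measurableSet_Ici
  rw [lebesgue, he.comap_apply, image_singleton]
  exact measure_singleton _

theorem IsRegular.massMeasure_Iic_ne_top (hx : IsRegular θ x) (b : ℝ≥0) :
    massMeasure θ x (Iic b) ≠ ∞ := by
  have hpow : Tendsto (fun k : ℕ => (4 : ℝ≥0) ^ k) atTop atTop :=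
    tendsto_pow_atTop_atTop_of_one_lt (by norm_num)
  obtain ⟨k, hk, hbk⟩ := (hx.mass_le.and (hpow.eventually_ge_atTop b)).exists
  exact ne_top_of_le_ne_top ENNReal.ofReal_ne_top
    ((measure_mono (Iic_subset_Iic.2 hbk)).trans hk)

theorem IsRegular.cutRate_Iic_ne_top (hx : IsRegular θ x) (b : ℝ≥0) :
    cutRate θ x (Iic b) ≠ ∞ :=
  ne_top_of_le_ne_top (ENNReal.mul_ne_top (hx.massMeasure_Iic_ne_top b) ENNReal.ofReal_ne_top)
    (cutRate_Iic_le θ x b)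

theorem IsRegular.ae_eventually_exists_mem_gridCell (hθ : IsParameter θ) (hx : IsRegular θ x)
    {Q : Measure (ℕ → ℝ≥0)} (hQ : IsPoissonLaw (cutRate θ x) Q) :
    ∀ᵐ y ∂Q, ∀ᶠ k : ℕ in atTop, ∀ a ≤ 5 * 8 ^ k, ∃ i, y i ∈ gridCell θ k a := by
  obtain ⟨K, hK, hKk⟩ := hx.le_mass
  refine ae_eventually_of_measure_le (summable_pow_mul_exp_neg hK) ?_
  filter_upwards [hKk] with k hk
  have hone : ∀ a, Q {y | ∀ i, y i ∉ gridCell θ k a} ≤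
      ENNReal.ofReal (Real.exp (-(2 ^ k / (K * (k + 1))))) := by
    intro a
    have hfin : cutRate θ x (gridCell θ k a) ≠ ∞ :=
      ne_top_of_le_ne_top (hx.cutRate_Iic_ne_top (gridPoint θ k (a + 1)))
        (measure_mono fun t ht => ht.2)
    rw [hQ.measure_forall_notMem (B := gridCell θ k a) measurableSet_Ioc hfin]
    refine ENNReal.ofReal_le_ofReal (Real.exp_le_exp.2 (neg_le_neg ?_))
    rw [← ENNReal.ofReal_le_iff_le_toReal hfin]
    have h1 := le_cutRate_Ioc θ x (4 ^ k) (gridPoint θ k a) (gridPoint θ k (a + 1)) le_self_add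
    refine le_trans ?_ h1
    have h2 := hθ.scale_pow_pos k
    have h3 : (gridPoint θ k (a + 1) : ℝ) - gridPoint θ k a = 2 ^ k / scale θ (4 ^ k) := by
      rw [hθ.coe_gridPoint, hθ.coe_gridPoint]
      push_cast
      ring
    -- The mass bound times the cell length: `scale` cancels.
    have h4 : (2 : ℝ) ^ k / (K * (k + 1)) =
        scale θ (4 ^ k) / (K * (k + 1)) * (2 ^ k / scale θ (4 ^ k)) := by
      field_simp
    rw [h3, h4, ENNReal.ofReal_mul (by positivity)]
    exact mul_le_mul_left hk _
  calc Q {y | ¬ ∀ a ≤ 5 * 8 ^ k, ∃ i, y i ∈ gridCell θ k a}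
      ≤ Q (⋃ a ∈ Finset.range (5 * 8 ^ k + 1), {y | ∀ i, y i ∉ gridCell θ k a}) := by
        refine measure_mono fun ω hω => ?_
        simp only [mem_ofPred_eq, not_forall, not_exists] at hω
        obtain ⟨a, ha, h⟩ := hω
        exact mem_biUnion (Finset.mem_coe.2 (Finset.mem_range.2 (Nat.lt_succ_of_le ha))) h
    _ ≤ ∑ a ∈ Finset.range (5 * 8 ^ k + 1), Q {y | ∀ i, y i ∉ gridCell θ k a} :=
        measure_biUnion_finset_le _ _
    _ ≤ ∑ a ∈ Finset.range (5 * 8 ^ k + 1),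
          ENNReal.ofReal (Real.exp (-(2 ^ k / (K * (k + 1))))) :=
        Finset.sum_le_sum fun a _ => hone a
    _ = _ := by
        rw [Finset.sum_const, Finset.card_range, nsmul_eq_mul, ENNReal.ofReal_mul (by positivity)]
        congr 1
        rw [← ENNReal.ofReal_natCast]
        push_cast
        rfl

/-- The mean number of cuts before `4 ^ k` is at most `8 ^ k * 4 ^ k = 32 ^ k`, so having `64 ^ k`
of them has probability at most `(1 / 2) ^ k`. -/
theorem IsRegular.ae_eventually_lt_withZero (hx : IsRegular θ x) {Q : Measure (ℕ → ℝ≥0)}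
    [IsProbabilityMeasure Q] (hQ : IsPoissonLaw (cutRate θ x) Q) :
    ∀ᵐ y ∂Q, ∀ᶠ k : ℕ in atTop, 4 ^ k < withZero y (64 ^ k) := by
  refine ae_eventually_of_measure_le summable_geometric_two ?_
  filter_upwards [hx.mass_le] with k hk
  obtain ⟨n, hn⟩ : ∃ n, 64 ^ k = n + 1 := Nat.exists_eq_succ_of_ne_zero (by positivity)
  have hn' : (n : ℝ) + 1 = 64 ^ k := by exact_mod_cast hn.symm
  rw [hn]
  simp only [withZero, not_lt]
  have hfin := hx.cutRate_Iic_ne_top (4 ^ k)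
  refine (hQ.measure_le hfin n).trans ((poissonMeasure_Ioi_le _ _).trans
    (ENNReal.ofReal_le_ofReal ?_))
  have h1 : ((cutRate θ x (Iic (4 ^ k))).toNNReal : ℝ) ≤ 8 ^ k * 4 ^ k := by
    refine ENNReal.toReal_le_of_le_ofReal (by positivity) ((cutRate_Iic_le θ x _).trans ?_)
    rw [ENNReal.ofReal_mul (by positivity)]
    push_cast
    exact mul_le_mul_left hk _
  rw [hn', div_le_iff₀ (by positivity), ← mul_pow]
  refine h1.trans (le_of_eq ?_)
  rw [← mul_pow]
  norm_num

/-- Deterministic bound for the masses of the branches. -/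
theorem IsRegular.eventually_massMeasure_branch_le (hθ : IsParameter θ) (hx : IsRegular θ x)
    {y : ℕ → ℝ≥0} (hy : StrictMono y)
    (hhit : ∀ᶠ k : ℕ in atTop, ∀ a ≤ 5 * 8 ^ k, ∃ i, y i ∈ gridCell θ k a)
    (hbig : ∀ᶠ k : ℕ in atTop, 4 ^ k < withZero y (64 ^ k)) :
    ∀ᶠ k : ℕ in atTop, ∀ j ≥ 64 ^ k,
      (massMeasure θ x (Ioc (withZero y j) (withZero y (j + 1)))).toReal ≤ 8 / 2 ^ k := by
  obtain ⟨k₀, hk₀⟩ := eventually_atTop.1 ((hx.cell_le.and hhit).and hbig)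
  refine eventually_atTop.2 ⟨k₀, fun k hk j hj => ?_⟩
  obtain ⟨n, rfl⟩ : ∃ n, j = n + 1 :=
    Nat.exists_eq_succ_of_ne_zero ((by positivity : 0 < 64 ^ k).trans_le hj).ne'
  change (massMeasure θ x (Ioc (y n) (y (n + 1)))).toReal ≤ 8 / 2 ^ k
  have hyn : 4 ^ k < y n := by
    obtain ⟨m, hm⟩ : ∃ m, 64 ^ k = m + 1 := Nat.exists_eq_succ_of_ne_zero (by positivity)
    have h1 := (hk₀ k hk).2
    rw [hm] at h1 hj
    exact h1.trans_le (hy.monotone (Nat.le_of_succ_le_succ hj))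
  -- The branch is treated at the scale `l` of its starting point, which may be much larger than
  -- `k`.
  obtain ⟨l, hkl, hl1, hl2⟩ : ∃ l, k ≤ l ∧ 4 ^ l < y n ∧ y n ≤ 4 ^ (l + 1) := by
    have hpow : Tendsto (fun k : ℕ => (4 : ℝ≥0) ^ k) atTop atTop :=
      tendsto_pow_atTop_atTop_of_one_lt (by norm_num)
    have hex : ∃ l, y n ≤ 4 ^ l := (hpow.eventually_ge_atTop (y n)).exists
    classical
    have h1 := Nat.find_spec hex
    have h2 : k < Nat.find hex := by
      by_contra hcon
      exact (h1.trans (pow_le_pow_right₀ (by norm_num) (not_lt.1 hcon))).not_gt hyn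
    refine ⟨Nat.find hex - 1, by omega, not_le.1 (Nat.find_min hex (by omega)), ?_⟩
    rwa [Nat.sub_add_cancel (by omega)]
  have hψ := hθ.scale_pow_pos l
  have hψl := hθ.scale_le (l := 4 ^ l) (by positivity)
  obtain ⟨a, ha1, ha2⟩ : ∃ a, gridPoint θ l a < y n ∧ y n ≤ gridPoint θ l (a + 1) := by
    have hex : ∃ a, y n ≤ gridPoint θ l a := by
      obtain ⟨a, ha⟩ := exists_nat_ge ((y n : ℝ) / (2 ^ l / scale θ (4 ^ l)))
      refine ⟨a, ?_⟩
      rw [← NNReal.coe_le_coe, hθ.coe_gridPoint]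
      rw [div_le_iff₀ (by positivity)] at ha
      linarith [(by positivity : (0 : ℝ) < 4 ^ l)]
    classical
    have h1 := Nat.find_spec hex
    have h2 : 0 < Nat.find hex := by
      by_contra hcon
      rw [Nat.eq_zero_of_not_pos hcon] at h1
      refine h1.not_gt ?_
      simpa [gridPoint] using hl1
    refine ⟨Nat.find hex - 1, not_le.1 (Nat.find_min hex (by omega)), ?_⟩
    rwa [Nat.sub_add_cancel h2]
  -- As `scale θ (4 ^ l) ≤ 4 ^ l`, cells have length at least `2 ^ l / 4 ^ l`, and an interval of
  -- length `3 * 4 ^ l` has to be covered. The range `5 * 8 ^ l` leaves room for the cell `a + 1`.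
  have ha3 : a ≤ 3 * 8 ^ l := by
    have h1 : (gridPoint θ l a : ℝ) < 4 ^ (l + 1) := by exact_mod_cast ha1.trans_le hl2
    rw [hθ.coe_gridPoint, pow_succ] at h1
    have h2 : a * (2 ^ l / scale θ (4 ^ l)) < 3 * 4 ^ l := by linarith
    rw [mul_div_assoc', div_lt_iff₀ hψ] at h2
    have h3 : (a : ℝ) * 2 ^ l < 3 * 8 ^ l * 2 ^ l := by
      calc (a : ℝ) * 2 ^ l < 3 * 4 ^ l * scale θ (4 ^ l) := h2
        _ ≤ 3 * 4 ^ l * 4 ^ l := by gcongr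
        _ = 3 * 8 ^ l * 2 ^ l := by
          rw [mul_assoc, mul_assoc, ← mul_pow, ← mul_pow]
          norm_num
    have h4 := lt_of_mul_lt_mul_right h3 (by positivity)
    exact_mod_cast h4.le
  have h8 : 1 ≤ 8 ^ l := Nat.one_le_pow _ _ (by norm_num)
  obtain ⟨⟨hcell, hhit'⟩, -⟩ := hk₀ l (hk.trans hkl)
  -- There is a cut in the cell following that of `y n`, so the branch ends there at the latest and
  -- meets only these two cells.
  obtain ⟨i, hi⟩ := hhit' (a + 1) (by omega)
  have hni : n < i := hy.lt_iff_lt.1 (ha2.trans_lt hi.1)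
  have hsub : Ioc (y n) (y (n + 1)) ⊆ gridCell θ l a ∪ gridCell θ l (a + 1) := by
    intro t ht
    rcases le_or_gt t (gridPoint θ l (a + 1)) with h | h
    · exact Or.inl ⟨ha1.trans ht.1, h⟩
    · exact Or.inr ⟨h, ht.2.trans ((hy.monotone hni).trans hi.2)⟩
  have hmass : massMeasure θ x (Ioc (y n) (y (n + 1))) ≤ ENNReal.ofReal (8 / 2 ^ l) := by
    calc massMeasure θ x (Ioc (y n) (y (n + 1)))
        ≤ massMeasure θ x (gridCell θ l a) + massMeasure θ x (gridCell θ l (a + 1)) :=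
          (measure_mono hsub).trans (measure_union_le _ _)
      _ ≤ ENNReal.ofReal (4 / 2 ^ l) + ENNReal.ofReal (4 / 2 ^ l) :=
          add_le_add (hcell a (by omega)) (hcell (a + 1) (by omega))
      _ = ENNReal.ofReal (8 / 2 ^ l) := by
          rw [← ENNReal.ofReal_add (by positivity) (by positivity)]
          congr 1
          ring
  refine (ENNReal.toReal_le_of_le_ofReal (by positivity) hmass).trans ?_
  gcongr
  norm_num

end Cuts

/-! ### Transfer from conditional laws to almost sure properties. -/

section Conditioning

variable {Ω : Type*} [MeasurableSpace Ω] {P : Measure Ω} [IsProbabilityMeasure P]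

/-- A property which holds almost surely under almost every conditional law holds almost surely. -/
theorem ae_of_ae_condDistrib {α β : Type*} [MeasurableSpace α] [MeasurableSpace β]
    [StandardBorelSpace β] [Nonempty β] {A : Ω → α} {B : Ω → β} (hA : Measurable A)
    (hB : Measurable B) {p : α × β → Prop} (hp : MeasurableSet {q | p q})
    (h : ∀ᵐ ω ∂P, ∀ᵐ b ∂(condDistrib B A P (A ω)), p (A ω, b)) : ∀ᵐ ω ∂P, p (A ω, B ω) := by
  have hm : MeasurableSet {a | ∀ᵐ b ∂(condDistrib B A P a), p (a, b)} := by
    have := Kernel.measurable_kernel_prodMk_left (κ := condDistrib B A P) hp.compl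
    exact this (measurableSet_singleton 0)
  rw [← ae_map_iff hA.aemeasurable hm, ← Measure.ae_compProd_iff hp,
    compProd_map_condDistrib hB.aemeasurable, ae_map_iff (hA.prodMk hB).aemeasurable hp] at h
  exact h

theorem measurableSet_eventually_nat {α : Type*} [MeasurableSpace α] {p : ℕ → α → Prop}
    (hp : ∀ k, MeasurableSet {a | p k a}) : MeasurableSet {a | ∀ᶠ k in atTop, p k a} := by
  simp only [eventually_atTop, ofPred_exists, ofPred_forall]
  exact MeasurableSet.iUnion fun k => MeasurableSet.iInter fun l => MeasurableSet.iInter fun _ =>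
    hp l

/-- The properties of the cuts which make the looptree compact. -/
structure IsRegularCut (θ x y : ℕ → ℝ≥0) : Prop where
  lt_succ : ∀ n, y n < y (n + 1)
  pos : 0 < y 0
  ne_atom : ∀ i k, y i ≠ x k
  hit : ∀ᶠ k : ℕ in atTop, ∀ a ≤ 5 * 8 ^ k, ∃ i, y i ∈ gridCell θ k a
  big : ∀ᶠ k : ℕ in atTop, 4 ^ k < withZero y (64 ^ k)

/-- Transfer through conditional laws requires measurability, which is why the cuts are described by
countably many conditions on coordinates. -/
theorem measurableSet_isRegularCut (θ : ℕ → ℝ≥0) :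
    MeasurableSet {q : (ℕ → ℝ≥0) × (ℕ → ℝ≥0) | IsRegularCut θ q.1 q.2} := by
  have hy : ∀ i, Measurable fun q : (ℕ → ℝ≥0) × (ℕ → ℝ≥0) => q.2 i := fun i => by fun_prop
  have hx : ∀ i, Measurable fun q : (ℕ → ℝ≥0) × (ℕ → ℝ≥0) => q.1 i := fun i => by fun_prop
  have h1 : MeasurableSet {q : (ℕ → ℝ≥0) × (ℕ → ℝ≥0) | ∀ n, q.2 n < q.2 (n + 1)} := by
    simp only [ofPred_forall]
    exact MeasurableSet.iInter fun n => measurableSet_lt (hy n) (hy (n + 1))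
  have h2 : MeasurableSet {q : (ℕ → ℝ≥0) × (ℕ → ℝ≥0) | 0 < q.2 0} :=
    measurableSet_lt measurable_const (hy 0)
  have h3 : MeasurableSet {q : (ℕ → ℝ≥0) × (ℕ → ℝ≥0) | ∀ i k, q.2 i ≠ q.1 k} := by
    simp only [ofPred_forall]
    exact MeasurableSet.iInter fun i => MeasurableSet.iInter fun k =>
      (measurableSet_eq_fun (hy i) (hx k)).compl
  have h4 : MeasurableSet {q : (ℕ → ℝ≥0) × (ℕ → ℝ≥0) |
      ∀ᶠ k : ℕ in atTop, ∀ a ≤ 5 * 8 ^ k, ∃ i, q.2 i ∈ gridCell θ k a} := by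
    refine measurableSet_eventually_nat fun k => ?_
    simp only [ofPred_forall, ofPred_exists]
    exact MeasurableSet.iInter fun a => MeasurableSet.iInter fun _ => MeasurableSet.iUnion fun i =>
      hy i measurableSet_Ioc
  have h5 : MeasurableSet {q : (ℕ → ℝ≥0) × (ℕ → ℝ≥0) |
      ∀ᶠ k : ℕ in atTop, 4 ^ k < withZero q.2 (64 ^ k)} :=
    measurableSet_eventually_nat fun k =>
      measurableSet_lt measurable_const (measurable_withZero measurable_snd _)
  convert h1.inter (h2.inter (h3.inter (h4.inter h5))) using 1
  ext q
  exact ⟨fun h => ⟨h.1, h.2, h.3, h.4, h.5⟩, fun h => ⟨h.1, h.2.1, h.2.2.1, h.2.2.2.1, h.2.2.2.2⟩⟩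

theorem IsRegular.ae_isRegularCut {θ x : ℕ → ℝ≥0} (hθ : IsParameter θ) (hx : IsRegular θ x)
    {Q : Measure (ℕ → ℝ≥0)} [IsProbabilityMeasure Q] (hQ : IsPoissonLaw (cutRate θ x) Q) :
    ∀ᵐ y ∂Q, IsRegularCut θ x y := by
  have h1 : ∀ᵐ y ∂Q, ∀ k i, y i ∉ ({x k} : Set ℝ≥0) :=
    ae_all_iff.2 fun k => hQ.ae_notMem (measurableSet_singleton _) (cutRate_singleton θ x _)
  filter_upwards [hQ.strictMono, h1,
    hQ.ae_notMem (measurableSet_singleton 0) (cutRate_singleton θ x 0),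
    hx.ae_eventually_exists_mem_gridCell hθ hQ, hx.ae_eventually_lt_withZero hQ]
    with y hy h1 h2 h3 h4
  exact ⟨fun n => hy (Nat.lt_succ_self n), pos_iff_ne_zero.2 (h2 0), fun i k => h1 k i, h3, h4⟩

theorem IsRegularCut.strictMono {θ x y : ℕ → ℝ≥0} (hy : IsRegularCut θ x y) : StrictMono y :=
  strictMono_nat_of_lt_succ hy.lt_succ

theorem IsRegularCut.monotone_withZero {θ x y : ℕ → ℝ≥0} (hy : IsRegularCut θ x y) :
    Monotone (withZero y) := by
  refine monotone_nat_of_le_succ ?_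
  rintro (_ | n)
  · exact zero_le
  · exact (hy.lt_succ n).le

theorem IsRegularCut.tendsto {θ x y : ℕ → ℝ≥0} (hy : IsRegularCut θ x y) :
    Tendsto y atTop atTop := by
  refine tendsto_atTop_atTop_of_monotone hy.strictMono.monotone fun b => ?_
  have hpow : Tendsto (fun k : ℕ => (4 : ℝ≥0) ^ k) atTop atTop :=
    tendsto_pow_atTop_atTop_of_one_lt (by norm_num)
  obtain ⟨k, hk, hbk⟩ := (hy.big.and (hpow.eventually_ge_atTop b)).exists
  exact ⟨64 ^ k, hbk.trans (hk.le.trans (hy.monotone_withZero (Nat.le_succ _)))⟩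

/-- The mass of the `j`-th branch. -/
def branchMass (θ x y : ℕ → ℝ≥0) (j : ℕ) : ℝ :=
  (massMeasure θ x (Ioc (withZero y j) (withZero y (j + 1)))).toReal

/-- The properties of the glue points which make the looptree compact. -/
structure IsRegularGlue (θ x y z : ℕ → ℝ≥0) : Prop where
  le : ∀ i, z i ≤ y i
  height_le : ∀ᶠ k : ℕ in atTop, ∀ j, 64 ^ k ≤ j → j < 64 ^ (k + 1) →
    height y z (branchMass θ x y) (64 ^ k) j ≤ 160 * k / 2 ^ k

theorem measurableSet_isRegularGlue (θ : ℕ → ℝ≥0) :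
    MeasurableSet {q : ((ℕ → ℝ≥0) × (ℕ → ℝ≥0)) × (ℕ → ℝ≥0) |
      IsRegularGlue θ q.1.1 q.1.2 q.2} := by
  have hx : Measurable fun q : ((ℕ → ℝ≥0) × (ℕ → ℝ≥0)) × (ℕ → ℝ≥0) => q.1.1 := by fun_prop
  have hy : Measurable fun q : ((ℕ → ℝ≥0) × (ℕ → ℝ≥0)) × (ℕ → ℝ≥0) => q.1.2 := by fun_prop
  have hz : Measurable fun q : ((ℕ → ℝ≥0) × (ℕ → ℝ≥0)) × (ℕ → ℝ≥0) => q.2 := by fun_prop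
  have h1 : MeasurableSet {q : ((ℕ → ℝ≥0) × (ℕ → ℝ≥0)) × (ℕ → ℝ≥0) | ∀ i, q.2 i ≤ q.1.2 i} := by
    simp only [ofPred_forall]
    exact MeasurableSet.iInter fun i => measurableSet_le (by fun_prop) (by fun_prop)
  have hm : Measurable fun q : ((ℕ → ℝ≥0) × (ℕ → ℝ≥0)) × (ℕ → ℝ≥0) =>
      branchMass θ q.1.1 q.1.2 :=
    measurable_pi_lambda _ fun j => (measurable_massMeasure_Ioc hx (measurable_withZero hy j)
      (measurable_withZero hy (j + 1))).ennreal_toReal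
  have h2 : MeasurableSet {q : ((ℕ → ℝ≥0) × (ℕ → ℝ≥0)) × (ℕ → ℝ≥0) | ∀ᶠ k : ℕ in atTop,
      ∀ j, 64 ^ k ≤ j → j < 64 ^ (k + 1) →
        height q.1.2 q.2 (branchMass θ q.1.1 q.1.2) (64 ^ k) j ≤ 160 * k / 2 ^ k} := by
    refine measurableSet_eventually_nat fun k => ?_
    simp only [ofPred_forall]
    exact MeasurableSet.iInter fun j => MeasurableSet.iInter fun _ => MeasurableSet.iInter fun _ =>
      measurableSet_le (measurable_height hy hz hm _ j) measurable_const
  convert h1.inter h2 using 1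
  ext q
  exact ⟨fun h => ⟨h.1, h.2⟩, fun h => ⟨h.1, h.2⟩⟩

theorem IsRegularCut.ae_isRegularGlue {θ x y : ℕ → ℝ≥0} (hθ : IsParameter θ) (hx : IsRegular θ x)
    (hy : IsRegularCut θ x y) {κ : Measure (ℕ → ℝ≥0)} [IsProbabilityMeasure κ]
    (hind : iIndepFun (fun i (z : ℕ → ℝ≥0) => z i) κ)
    (hlaw : ∀ i, κ.map (fun z => z i) = (massMeasure θ x)[|Iic (y i)]) :
    ∀ᵐ z ∂κ, IsRegularGlue θ x y z := by
  -- If `[0, y 0]` had no mass, conditioning on it would give the zero measure, which is not the law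
  -- of `z 0`.
  have hpos : 0 < massMeasure θ x (Iic (y 0)) := by
    rw [pos_iff_ne_zero]
    intro h0
    have h1 := Measure.isProbabilityMeasure_map (μ := κ) (f := fun z => z 0)
      (measurable_pi_apply 0).aemeasurable
    rw [hlaw 0, cond_eq_zero_of_meas_eq_zero h0] at h1
    exact (IsProbabilityMeasure.ne_zero (0 : Measure ℝ≥0)) rfl
  have hle : ∀ᵐ z ∂κ, ∀ i, z i ≤ y i := by
    rw [ae_all_iff]
    intro i
    have h1 : κ.map (fun z => z i) (Iic (y i))ᶜ = 0 := by
      rw [hlaw i, cond_apply measurableSet_Iic, inter_compl_self, measure_empty, mul_zero]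
    rw [Measure.map_apply (measurable_pi_apply i) measurableSet_Iic.compl] at h1
    exact h1
  filter_upwards [hle, ae_eventually_height_le hind hlaw hy.monotone_withZero
    (fun j => hx.massMeasure_Iic_ne_top _) hpos
    (hx.eventually_massMeasure_branch_le hθ hy.strictMono hy.hit hy.big)] with z h1 h2
  exact ⟨h1, h2⟩

/-- The variables `V j` are almost surely distinct, and distinct from `0` and `1 / 2`. -/
theorem ae_injective_of_uniform {J : Type*} [Countable J] {V : Ω → J → I}
    (hV : ∀ j, Measurable fun ω => V ω j) (hind : iIndepFun (fun j ω => V ω j) P)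
    (hlaw : ∀ j, P.map (fun ω => V ω j) = volume) :
    ∀ᵐ ω ∂P, Function.Injective (V ω) ∧ (∀ j, V ω j ≠ 0) ∧ ∀ j, (V ω j : ℝ) ≠ 1 / 2 := by
  have hpt : ∀ (t : I) j, ∀ᵐ ω ∂P, V ω j ≠ t := by
    intro t j
    have h1 : P.map (fun ω => V ω j) {t} = 0 := by
      rw [hlaw j]
      exact measure_singleton t
    rw [Measure.map_apply (hV j) (measurableSet_singleton _)] at h1
    rw [ae_iff]
    simp only [ne_eq, not_not]
    exact h1
  have hinj : ∀ᵐ ω ∂P, ∀ i j, i ≠ j → V ω i ≠ V ω j := by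
    rw [ae_all_iff]
    intro i
    rw [ae_all_iff]
    intro j
    by_cases hij : i = j
    · exact Eventually.of_forall fun _ h => absurd hij h
    filter_upwards [ae_ne_of_indepFun (hV i) (hV j) (hind.indepFun hij) fun t => by
      rw [hlaw j]
      exact measure_singleton t] with ω hω _ using hω
  filter_upwards [hinj, ae_all_iff.2 (hpt 0), ae_all_iff.2 (hpt ⟨1 / 2, by norm_num, by norm_num⟩)]
    with ω h1 h2 h3
  refine ⟨fun i j hij => ?_, h2, fun j hj => h3 j (Subtype.ext hj)⟩
  by_contra hne
  exact h1 i j hne hij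

/-- The looptree built from regular atoms, cuts and glue points is finite and compact. -/
theorem looptree_compact {θ x y z : ℕ → ℝ≥0} {uX uZ : ℕ → I} (hx : IsRegular θ x)
    (hz : IsRegularGlue θ x y z) (h : IsStick y z) {U : Tree h → Tree h → I}
    (hU : IsUniformAngle θ x h uX uZ U) :
    (∀ α β : PreLooptree θ x h U, edist α β ≠ ∞) ∧ CompactSpace (Looptree θ x h U) := by
  have hfin : ∀ n, massMeasure θ x (Iic (withZero y n)) ≠ ∞ := fun n =>
    hx.massMeasure_Iic_ne_top _
  refine edist_ne_top_and_compactSpace hU.angle hfin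
    (totallyBounded_range_vertex hU.angle (m := branchMass θ x y)
      (fun j => ENNReal.toReal_nonneg) (fun j => ?_) hfin
      -- The stages `64 ^ l` and costs `160 * l / 2 ^ l` of `IsRegularGlue`.
      (N := fun l => 64 ^ l) (tendsto_pow_atTop_atTop_of_one_lt (by norm_num))
      (c := fun l => 160 * l / 2 ^ l) ?_ hz.height_le)
  · rw [branchMass, ENNReal.ofReal_toReal]
    exact ne_top_of_le_ne_top (hfin (j + 1)) (measure_mono fun t ht => ht.2)
  · have h1 : Summable fun k : ℕ => ((k : ℝ)) ^ 1 * (1 / 2 : ℝ) ^ k :=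
      summable_pow_mul_geometric_of_norm_lt_one 1 (by norm_num)
    refine ((h1.mul_left 160).congr fun k => ?_).tsum_ofReal_ne_top
    rw [pow_one, div_pow, one_pow]
    ring

end Conditioning

end ICRT

end

/-! ### Assembly of the almost sure properties. -/

theorem mainTheorem1 (θ : ℕ → ℝ≥0) (hθ : ICRT.IsParameter θ)
    {Ω : Type*} [MeasurableSpace Ω] (P : Measure Ω) [IsProbabilityMeasure P]
    (X Y Z : Ω → ℕ → ℝ≥0) (UX UZ : Ω → ℕ → I)
    (hICRT : ICRT.IsPlaneICRT P θ X Y Z UX UZ) :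
    ∀ᵐ ω ∂P, ∃ h : ICRT.IsStick (Y ω) (Z ω),
      (∃! U, ICRT.IsUniformAngle θ (X ω) h (UX ω) (UZ ω) U) ∧
      ∀ U, ICRT.IsUniformAngle θ (X ω) h (UX ω) (UZ ω) U →
        (∀ α β : ICRT.PreLooptree θ (X ω) h U, edist α β ≠ ∞) ∧
        CompactSpace (ICRT.Looptree θ (X ω) h U) := by
  have hX := hICRT.measurable_X
  have hY := hICRT.measurable_Y
  have hZ := hICRT.measurable_Z
  have hXY : Measurable fun ω => (X ω, Y ω) := hX.prodMk hY
  have regX := ICRT.ae_isRegular hθ hX hICRT.indep_X hICRT.law_X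
  -- Regularity is obtained successively for `X`, for `Y` given a regular `X`, and for `Z` given
  -- regular `X` and `Y`.
  have regY : ∀ᵐ ω ∂P, ICRT.IsRegularCut θ (X ω) (Y ω) := by
    refine ICRT.ae_of_ae_condDistrib (p := fun q => ICRT.IsRegularCut θ q.1 q.2) hX hY
      (ICRT.measurableSet_isRegularCut θ) ?_
    filter_upwards [regX, ae_of_ae_map hX.aemeasurable hICRT.law_Y] with ω h1 h2
    exact h1.ae_isRegularCut hθ h2
  have regZ : ∀ᵐ ω ∂P, ICRT.IsRegularGlue θ (X ω) (Y ω) (Z ω) := by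
    refine ICRT.ae_of_ae_condDistrib (A := fun ω => (X ω, Y ω))
      (p := fun q => ICRT.IsRegularGlue θ q.1.1 q.1.2 q.2) hXY hZ
      (ICRT.measurableSet_isRegularGlue θ) ?_
    filter_upwards [regX, regY, ae_of_ae_map hXY.aemeasurable hICRT.indep_Z,
      ae_of_ae_map hXY.aemeasurable hICRT.law_Z] with ω h1 h2 h3 h4
    exact h2.ae_isRegularGlue hθ h1 h3 h4
  have regU := ICRT.ae_injective_of_uniform (P := P) (V := fun ω => Sum.elim (UX ω) (UZ ω))
    (fun j => by
      have hUX := hICRT.measurable_UX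
      have hUZ := hICRT.measurable_UZ
      rcases j with j | j
      · exact (measurable_pi_apply j).comp hUX
      · exact (measurable_pi_apply j).comp hUZ) hICRT.indep_U
    (fun j => by
      rcases j with j | j
      · exact hICRT.law_UX j
      · exact hICRT.law_UZ j)
  filter_upwards [regX, regY, regZ, regU,
    ICRT.ae_atom_injective hX hICRT.indep_X hICRT.law_X] with ω hx hy hz hu hinj
  have h : ICRT.IsStick (Y ω) (Z ω) := ⟨hy.strictMono, hy.tendsto, hz.le⟩
  have hg : ICRT.IsGeneric θ (X ω) (Y ω) (UX ω) (UZ ω) :=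
    ⟨hy.pos, hinj, fun i _ ⟨k, hk⟩ => hy.ne_atom k i hk, hu.1, hu.2.1, hu.2.2⟩
  exact ⟨h, hg.existsUnique_isUniformAngle h, fun U hU =>
    ICRT.looptree_compact hx hz h hU⟩
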